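/- Let $n\ge 2$ and let $X_i,Y_i,Z_i$ ($1\le i\le n$) be the Pauli operators on qubit $i$ of an open chain of $n$ qubits. For $1\le i\le n-1$ and $\vec\theta=(a,b,c,d,f,g)\in\mathbb R^6$ put $$B_i(\vec\theta)=e^{-iaZ_i}e^{-ibZ_{i+1}}e^{-icX_iX_{i+1}}e^{-idY_iY_{i+1}}e^{-ifZ_i}e^{-igZ_{i+1}} .$$ Below, a product of $B$'s written without parameters stands for such a product with arbitrary, independent parameters. For a real Lie algebra $\mathfrak g$ of matrices, "the group of $\mathfrak g$" is the group generated by $\exp(\mathfrak g)$. The cascade is $C_{i,j}=B_iB_{i+1}\cdots B_j$; the triangle is $T_N=C_{N,N}C_{N-1,N}\cdots C_{1,N}$; the zigzag $L_N$ is the product of all odd-indexed $B_k$, $k\le N$, followed by all even-indexed ones; the square $S_N$ is the product of the $C_{k,N}$ over decreasing $k\in\{1,\dots,N\}$ of parity opposite to $N$, followed by the product of the $C_{1,k}$ over decreasing odd $k\le N$. 1. (Block.) For all parameters: (fusion) $B_i(\vec\alpha)B_i(\vec\beta)=B_i(\vec a)$ for some $\vec a$; (commutation) $B_i(\vec\alpha)B_j(\vec\beta)=B_j(\vec\beta)B_i(\vec\alpha)$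 if $|i-j|>1$; (turnover) $B_i(\vec\alpha)B_{i+1}(\vec\beta)B_i(\vec\gamma)=B_{i+1}(\vec a)B_i(\vec b)B_{i+1}(\vec c)$ for some $\vec a,\vec b,\vec c$, and likewise with $i$ and $i+1$ exchanged. 2. (Two sites.) For $1\le i\le n-1$ the real Lie algebra $\mathfrak g_2^{(i)}$ generated by $iZ_i,iZ_{i+1},iX_iX_{i+1},iY_iY_{i+1}$ has basis $i\{X_iX_{i+1},Y_iY_{i+1},X_iY_{i+1},Y_iX_{i+1},Z_i,Z_{i+1}\}$. It is the direct sum of the commuting Lie subalgebras $\mathfrak g_\pm$ spanned by $\tfrac i2(X_iX_{i+1}\pm Y_iY_{i+1})$, $\tfrac i2(Z_i\mp Z_{i+1})$, $\tfrac i2(X_iY_{i+1}\mp Y_iX_{i+1})$, each isomorphic to $\mathfrak{su}(2)$. The operators $B_i(\vec\theta)$, $\vec\theta\in\mathbb R^6$, are exactly the elements of the group of $\mathfrak g_2^{(i)}$. 3. (Three sites.) For $1\le i\le n-2$ the Lie algebra $\mathfrak g_3^{(i)}$ generated by $\mathfrak g_2^{(i)}$ and $\mathfrak g_2^{(i+1)}$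 has as basis the 15 elements $i\{P_iQ_{i+1},P_{i+1}Q_{i+2},P_iZ_{i+1}Q_{i+2}\ (P,Q\in\{X,Y\}),Z_i,Z_{i+1},Z_{i+2}\}$. The fixed points of $g\mapsto Z_{i+2}\,g\,Z_{i+2}$ on it are $\mathfrak k=\mathfrak g_2^{(i)}+\mathbb R\,iZ_{i+2}$, and every $G$ in its group is $e^{k_1}e^{h}e^{k_2}$ with $k_1,k_2\in\mathfrak k$ and $h\in\mathrm{span}_{\mathbb R}\,i\{X_{i+1}X_{i+2},Y_{i+1}Y_{i+2}\}$. The fixed points of $g\mapsto Z_i\,g\,Z_i$ are $\mathfrak k'=\mathfrak g_2^{(i+1)}+\mathbb R\,iZ_i$, and every $G$ is $e^{k_1}e^{h}e^{k_2}$ with $k_1,k_2\in\mathfrak k'$ and $h\in\mathrm{span}_{\mathbb R}\,i\{X_iX_{i+1},Y_iY_{i+1}\}$. The group of $\mathfrak g_3^{(i)}$ is exactly the set of products $B_iB_{i+1}B_i$, exactly the set of products $B_{i+1}B_iB_{i+1}$, and exactly the set of triangles $T_5$ formed from the five one-parameter TFIM rotations $e^{-i\theta Z_i},e^{-i\theta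 X_iX_{i+1}},e^{-i\theta Z_{i+1}},e^{-i\theta X_{i+1}X_{i+2}},e^{-i\theta Z_{i+2}}$ taken as blocks $1,\dots,5$. 4. (Compression.) Every finite product of blocks $B_k$, $1\le k\le n-1$, equals a triangle $T_{n-1}$ and equals a square $S_{n-1}$. Both have $n(n-1)/2$ blocks. Counting layers in which no two blocks share a qubit, $T_{n-1}$ has depth at most $2n-3$ and $S_{n-1}$ depth at most $n$. 5. (Generalized TFXY model.) Let $$\mathcal H=\sum_{i=1}^{n-1}(a_iX_iX_{i+1}+b_iY_iY_{i+1}+c_iX_iY_{i+1}+d_iY_iX_{i+1})+\sum_{i=1}^nf_iZ_i$$ with real coefficients. A first-order Trotter step is the product, in some order, of the exponentials $e^{-i\Delta t\,h_\sigma\sigma}$ over all Pauli strings $\sigma$ of $\mathcal H$, with $h_\sigma$ the coefficient of $\sigma$. There is an order, not depending on the coefficients or on $\Delta t$, for which this step is a zigzag $L_{n-1}$. For any number $r$ of steps, any coefficients, time steps and orders varying from step to step, the product of the $r$ Trotter steps equals a triangle $T_{n-1}$ and equals a square $S_{n-1}$. 6. (Free fermions.) Let $\hat c_j=Z_1\cdots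 Z_{j-1}(X_j+iY_j)/2$ (Jordan–Wigner). Up to adding a real multiple of the identity, the Hamiltonians of part 5 are exactly the Hamiltonians $$\mathcal H=\sum_{i=1}^{n-1}(\alpha_i\hat c_i^\dagger\hat c_{i+1}+\alpha_i^*\hat c_{i+1}^\dagger\hat c_i+\beta_i\hat c_i\hat c_{i+1}+\beta_i^*\hat c_{i+1}^\dagger\hat c_i^\dagger)+\sum_{i=1}^n\gamma_i\hat c_i^\dagger\hat c_i ,\qquad \alpha_i,\beta_i\in\mathbb C,\ \gamma_i\in\mathbb R .$$ Let $r$ such Hamiltonians $\mathcal H_1,\dots,\mathcal H_r$ be given, each written as a finite sum $\mathcal H_k=\sum_jh_{k,j}$ of Hamiltonians of this form supported on single bonds $(i,i+1)$. Then for all real $\Delta t_k$ the Trotter circuit $\prod_{k=r}^{1}\prod_je^{-i\Delta t_kh_{k,j}}$ equals, up to a global phase, a triangle $T_{n-1}$ and (with the same phase) a square $S_{n-1}$. Hence its depth in blocks is at most $n$, independently of $r$. -/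

import Mathlib

attribute [local instance 100] LieRing.ofAssociativeRing

namespace TFXY

/-! ### Operators on a chain of `n` qubits -/

/-- Operators on `n` qubits: matrices indexed by the computational basis `{0,1}^n`. -/
abbrev Op (n : ℕ) := Matrix (Fin n → Fin 2) (Fin n → Fin 2) ℂ

def pX : Matrix (Fin 2) (Fin 2) ℂ := !![0, 1; 1, 0]

def pY : Matrix (Fin 2) (Fin 2) ℂ := !![0, -Complex.I; Complex.I, 0]

def pZ : Matrix (Fin 2) (Fin 2) ℂ := !![1, 0; 0, -1]

/-- The tensor product `A₁ ⊗ ⋯ ⊗ Aₙ` of one-qubit operators. -/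
def tensorOp {n : ℕ} (A : Fin n → Matrix (Fin 2) (Fin 2) ℂ) : Op n :=
  fun s t => ∏ j, A j (s j) (t j)

/-- The one-qubit operator `A` acting on qubit `i`; qubits are numbered `1, …, n`. -/
def site (n i : ℕ) (A : Matrix (Fin 2) (Fin 2) ℂ) : Op n :=
  tensorOp fun j => if (j : ℕ) + 1 = i then A else 1

def X (n i : ℕ) : Op n := site n i pX

def Y (n i : ℕ) : Op n := site n i pY

def Z (n i : ℕ) : Op n := site n i pZ

/-- The rotation `exp(-iθP)`. -/
noncomputable def rot {n : ℕ} (P : Op n) (θ : ℝ) : Op n :=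
  NormedSpace.exp ((-(Complex.I * (θ : ℂ))) • P)

/-! ### Blocks and circuits made of blocks -/

/-- `B_1(θ), …, B_N(θ)` are blocks: fusion, commutation and turnover. -/
structure IsBlock {M P : Type*} [Monoid M] (N : ℕ) (B : ℕ → P → M) : Prop where
  fusion : ∀ i, 1 ≤ i → i ≤ N → ∀ α β : P, ∃ a : P, B i α * B i β = B i a
  commutation : ∀ i j, 1 ≤ i → i ≤ N → 1 ≤ j → j ≤ N → (i + 1 < j ∨ j + 1 < i) →
    ∀ α β : P, B i α * B j β = B j β * B i α
  turnover : ∀ i, 1 ≤ i → i + 1 ≤ N → ∀ α β γ : P, ∃ a b c : P,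
    B i α * B (i + 1) β * B i γ = B (i + 1) a * B i b * B (i + 1) c

/-- The set of all products `B_{k₁}(θ₁) B_{k₂}(θ₂) ⋯` whose sequence of block indices is the
list `idx = [k₁, k₂, …]`; every block carries its own parameters. -/
def blockProducts {M P : Type*} [Monoid M] (B : ℕ → P → M) (idx : List ℕ) : Set M :=
  {U | ∃ C : List (ℕ × P), C.map Prod.fst = idx ∧ (C.map fun g => B g.1 g.2).prod = U}

/-- Indices of the cascade `C_{i,j} = B_i B_{i+1} ⋯ B_j`. -/
def cascadeIdx (i j : ℕ) : List ℕ := List.range' i (j + 1 - i)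

/-- Indices of the triangle `T_N = C_{N,N} C_{N-1,N} ⋯ C_{1,N}`. -/
def triangleIdx (N : ℕ) : List ℕ :=
  (List.range' 1 N).reverse.flatMap fun k => cascadeIdx k N

/-- Indices of the zigzag: first all odd blocks `B_1 B_3 ⋯`, then all even ones `B_2 B_4 ⋯`. -/
def zigzagIdx (N : ℕ) : List ℕ :=
  (List.range' 1 N).filter (fun k => k % 2 = 1) ++ (List.range' 1 N).filter (fun k => k % 2 = 0)

/-- Indices of the square `S_N`: the cascades `C_{k,N}` over decreasing `k` of parity opposite to
that of `N`, followed by the cascades `C_{1,k}` over decreasing odd `k`. -/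
def squareIdx (N : ℕ) : List ℕ :=
  ((List.range' 1 N).reverse.filter fun k => k % 2 ≠ N % 2).flatMap (fun k => cascadeIdx k N) ++
    ((List.range' 1 N).reverse.filter fun k => k % 2 = 1).flatMap (fun k => cascadeIdx 1 k)

/-- A circuit whose blocks `B_k` act on qubits `k, k+1` can be executed in `d` time layers: one
can assign layers to the blocks so that of two blocks sharing a qubit the one that comes first in
the circuit is in a strictly earlier layer. -/
def HasDepthLE (idx : List ℕ) (d : ℕ) : Prop :=
  ∃ t : Fin idx.length → Fin d, ∀ p q, p < q →
    idx.get p ≤ idx.get q + 1 → idx.get q ≤ idx.get p + 1 → t p < t q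

/-- The six-parameter TFXY block on qubits `i, i+1`. -/
noncomputable def block (n i : ℕ) (θ : Fin 6 → ℝ) : Op n :=
  rot (Z n i) (θ 0) * rot (Z n (i + 1)) (θ 1) * rot (X n i * X n (i + 1)) (θ 2) *
    rot (Y n i * Y n (i + 1)) (θ 3) * rot (Z n i) (θ 4) * rot (Z n (i + 1)) (θ 5)

/-- The TFIM blocks: `B_{2i-1}(θ) = exp(-iθ Z_i)` and `B_{2i}(θ) = exp(-iθ X_i X_{i+1})`. -/
noncomputable def tfimBlock (n k : ℕ) (θ : ℝ) : Op n :=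
  if k % 2 = 1 then rot (Z n ((k + 1) / 2)) θ else rot (X n (k / 2) * X n (k / 2 + 1)) θ

/-! ### Hamiltonian algebras -/

/-- The real Lie algebra `su(2)`: traceless anti-Hermitian `2 × 2` matrices. -/
def su2 : LieSubalgebra ℝ (Matrix (Fin 2) (Fin 2) ℂ) where
  carrier := {A | A.conjTranspose = -A ∧ A.trace = 0}
  add_mem' := by
    rintro A B ⟨hA, hA'⟩ ⟨hB, hB'⟩
    refine ⟨?_, ?_⟩
    · rw [Matrix.conjTranspose_add, hA, hB, neg_add]
    · rw [Matrix.trace_add, hA', hB', add_zero]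
  zero_mem' := by simp
  smul_mem' := by
    rintro c A ⟨hA, hA'⟩
    refine ⟨?_, ?_⟩
    · rw [Matrix.conjTranspose_smul, hA]; simp
    · rw [Matrix.trace_smul, hA', smul_zero]
  lie_mem' := by
    rintro A B ⟨hA, hA'⟩ ⟨hB, hB'⟩
    refine ⟨?_, ?_⟩
    · rw [Ring.lie_def, Matrix.conjTranspose_sub, Matrix.conjTranspose_mul,
        Matrix.conjTranspose_mul, hA, hB]
      simp
    · rw [Ring.lie_def, Matrix.trace_sub, Matrix.trace_mul_comm, sub_self]

/-- The group with Lie algebra `g`: all finite products of exponentials of elements of `g`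
(closed under inverses because `g = -g`). -/
noncomputable def expGroup {n : ℕ} (g : LieSubalgebra ℝ (Op n)) : Submonoid (Op n) :=
  Submonoid.closure {U | ∃ x ∈ g, NormedSpace.exp x = U}

/-- `i` times each of the exponents of the block on qubits `i, i+1`. -/
def exponents (n i : ℕ) : Set (Op n) :=
  {Complex.I • Z n i, Complex.I • Z n (i + 1), Complex.I • (X n i * X n (i + 1)),
    Complex.I • (Y n i * Y n (i + 1))}

/-- `g(TFXY₂)` on qubits `i, i+1`: the Lie algebra generated by the exponents of one block. -/
noncomputable def g2 (n i : ℕ) : LieSubalgebra ℝ (Op n) :=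
  LieSubalgebra.lieSpan ℝ (Op n) (exponents n i)

/-- `g(TFXY₃)` on qubits `i, i+1, i+2`: generated by the exponents of two adjacent blocks. -/
noncomputable def g3 (n i : ℕ) : LieSubalgebra ℝ (Op n) :=
  LieSubalgebra.lieSpan ℝ (Op n) (exponents n i ∪ exponents n (i + 1))

def g2Basis (n i : ℕ) : Fin 6 → Op n :=
  ![Complex.I • (X n i * X n (i + 1)), Complex.I • (Y n i * Y n (i + 1)),
    Complex.I • (X n i * Y n (i + 1)), Complex.I • (Y n i * X n (i + 1)),
    Complex.I • Z n i, Complex.I • Z n (i + 1)]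

def g3Basis (n i : ℕ) : Fin 15 → Op n :=
  ![Complex.I • (X n i * X n (i + 1)), Complex.I • (Y n i * Y n (i + 1)),
    Complex.I • (X n i * Y n (i + 1)), Complex.I • (Y n i * X n (i + 1)),
    Complex.I • (X n (i + 1) * X n (i + 2)), Complex.I • (Y n (i + 1) * Y n (i + 2)),
    Complex.I • (X n (i + 1) * Y n (i + 2)), Complex.I • (Y n (i + 1) * X n (i + 2)),
    Complex.I • Z n i, Complex.I • Z n (i + 1), Complex.I • Z n (i + 2),
    Complex.I • (X n i * Z n (i + 1) * X n (i + 2)),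
    Complex.I • (X n i * Z n (i + 1) * Y n (i + 2)),
    Complex.I • (Y n i * Z n (i + 1) * X n (i + 2)),
    Complex.I • (Y n i * Z n (i + 1) * Y n (i + 2))]

noncomputable def gPlusBasis (n i : ℕ) : Fin 3 → Op n :=
  ![(Complex.I / 2) • (X n i * X n (i + 1) + Y n i * Y n (i + 1)),
    (Complex.I / 2) • (Z n i - Z n (i + 1)),
    (Complex.I / 2) • (X n i * Y n (i + 1) - Y n i * X n (i + 1))]

noncomputable def gMinusBasis (n i : ℕ) : Fin 3 → Op n :=
  ![(Complex.I / 2) • (X n i * X n (i + 1) - Y n i * Y n (i + 1)),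
    (Complex.I / 2) • (Z n i + Z n (i + 1)),
    (Complex.I / 2) • (X n i * Y n (i + 1) + Y n i * X n (i + 1))]

noncomputable def gPlus (n i : ℕ) : LieSubalgebra ℝ (Op n) :=
  LieSubalgebra.lieSpan ℝ (Op n) (Set.range (gPlusBasis n i))

noncomputable def gMinus (n i : ℕ) : LieSubalgebra ℝ (Op n) :=
  LieSubalgebra.lieSpan ℝ (Op n) (Set.range (gMinusBasis n i))

/-! ### The generalized TFXY Hamiltonian and its Trotter circuits -/

/-- The kinds of Pauli strings `X_i X_{i+1}`, `Y_i Y_{i+1}`, `X_i Y_{i+1}`, `Y_i X_{i+1}`, `Z_i`. -/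
inductive Kind
  | xx | yy | xy | yx | z

def pauliTerm (n : ℕ) : Kind × ℕ → Op n
  | (Kind.xx, i) => X n i * X n (i + 1)
  | (Kind.yy, i) => Y n i * Y n (i + 1)
  | (Kind.xy, i) => X n i * Y n (i + 1)
  | (Kind.yx, i) => Y n i * X n (i + 1)
  | (Kind.z, i) => Z n i

/-- The Pauli strings present in the open chain of `n` qubits. -/
def IsTerm (n : ℕ) : Kind × ℕ → Prop
  | (Kind.z, i) => 1 ≤ i ∧ i ≤ n
  | (_, i) => 1 ≤ i ∧ i + 1 ≤ n

/-- The generalized TFXY Hamiltonian with real coefficients `h kind i` and open boundaries; the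
TFXY Hamiltonian is the case `h xy = h yx = 0`. -/
noncomputable def tfxyHamiltonian (n : ℕ) (h : Kind × ℕ → ℝ) : Op n :=
  ∑ i ∈ Finset.Icc 1 (n - 1),
      (h (Kind.xx, i) • (X n i * X n (i + 1)) + h (Kind.yy, i) • (Y n i * Y n (i + 1)) +
        h (Kind.xy, i) • (X n i * Y n (i + 1)) + h (Kind.yx, i) • (Y n i * X n (i + 1))) +
    ∑ i ∈ Finset.Icc 1 n, h (Kind.z, i) • Z n i

/-- An order of multiplication for a Trotter step: every Pauli string of the chain once. -/
def IsTermOrder (n : ℕ) (l : List (Kind × ℕ)) : Prop :=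
  l.Nodup ∧ ∀ τ, τ ∈ l ↔ IsTerm n τ

/-- One first-order Trotter step of `tfxyHamiltonian n h`, multiplied in the order `l`. -/
noncomputable def trotterStep (n : ℕ) (h : Kind × ℕ → ℝ) (dt : ℝ) (l : List (Kind × ℕ)) : Op n :=
  (l.map fun τ => rot (pauliTerm n τ) (dt * h τ)).prod

/-! ### Free fermions -/

/-- The fermion annihilation operator on site `j` in the Jordan–Wigner representation,
`c_j = Z_1 ⋯ Z_{j-1} (X_j + i Y_j)/2`. -/
noncomputable def annih (n j : ℕ) : Op n :=
  tensorOp fun k =>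
    if (k : ℕ) + 1 < j then pZ
    else if (k : ℕ) + 1 = j then (1 / 2 : ℂ) • (pX + Complex.I • pY) else 1

noncomputable def creat (n j : ℕ) : Op n := (annih n j).conjTranspose

/-- Hopping and pairing between the sites `i` and `i+1`. -/
noncomputable def hopPair (n i : ℕ) (α β : ℂ) : Op n :=
  α • (creat n i * annih n (i + 1)) + star α • (creat n (i + 1) * annih n i) +
    β • (annih n i * annih n (i + 1)) + star β • (creat n (i + 1) * creat n i)

/-- The general free-fermion Hamiltonian on an open chain with nearest-neighbour terms. -/
noncomputable def fermionHamiltonian (n : ℕ) (α β : ℕ → ℂ) (γ : ℕ → ℝ) : Op n :=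
  ∑ i ∈ Finset.Icc 1 (n - 1), hopPair n i (α i) (β i) +
    ∑ i ∈ Finset.Icc 1 n, γ i • (creat n i * annih n i)

/-- A free-fermion Hamiltonian supported on one bond `(bond, bond + 1)`. -/
structure BondTerm where
  bond : ℕ
  hop : ℂ
  pair : ℂ
  occL : ℝ
  occR : ℝ

noncomputable def BondTerm.op (n : ℕ) (p : BondTerm) : Op n :=
  hopPair n p.bond p.hop p.pair + p.occL • (creat n p.bond * annih n p.bond) +
    p.occR • (creat n (p.bond + 1) * annih n (p.bond + 1))

/-- `l` splits the Hamiltonian `H` on `n` sites into free-fermion terms on single bonds. -/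
def IsBondSplitting (n : ℕ) (l : List BondTerm) (H : Op n) : Prop :=
  (∀ p ∈ l, 1 ≤ p.bond ∧ p.bond + 1 ≤ n) ∧ (l.map (BondTerm.op n)).sum = H

/-- The first-order Trotter step belonging to such a splitting. -/
noncomputable def fermionTrotterStep (n : ℕ) (dt : ℝ) (l : List BondTerm) : Op n :=
  (l.map fun p => rot (p.op n) dt).prod

end TFXY

open TFXY

namespace TFXY

/-! ### Tensor products of one-qubit operators -/

/-! The Jordan–Wigner Majorana operators `maj n 1, …, maj n (2n)` square to one and anticommute
pairwise, and `i` times every Pauli string in the theorem is, up to sign, a product of two of them.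
The bivectors of 4 consecutive Majoranas form `so(4) = su(2) ⊕ su(2)`, the two-site algebra, and
those of 6 form `so(6)`, the three-site algebra.

The adjacent generators `P_k = -i γ_k γ_{k+1}` (`tfimGen`) are involutions. Neighbours anticommute,
so `1, -iA, -iB, -AB` multiply like quaternions and every unit quaternion is an Euler product in
either order, `ABA` or `BAB` (`rot_turnover`); the other pairs commute. In the monoid of subsets
with pointwise product, the circles of rotations about the `P_k` therefore satisfy the relations of
the 0-Hecke monoid (`tfim_isHecke`). There the triangle spells the longest element and absorbs every
generator (`IsHecke.triangle_mul`), so the triangle is the whole generated group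
(`IsHecke.closure_eq_triangle`).

Being a finite product of circles, that group is compact, hence closed. The Lie product formula then
puts the exponential of every combination of bivectors into it (`exp_add_mem_of_isCompact`), which
identifies it with the group of the Lie algebra (`expGroup_eq_rotGroup`).

A six-parameter block is a pair of independent Euler products, one in each eigenspace of `Z_i
Z_{i+1}` (`IsChiral.chiralBlock_eq`). Blocks are thus closed under products and fill the group of
three adjacent TFIM generators (`range_block`). The longest word on five generators factors through
right, left and right triples (`IsHecke.triangle_five`), and by reflection through left, right and
left ones. Both block products therefore equal the three-site group, which is the turnover of blocks
(`block_braid`); factoring the outer and middle blocks also gives the Cartan decompositions.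

So the blocks satisfy the same 0-Hecke relations (`block_isHecke`), and the triangle absorbs every
circuit. Sliding every other cascade through the others turns the triangle into the square
(`IsHecke.cascades_eq`). Each Trotter factor lies in a two-site group, in the fermionic case after
removing a multiple of the identity that becomes a phase. -/

theorem tensorOp_mul {n : ℕ} (A B : Fin n → Matrix (Fin 2) (Fin 2) ℂ) :
    tensorOp A * tensorOp B = tensorOp fun j => A j * B j := by
  ext s t
  simp only [tensorOp, Matrix.mul_apply, ← Finset.prod_mul_distrib]
  -- Distributivity: a product over qubits of one-qubit sums is a sum over intermediate basis
  -- states.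
  rw [Finset.prod_univ_sum]
  simp

theorem tensorOp_one {n : ℕ} : (tensorOp fun _ => 1 : Op n) = 1 := by
  ext s t
  simp only [tensorOp, Matrix.one_apply]
  by_cases h : s = t
  · simp [h]
  · obtain ⟨j, hj⟩ := Function.ne_iff.1 h
    rw [if_neg h]
    exact Finset.prod_eq_zero (Finset.mem_univ j) (if_neg hj)

theorem tensorOp_conjTranspose {n : ℕ} (A : Fin n → Matrix (Fin 2) (Fin 2) ℂ) :
    (tensorOp A).conjTranspose = tensorOp fun j => (A j).conjTranspose := by
  ext s t
  simp [tensorOp, Matrix.conjTranspose_apply]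

theorem tensorOp_commute {n : ℕ} {A B : Fin n → Matrix (Fin 2) (Fin 2) ℂ}
    (h : ∀ j, Commute (A j) (B j)) : Commute (tensorOp A) (tensorOp B) := by
  rw [Commute, SemiconjBy, tensorOp_mul, tensorOp_mul]
  exact congrArg tensorOp (funext fun j => h j)

theorem site_mul (n i : ℕ) (A B : Matrix (Fin 2) (Fin 2) ℂ) :
    site n i A * site n i B = site n i (A * B) := by
  rw [site, site, tensorOp_mul, site]
  congr 1; funext j; split_ifs <;> simp

theorem site_one (n i : ℕ) : site n i 1 = 1 := by
  rw [site, ← tensorOp_one]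
  congr 1; funext j; split_ifs <;> rfl

theorem site_commute {n i j : ℕ} (h : i ≠ j) (A B : Matrix (Fin 2) (Fin 2) ℂ) :
    Commute (site n i A) (site n j B) := by
  apply tensorOp_commute
  intro k
  split_ifs with h1 h2
  · omega
  · exact Commute.one_right _
  · exact Commute.one_left _
  · exact Commute.one_left _

/-- Isolates the only factor containing `A`, which makes linearity in `A` visible. The bounds
matter: off the chain `site n i A` is `1` and linearity fails. -/
theorem site_apply {n i : ℕ} (h1 : 1 ≤ i) (h2 : i ≤ n) (A : Matrix (Fin 2) (Fin 2) ℂ)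
    (s t : Fin n → Fin 2) :
    site n i A s t = A (s ⟨i - 1, by omega⟩) (t ⟨i - 1, by omega⟩) *
      ∏ j ∈ Finset.univ.erase (⟨i - 1, by omega⟩ : Fin n),
        (1 : Matrix (Fin 2) (Fin 2) ℂ) (s j) (t j) := by
  rw [site, tensorOp, ← Finset.mul_prod_erase _ _ (Finset.mem_univ (⟨i - 1, by omega⟩ : Fin n))]
  congr 1
  · rw [if_pos]; simp; omega
  · refine Finset.prod_congr rfl fun j hj => ?_
    rw [if_neg]
    intro h
    apply Finset.ne_of_mem_erase hj
    ext; simp; omega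

theorem site_add {n i : ℕ} (h1 : 1 ≤ i) (h2 : i ≤ n) (A B : Matrix (Fin 2) (Fin 2) ℂ) :
    site n i (A + B) = site n i A + site n i B := by
  ext s t
  simp only [site_apply h1 h2, Matrix.add_apply, add_mul]

theorem site_smul {n i : ℕ} (h1 : 1 ≤ i) (h2 : i ≤ n) (c : ℂ) (A : Matrix (Fin 2) (Fin 2) ℂ) :
    site n i (c • A) = c • site n i A := by
  ext s t
  simp only [site_apply h1 h2, Matrix.smul_apply, smul_eq_mul, mul_assoc]

theorem site_conjTranspose (n i : ℕ) (A : Matrix (Fin 2) (Fin 2) ℂ) :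
    (site n i A).conjTranspose = site n i A.conjTranspose := by
  rw [site, tensorOp_conjTranspose, site]
  congr 1; funext j; split_ifs <;> simp

/-! ### One-qubit Pauli identities. -/

theorem pX_mul_pX : pX * pX = 1 := by
  ext i j; fin_cases i <;> fin_cases j <;> simp [pX, Matrix.mul_apply]

theorem pY_mul_pY : pY * pY = 1 := by
  ext i j; fin_cases i <;> fin_cases j <;> simp [pY, Matrix.mul_apply]

theorem pZ_mul_pZ : pZ * pZ = 1 := by
  ext i j; fin_cases i <;> fin_cases j <;> simp [pZ, Matrix.mul_apply]

theorem pX_mul_pY : pX * pY = Complex.I • pZ := by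
  ext i j; fin_cases i <;> fin_cases j <;> simp [pX, pY, pZ, Matrix.mul_apply]

theorem pY_mul_pX : pY * pX = (-Complex.I) • pZ := by
  ext i j; fin_cases i <;> fin_cases j <;> simp [pX, pY, pZ, Matrix.mul_apply]

theorem pY_mul_pZ : pY * pZ = Complex.I • pX := by
  ext i j; fin_cases i <;> fin_cases j <;> simp [pX, pY, pZ, Matrix.mul_apply]

theorem pZ_mul_pY : pZ * pY = (-Complex.I) • pX := by
  ext i j; fin_cases i <;> fin_cases j <;> simp [pX, pY, pZ, Matrix.mul_apply]

theorem pX_mul_pZ : pX * pZ = (-Complex.I) • pY := by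
  ext i j; fin_cases i <;> fin_cases j <;> simp [pX, pY, pZ, Matrix.mul_apply]

theorem pZ_mul_pX : pZ * pX = Complex.I • pY := by
  ext i j; fin_cases i <;> fin_cases j <;> simp [pX, pY, pZ, Matrix.mul_apply]

theorem pX_conjTranspose : pX.conjTranspose = pX := by
  ext i j; fin_cases i <;> fin_cases j <;> simp [pX, Matrix.conjTranspose_apply]

theorem pY_conjTranspose : pY.conjTranspose = pY := by
  ext i j; fin_cases i <;> fin_cases j <;> simp [pY, Matrix.conjTranspose_apply]

theorem pZ_conjTranspose : pZ.conjTranspose = pZ := by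
  ext i j; fin_cases i <;> fin_cases j <;> simp [pZ, Matrix.conjTranspose_apply]

/-! ### Majorana operators -/

/-- The Jordan–Wigner string `Z_1 ⋯ Z_{j-1}`. -/
def zString (n j : ℕ) : Op n := tensorOp fun k => if (k : ℕ) + 1 < j then pZ else 1

theorem zString_mul_self (n j : ℕ) : zString n j * zString n j = 1 := by
  rw [zString, tensorOp_mul, ← tensorOp_one]
  congr 1; funext k; split_ifs
  · exact pZ_mul_pZ
  · exact one_mul 1

theorem zString_commute (n i j : ℕ) : Commute (zString n i) (zString n j) := by
  apply tensorOp_commute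
  intro k
  split_ifs
  · exact Commute.refl _
  · exact Commute.one_right _
  · exact Commute.one_left _
  · exact Commute.one_left _

theorem zString_commute_site {n i j : ℕ} (h : j ≤ i) (A : Matrix (Fin 2) (Fin 2) ℂ) :
    Commute (zString n j) (site n i A) := by
  apply tensorOp_commute
  intro k
  split_ifs
  · omega
  · exact Commute.one_right _
  · exact Commute.one_left _
  · exact Commute.one_left _

theorem zString_succ (n j : ℕ) : zString n (j + 1) = zString n j * Z n j := by
  rw [Z, site, zString, zString, tensorOp_mul]
  congr 1; funext k
  split_ifs <;> first | omega | simp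

theorem zString_conjTranspose (n j : ℕ) : (zString n j).conjTranspose = zString n j := by
  rw [zString, tensorOp_conjTranspose]
  congr 1; funext k; split_ifs
  · exact pZ_conjTranspose
  · simp

/-- A string ending beyond `i` contains exactly one `Z` on qubit `i`, and only that factor fails to
commute with `A`. -/
theorem site_mul_zString {n i j : ℕ} (h1 : 1 ≤ i) (h2 : i ≤ n) (h : i < j)
    {A : Matrix (Fin 2) (Fin 2) ℂ} (hA : A * pZ = (-1 : ℂ) • (pZ * A)) :
    site n i A * zString n j = -(zString n j * site n i A) := by
  induction j, h using Nat.le_induction with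
  | base =>
    rw [zString_succ, ← mul_assoc, ← (zString_commute_site le_rfl A).eq, mul_assoc, Z, site_mul, hA,
      site_smul h1 h2, ← site_mul]
    simp [mul_assoc]
  | succ j hj ih =>
    rw [zString_succ, ← mul_assoc, ih, neg_mul, mul_assoc, mul_assoc, Z,
      (site_commute (by omega : i ≠ j) A pZ).eq]

/-- The string operator `Z_1 ⋯ Z_{j-1} A_j`. -/
def strOp (n j : ℕ) (A : Matrix (Fin 2) (Fin 2) ℂ) : Op n := zString n j * site n j A

theorem strOp_mul_strOp_self (n j : ℕ) (A B : Matrix (Fin 2) (Fin 2) ℂ) :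
    strOp n j A * strOp n j B = site n j (A * B) := by
  rw [strOp, strOp, (zString_commute_site le_rfl A).eq, mul_assoc, ← mul_assoc (zString n j),
    zString_mul_self, one_mul, site_mul]

/-- The sign arises when `A` on qubit `i` passes the longer string; `B` sits on another qubit and
beyond the shorter string. -/
theorem strOp_anticomm {n i j : ℕ} (h1 : 1 ≤ i) (h2 : i ≤ n) (h : i < j)
    {A B : Matrix (Fin 2) (Fin 2) ℂ} (hA : A * pZ = (-1 : ℂ) • (pZ * A)) :
    strOp n i A * strOp n j B = -(strOp n j B * strOp n i A) := by
  calc strOp n i A * strOp n j B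
      = zString n i * (site n i A * zString n j) * site n j B := by simp only [strOp, mul_assoc]
    _ = -(zString n i * zString n j * (site n i A * site n j B)) := by
        rw [site_mul_zString h1 h2 h hA]; simp [mul_assoc]
    _ = -(zString n j * (zString n i * site n j B) * site n i A) := by
        rw [(zString_commute n i j).eq, (site_commute h.ne A B).eq]; simp only [mul_assoc]
    _ = _ := by
        rw [(zString_commute_site h.le B).eq]; simp only [strOp, mul_assoc]

/-- The Majorana operators `γ_1, …, γ_{2n}`: `γ_{2j-1} = Z_1 ⋯ Z_{j-1} X_j` and
`γ_{2j} = Z_1 ⋯ Z_{j-1} Y_j`. -/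
def maj (n a : ℕ) : Op n := if a % 2 = 1 then strOp n ((a + 1) / 2) pX else strOp n (a / 2) pY

theorem maj_odd (n j : ℕ) : maj n (2 * j + 1) = strOp n (j + 1) pX := by
  rw [maj, if_pos (by omega)]; congr 1; omega

theorem maj_even (n j : ℕ) : maj n (2 * j + 2) = strOp n (j + 1) pY := by
  rw [maj, if_neg (by omega)]; congr 1; omega

theorem maj_mul_self (n a : ℕ) : maj n a * maj n a = 1 := by
  rw [maj]
  split_ifs
  · rw [strOp_mul_strOp_self, pX_mul_pX, site_one]
  · rw [strOp_mul_strOp_self, pY_mul_pY, site_one]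

theorem maj_anticomm_of_lt {n a b : ℕ} (h1 : 1 ≤ a) (h : a < b) (h2 : b ≤ 2 * n) :
    maj n a * maj n b = -(maj n b * maj n a) := by
  have hX : pX * pZ = (-1 : ℂ) • (pZ * pX) := by rw [pX_mul_pZ, pZ_mul_pX]; simp
  have hY : pY * pZ = (-1 : ℂ) • (pZ * pY) := by rw [pY_mul_pZ, pZ_mul_pY]; simp
  rw [maj, maj]
  split_ifs with ha hb hb
  · exact strOp_anticomm (by omega) (by omega) (by omega) hX
  · rcases Nat.lt_or_ge ((a + 1) / 2) (b / 2) with h' | h'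
    · exact strOp_anticomm (by omega) (by omega) h' hX
    -- Both operators end on the same qubit: the strings cancel and the sign is that of `XY = -YX`.
    · have : (a + 1) / 2 = b / 2 := by omega
      rw [this, strOp_mul_strOp_self, strOp_mul_strOp_self, pX_mul_pY, pY_mul_pX,
        site_smul (by omega) (by omega), site_smul (by omega) (by omega)]
      simp
  · exact strOp_anticomm (by omega) (by omega) (by omega) hY
  · exact strOp_anticomm (by omega) (by omega) (by omega) hY

theorem maj_anticomm {n a b : ℕ} (ha : 1 ≤ a) (ha' : a ≤ 2 * n) (hb : 1 ≤ b) (hb' : b ≤ 2 * n)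
    (h : a ≠ b) : maj n a * maj n b = -(maj n b * maj n a) := by
  rcases Nat.lt_or_ge a b with h' | h'
  · exact maj_anticomm_of_lt ha h' hb'
  · rw [maj_anticomm_of_lt hb (by omega) ha', neg_neg]

/-! ### Pauli strings as products of two Majorana operators -/

/-- The two strings cancel up to one leftover `Z` on qubit `j`, which merges with `A`. -/
theorem strOp_mul_strOp_succ (n j : ℕ) (A B : Matrix (Fin 2) (Fin 2) ℂ) :
    strOp n j A * strOp n (j + 1) B = site n j (A * pZ) * site n (j + 1) B := by
  rw [strOp, strOp, zString_succ, (zString_commute_site le_rfl A).eq, ← site_mul, Z]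
  simp only [mul_assoc]
  rw [← mul_assoc (zString n j) (zString n j), zString_mul_self, one_mul]

theorem strOp_mul_strOp_add_two (n j : ℕ) (A B : Matrix (Fin 2) (Fin 2) ℂ) :
    strOp n j A * strOp n (j + 2) B = site n j (A * pZ) * Z n (j + 1) * site n (j + 2) B := by
  rw [strOp, strOp, zString_succ, zString_succ, (zString_commute_site le_rfl A).eq, ← site_mul, Z,
    Z]
  simp only [mul_assoc]
  rw [← mul_assoc (zString n j) (zString n j), zString_mul_self, one_mul]

variable {n j : ℕ}

theorem I_smul_Z (hj : j < n) :
    Complex.I • Z n (j + 1) = maj n (2 * j + 1) * maj n (2 * j + 2) := by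
  rw [maj_odd, maj_even, strOp_mul_strOp_self, pX_mul_pY, site_smul (by omega) (by omega), Z]

theorem I_smul_XX (hj : j + 1 < n) : Complex.I • (X n (j + 1) * X n (j + 2)) =
    maj n (2 * j + 2) * maj n (2 * j + 3) := by
  rw [maj_even, show 2 * j + 3 = 2 * (j + 1) + 1 by ring, maj_odd, strOp_mul_strOp_succ, pY_mul_pZ,
    site_smul (by omega) (by omega), smul_mul_assoc, X, X]

theorem I_smul_XY (hj : j + 1 < n) : Complex.I • (X n (j + 1) * Y n (j + 2)) =
    maj n (2 * j + 2) * maj n (2 * j + 4) := by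
  rw [maj_even, show 2 * j + 4 = 2 * (j + 1) + 2 by ring, maj_even, strOp_mul_strOp_succ, pY_mul_pZ,
    site_smul (by omega) (by omega), smul_mul_assoc, X, Y]

theorem I_smul_YX (hj : j + 1 < n) : Complex.I • (Y n (j + 1) * X n (j + 2)) =
    -(maj n (2 * j + 1) * maj n (2 * j + 3)) := by
  rw [maj_odd, show 2 * j + 3 = 2 * (j + 1) + 1 by ring, maj_odd, strOp_mul_strOp_succ, pX_mul_pZ,
    site_smul (by omega) (by omega), smul_mul_assoc, X, Y, neg_smul, neg_neg]

theorem I_smul_YY (hj : j + 1 < n) : Complex.I • (Y n (j + 1) * Y n (j + 2)) =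
    -(maj n (2 * j + 1) * maj n (2 * j + 4)) := by
  rw [maj_odd, show 2 * j + 4 = 2 * (j + 1) + 2 by ring, maj_even, strOp_mul_strOp_succ, pX_mul_pZ,
    site_smul (by omega) (by omega), smul_mul_assoc, Y, Y, neg_smul, neg_neg]

theorem I_smul_XZX (hj : j + 2 < n) : Complex.I • (X n (j + 1) * Z n (j + 2) * X n (j + 3)) =
    maj n (2 * j + 2) * maj n (2 * j + 5) := by
  rw [maj_even, show 2 * j + 5 = 2 * (j + 2) + 1 by ring, maj_odd, strOp_mul_strOp_add_two,
    pY_mul_pZ, site_smul (by omega) (by omega), smul_mul_assoc, smul_mul_assoc, X, X]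

theorem I_smul_XZY (hj : j + 2 < n) : Complex.I • (X n (j + 1) * Z n (j + 2) * Y n (j + 3)) =
    maj n (2 * j + 2) * maj n (2 * j + 6) := by
  rw [maj_even, show 2 * j + 6 = 2 * (j + 2) + 2 by ring, maj_even, strOp_mul_strOp_add_two,
    pY_mul_pZ, site_smul (by omega) (by omega), smul_mul_assoc, smul_mul_assoc, X, Y]

theorem I_smul_YZX (hj : j + 2 < n) : Complex.I • (Y n (j + 1) * Z n (j + 2) * X n (j + 3)) =
    -(maj n (2 * j + 1) * maj n (2 * j + 5)) := by
  rw [maj_odd, show 2 * j + 5 = 2 * (j + 2) + 1 by ring, maj_odd, strOp_mul_strOp_add_two,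
    pX_mul_pZ, site_smul (by omega) (by omega), smul_mul_assoc, smul_mul_assoc, X, Y, neg_smul,
    neg_neg]

theorem I_smul_YZY (hj : j + 2 < n) : Complex.I • (Y n (j + 1) * Z n (j + 2) * Y n (j + 3)) =
    -(maj n (2 * j + 1) * maj n (2 * j + 6)) := by
  rw [maj_odd, show 2 * j + 6 = 2 * (j + 2) + 2 by ring, maj_even, strOp_mul_strOp_add_two,
    pX_mul_pZ, site_smul (by omega) (by omega), smul_mul_assoc, smul_mul_assoc, Y, Y, neg_smul,
    neg_neg]

/-- The generators `Z_1, X_1X_2, Z_2, X_2X_3, …, Z_n` of the TFIM. -/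
noncomputable def tfimGen (n k : ℕ) : Op n := (-Complex.I) • (maj n k * maj n (k + 1))

theorem tfimBlock_eq_rot {k : ℕ} (h1 : 1 ≤ k) (h2 : k + 1 ≤ 2 * n) (θ : ℝ) :
    tfimBlock n k θ = rot (tfimGen n k) θ := by
  rw [tfimBlock, tfimGen]
  split_ifs with h
  · obtain ⟨m, rfl⟩ : ∃ m, k = 2 * m + 1 := ⟨k / 2, by omega⟩
    rw [← I_smul_Z (by omega), show (2 * m + 1 + 1) / 2 = m + 1 by omega]
    simp [smul_smul]
  · obtain ⟨m, rfl⟩ : ∃ m, k = 2 * m + 2 := ⟨k / 2 - 1, by omega⟩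
    rw [← I_smul_XX (by omega), show (2 * m + 2) / 2 = m + 1 by omega]
    simp [smul_smul]

end TFXY

/-! ### Exponentials of sums and compact submonoids -/

/-- Telescoping of `a^k - b^k`. The trailing power of `b` is carried along so that the induction
closes with bounds on powers only, without assuming that `a` and `b` have norm at most one. -/
theorem norm_pow_sub_pow_mul_le {𝔸 : Type*} [NormedRing 𝔸] {a b : 𝔸} {m : ℕ} {K L : ℝ}
    (ha : ∀ k ≤ m, ‖a ^ k‖ ≤ K) (hb : ∀ k ≤ m, ‖b ^ k‖ ≤ L) (k : ℕ) :
    ∀ j, k + j ≤ m → ‖(a ^ k - b ^ k) * b ^ j‖ ≤ k * (K * ‖a - b‖ * L) := by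
  have hK : 0 ≤ K := (norm_nonneg _).trans (ha 0 (Nat.zero_le _))
  induction k with
  | zero => intro j _; simp
  | succ k ih =>
    intro j hj
    have h : (a ^ (k + 1) - b ^ (k + 1)) * b ^ j =
        a ^ k * (a - b) * b ^ j + (a ^ k - b ^ k) * b ^ (j + 1) := by
      rw [pow_succ a, pow_succ b k, pow_succ' b j]; noncomm_ring
    rw [h]
    refine (norm_add_le _ _).trans ?_
    have h1 : ‖a ^ k * (a - b) * b ^ j‖ ≤ K * ‖a - b‖ * L := by
      refine (norm_mul_le _ _).trans ?_
      refine mul_le_mul ((norm_mul_le _ _).trans ?_) (hb j (by omega)) (norm_nonneg _)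
        (mul_nonneg hK (norm_nonneg _))
      exact mul_le_mul_of_nonneg_right (ha k (by omega)) (norm_nonneg _)
    have h2 := ih (j + 1) (by omega)
    push_cast
    linarith

/-- A compact submonoid of a Banach algebra that contains the one-parameter groups of `x` and `y`
contains `exp (x + y)`. -/
theorem exp_add_mem_of_isCompact {𝔸 : Type*} [NormedRing 𝔸] [NormedAlgebra ℝ 𝔸] [CompleteSpace 𝔸]
    [NormedAlgebra ℚ 𝔸] (S : Submonoid 𝔸) (hS : IsCompact (S : Set 𝔸)) {x y : 𝔸}
    (hx : ∀ t : ℝ, NormedSpace.exp (t • x) ∈ S) (hy : ∀ t : ℝ, NormedSpace.exp (t • y) ∈ S) :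
    NormedSpace.exp (x + y) ∈ S := by
  set F : ℝ → 𝔸 := fun t => NormedSpace.exp (t • x) * NormedSpace.exp (t • y) with hF
  set H : ℝ → 𝔸 := fun t => NormedSpace.exp (t • (x + y)) with hH
  have hFS : ∀ t k, F t ^ k ∈ S := fun t k => pow_mem (mul_mem (hx t) (hy t)) k
  obtain ⟨K, hK⟩ := hS.isBounded.exists_norm_le
  have hder : ∀ z : 𝔸, HasDerivAt (fun t : ℝ => NormedSpace.exp (t • z)) z 0 := by
    intro z
    have := hasDerivAt_exp_smul_const (𝕂 := ℝ) z (0 : ℝ)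
    simpa using this
  have hHc : Continuous H := NormedSpace.exp_continuous.comp (by fun_prop)
  obtain ⟨L, hL⟩ := (isCompact_Icc (a := (0 : ℝ)) (b := 1)).image hHc |>.isBounded.exists_norm_le
  have hHpow : ∀ (t : ℝ) (k : ℕ), H t ^ k = H (k * t) := by
    intro t k
    simp only [hH]
    rw [← NormedSpace.exp_nsmul, ← Nat.cast_smul_eq_nsmul ℝ, smul_smul]
  have hD : HasDerivAt (fun t => F t - H t) 0 0 := by
    have := ((hder x).mul (hder y)).sub (hder (x + y))
    simp only [zero_smul, NormedSpace.exp_zero, one_mul, mul_one, sub_self] at this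
    exact this
  -- `F` and `H` agree to first order at `0`, so their difference at `1/m` is `o(1/m)`.
  have hlim : Filter.Tendsto (fun m : ℕ => (m : ℝ) * ‖F (1 / (m : ℝ)) - H (1 / (m : ℝ))‖)
      Filter.atTop (nhds 0) := by
    have h0 := (hasDerivAt_iff_tendsto_slope_zero.1 hD).norm
    have hseq : Filter.Tendsto (fun m : ℕ => 1 / (m : ℝ)) Filter.atTop (nhdsWithin 0 {0}ᶜ) := by
      refine tendsto_nhdsWithin_iff.2 ⟨tendsto_one_div_atTop_nhds_zero_nat, ?_⟩
      filter_upwards [Filter.eventually_gt_atTop 0] with m hm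
      simp; omega
    have := h0.comp hseq
    rw [norm_zero] at this
    refine this.congr fun m => ?_
    simp [hF, hH, norm_smul]
  -- Lie product formula: the `m` one-step errors add up to at most `K L m ‖F(1/m) - H(1/m)‖`.
  -- Compactness supplies the bound `K`, since all powers of `F` stay in `S`; it also supplies the
  -- closedness used at the end.
  have hconv : Filter.Tendsto (fun m : ℕ => F (1 / (m : ℝ)) ^ m) Filter.atTop
      (nhds (NormedSpace.exp (x + y))) := by
    rw [tendsto_iff_norm_sub_tendsto_zero]
    have hlim2 := hlim.const_mul (K * L)
    rw [mul_zero] at hlim2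
    refine tendsto_of_tendsto_of_tendsto_of_le_of_le' tendsto_const_nhds hlim2
      (Filter.Eventually.of_forall fun _ => norm_nonneg _) ?_
    filter_upwards [Filter.eventually_gt_atTop 0] with m hm
    have hm' : (0 : ℝ) < m := by exact_mod_cast hm
    have h1 := norm_pow_sub_pow_mul_le (a := F (1 / (m : ℝ))) (b := H (1 / (m : ℝ))) (m := m)
      (K := K) (L := L) (fun k _ => hK _ (hFS _ k)) (fun k hk => by
        rw [hHpow]
        refine hL _ ⟨_, ⟨by positivity, ?_⟩, rfl⟩
        rw [mul_one_div, div_le_one hm']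
        exact_mod_cast hk) m 0 (by omega)
    have h2 : H (1 / (m : ℝ)) ^ m = NormedSpace.exp (x + y) := by
      rw [hHpow, mul_one_div_cancel hm'.ne']; simp [hH]
    rw [h2, pow_zero, mul_one] at h1
    refine h1.trans (le_of_eq ?_)
    ring
  exact hS.isClosed.mem_of_tendsto hconv (Filter.Eventually.of_forall fun m => hFS _ m)

namespace TFXY

variable {n : ℕ}

/-! ### Matrix exponentials, with an auxiliary Banach algebra norm. -/

section Norm

attribute [local instance] Matrix.linftyOpNormedRing Matrix.linftyOpNormedAlgebra

/-- Stated as an intertwining rather than a conjugation because `x` need not be invertible: below it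
is often a multiple of a projection. -/
theorem mul_exp_of_mul_eq {x a b : Op n} (h : x * a = b * x) :
    x * NormedSpace.exp a = NormedSpace.exp b * x :=
  SemiconjBy.exp_right h

theorem exp_mem_of_isCompact_of_span (S : Submonoid (Op n)) (hS : IsCompact (S : Set (Op n)))
    (s : Set (Op n)) (hs : ∀ x ∈ s, ∀ t : ℝ, NormedSpace.exp (t • x) ∈ S) {x : Op n}
    (hx : x ∈ Submodule.span ℝ s) : NormedSpace.exp x ∈ S := by
  -- The induction needs whole one-parameter groups, since the sum step takes limits of products
  -- with small parameters.
  suffices h : ∀ t : ℝ, NormedSpace.exp (t • x) ∈ S by simpa using h 1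
  induction hx using Submodule.span_induction with
  | mem x hx => exact hs x hx
  | zero => intro t; simp
  | add x y _ _ hx hy =>
    intro t
    rw [smul_add]
    exact exp_add_mem_of_isCompact S hS (fun r => by rw [smul_smul]; exact hx _)
      (fun r => by rw [smul_smul]; exact hy _)
  | smul c x _ hx => intro t; rw [smul_smul]; exact hx _

theorem exp_smul_one (z : ℂ) : NormedSpace.exp (z • (1 : Op n)) = Complex.exp z • 1 := by
  have h : algebraMap ℂ (Op n) (NormedSpace.exp z) = NormedSpace.exp (algebraMap ℂ (Op n) z) :=
    NormedSpace.algebraMap_exp_comm z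
  rw [← Algebra.algebraMap_eq_smul_one, ← h, Algebra.algebraMap_eq_smul_one, Complex.exp_eq_exp_ℂ]

theorem continuous_rot (P : Op n) : Continuous (rot P) :=
  NormedSpace.exp_continuous.comp (by fun_prop)

end Norm

/-! ### Rotations generated by involutions -/

theorem rot_zero (P : Op n) : rot P 0 = 1 := by simp [rot]

theorem rot_add (P : Op n) (s t : ℝ) : rot P (s + t) = rot P s * rot P t := by
  rw [rot, rot, rot, ← Matrix.exp_add_of_commute _ _ ((Commute.refl P).smul_left _ |>.smul_right _),
    ← add_smul]
  congr 2; push_cast; ring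

theorem rot_commute {P Q : Op n} (h : Commute P Q) (s t : ℝ) : Commute (rot P s) (rot Q t) := by
  have h' : Commute ((-(Complex.I * (s : ℂ))) • P) ((-(Complex.I * (t : ℂ))) • Q) :=
    (h.smul_left _).smul_right _
  rw [Commute, SemiconjBy, rot, rot, ← Matrix.exp_add_of_commute _ _ h',
    ← Matrix.exp_add_of_commute _ _ h'.symm, add_comm]

theorem mul_rot {x P Q : Op n} (h : x * P = Q * x) (t : ℝ) : x * rot P t = rot Q t * x :=
  mul_exp_of_mul_eq (by rw [mul_smul_comm, h, smul_mul_assoc])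

theorem rot_neg_left (P : Op n) (t : ℝ) : rot (-P) t = rot P (-t) := by
  rw [rot, rot]; congr 1; simp

/-- `1 + P` and `1 - P` are twice the projections onto the eigenspaces of `P`, on which the
exponential is the scalar `e^z` or `e^{-z}`. -/
theorem exp_smul_of_mul_self {P : Op n} (hP : P * P = 1) (z : ℂ) :
    NormedSpace.exp (z • P) = Complex.cosh z • 1 + Complex.sinh z • P := by
  have h1 : (1 + P) * NormedSpace.exp (z • P) = NormedSpace.exp (z • (1 : Op n)) * (1 + P) :=
    mul_exp_of_mul_eq (by simp [mul_add, add_mul, hP, add_comm])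
  have h2 : (1 - P) * NormedSpace.exp (z • P) = NormedSpace.exp ((-z) • (1 : Op n)) * (1 - P) :=
    mul_exp_of_mul_eq (by simp [mul_sub, sub_mul, hP, smul_sub]; abel)
  rw [exp_smul_one, smul_mul_assoc, one_mul] at h1 h2
  have h3 : (2 : ℂ) • NormedSpace.exp (z • P) =
      Complex.exp z • (1 + P) + Complex.exp (-z) • (1 - P) := by
    rw [← h1, ← h2, ← add_mul, add_add_sub_cancel, one_add_one_eq_two, two_smul, two_mul]
  have h4 : NormedSpace.exp (z • P) = (1 / 2 : ℂ) • ((2 : ℂ) • NormedSpace.exp (z • P)) := by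
    rw [smul_smul]; norm_num
  rw [h4, h3, Complex.cosh, Complex.sinh]
  module

theorem rot_eq_cos_sin {P : Op n} (hP : P * P = 1) (θ : ℝ) :
    rot P θ = (Real.cos θ : ℂ) • 1 - (Complex.I * (Real.sin θ : ℂ)) • P := by
  rw [rot, exp_smul_of_mul_self hP, show -(Complex.I * (θ : ℂ)) = (-(θ : ℂ)) * Complex.I by ring,
    Complex.cosh_mul_I, Complex.sinh_mul_I, Complex.cos_neg, Complex.sin_neg]
  push_cast
  module

theorem isCompact_range_rot {P : Op n} (hP : P * P = 1) : IsCompact (Set.range (rot P)) := by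
  have hper : Function.Periodic (rot P) (2 * Real.pi) := by
    intro t
    rw [rot_eq_cos_sin hP, rot_eq_cos_sin hP, Real.cos_add_two_pi, Real.sin_add_two_pi]
  rw [← hper.image_Icc Real.two_pi_pos 0]
  exact isCompact_Icc.image (continuous_rot P)

/-! ### Euler angles -/

theorem exists_polar (x y : ℝ) : ∃ φ : ℝ, x = Real.sqrt (x ^ 2 + y ^ 2) * Real.cos φ ∧
    y = Real.sqrt (x ^ 2 + y ^ 2) * Real.sin φ := by
  refine ⟨Complex.arg (x + y * Complex.I), ?_, ?_⟩
  · rw [← Complex.norm_add_mul_I, Complex.norm_mul_cos_arg]; simp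
  · rw [← Complex.norm_add_mul_I, Complex.norm_mul_sin_arg]; simp

/-- Hopf coordinates on the 3-sphere: polar coordinates in the planes `(w, x)` and `(y, z)`, then
for the pair of radii. The outer angles are the half sum and half difference of the two phases. -/
theorem exists_euler_angles {w x y z : ℝ} (h : w ^ 2 + x ^ 2 + y ^ 2 + z ^ 2 = 1) :
    ∃ a b c : ℝ, Real.cos b * Real.cos (a + c) = w ∧ Real.cos b * Real.sin (a + c) = x ∧
      Real.sin b * Real.cos (a - c) = y ∧ Real.sin b * Real.sin (a - c) = z := by
  obtain ⟨φ, h1, h2⟩ := exists_polar w x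
  obtain ⟨ψ, h3, h4⟩ := exists_polar y z
  obtain ⟨b, h5, h6⟩ := exists_polar (Real.sqrt (w ^ 2 + x ^ 2)) (Real.sqrt (y ^ 2 + z ^ 2))
  rw [Real.sq_sqrt (by positivity), Real.sq_sqrt (by positivity), ← add_assoc, h, Real.sqrt_one,
    one_mul] at h5 h6
  refine ⟨(φ + ψ) / 2, b, (φ - ψ) / 2, ?_⟩
  rw [show (φ + ψ) / 2 + (φ - ψ) / 2 = φ by ring, show (φ + ψ) / 2 - (φ - ψ) / 2 = ψ by ring,
    ← h5, ← h6]
  exact ⟨h1.symm, h2.symm, h3.symm, h4.symm⟩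

/-- The element `w - i x A - i y B - z A B`. -/
noncomputable def quat (A B : Op n) (w x y z : ℝ) : Op n :=
  (w : ℂ) • 1 - (Complex.I * x) • A - (Complex.I * y) • B - (z : ℂ) • (A * B)

/-- Exchanging the first two quaternion units reverses the third. -/
theorem quat_swap {A B : Op n} (hAB : B * A = -(A * B)) (w x y z : ℝ) :
    quat B A w x y z = quat A B w y x (-z) := by
  rw [quat, quat, hAB]
  push_cast
  module

theorem euler_eq_quat {A B : Op n} (hA : A * A = 1) (hB : B * B = 1) (hAB : B * A = -(A * B))
    (a b c : ℝ) :
    rot A a * rot B b * rot A c = quat A B (Real.cos b * Real.cos (a + c))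
      (Real.cos b * Real.sin (a + c)) (Real.sin b * Real.cos (a - c))
      (Real.sin b * Real.sin (a - c)) := by
  have h1 : A * B * A = -B := by rw [mul_assoc, hAB, mul_neg, ← mul_assoc, hA, one_mul]
  rw [rot_eq_cos_sin hA, rot_eq_cos_sin hB, rot_eq_cos_sin hA, quat, Real.cos_add, Real.sin_add,
    Real.cos_sub, Real.sin_sub]
  simp only [sub_mul, mul_sub, smul_mul_assoc, mul_smul_comm, one_mul, mul_one, hA, hAB, h1]
  push_cast
  match_scalars <;> ring_nf <;> simp only [Complex.I_sq, Complex.I_pow_three] <;> ring_nf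

theorem euler_norm (a b c : ℝ) : (Real.cos b * Real.cos (a + c)) ^ 2 +
    (Real.cos b * Real.sin (a + c)) ^ 2 + (Real.sin b * Real.cos (a - c)) ^ 2 +
      (Real.sin b * Real.sin (a - c)) ^ 2 = 1 := by
  have h1 := Real.sin_sq_add_cos_sq (a + c)
  have h2 := Real.sin_sq_add_cos_sq (a - c)
  have h3 := Real.sin_sq_add_cos_sq b
  linear_combination (Real.cos b) ^ 2 * h1 + (Real.sin b) ^ 2 * h2 + h3

theorem exists_euler_of_quat {A B : Op n} (hA : A * A = 1) (hB : B * B = 1)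
    (hAB : B * A = -(A * B)) {w x y z : ℝ} (h : w ^ 2 + x ^ 2 + y ^ 2 + z ^ 2 = 1) :
    ∃ a b c : ℝ, quat A B w x y z = rot A a * rot B b * rot A c := by
  obtain ⟨a, b, c, h1, h2, h3, h4⟩ := exists_euler_angles h
  exact ⟨a, b, c, by rw [euler_eq_quat hA hB hAB, h1, h2, h3, h4]⟩

/-- Euler products of either shape are unit quaternions, and Euler angles exist with either unit as
the outer axis. -/
theorem rot_turnover {A B : Op n} (hA : A * A = 1) (hB : B * B = 1) (hAB : B * A = -(A * B))
    (α β γ : ℝ) : ∃ a b c : ℝ, rot A α * rot B β * rot A γ = rot B a * rot A b * rot B c := by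
  have hBA : A * B = -(B * A) := by rw [hAB, neg_neg]
  rw [euler_eq_quat hA hB hAB, quat_swap hBA]
  refine exists_euler_of_quat hB hA hBA ?_
  rw [← euler_norm α β γ]; ring

theorem quat_eq_exp {A B : Op n} (hA : A * A = 1) (hB : B * B = 1) (hAB : B * A = -(A * B))
    {w x y z : ℝ} (h : w ^ 2 + x ^ 2 + y ^ 2 + z ^ 2 = 1) :
    ∃ a b c : ℝ, quat A B w x y z =
      NormedSpace.exp (a • (Complex.I • A) + b • (Complex.I • B) + c • (A * B)) := by
  have h1 : A * B * A = -B := by rw [mul_assoc, hAB, mul_neg, ← mul_assoc, hA, one_mul]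
  have h2 : A * (A * B) = B := by rw [← mul_assoc, hA, one_mul]
  have h3 : B * (A * B) = -A := by rw [← mul_assoc, hAB, neg_mul, mul_assoc, hB, mul_one]
  have h4 : A * B * B = A := by rw [mul_assoc, hB, mul_one]
  have h5 : A * B * (A * B) = -1 := by rw [← mul_assoc, h1, neg_mul, hB]
  set r : ℝ := Real.sqrt (x ^ 2 + y ^ 2 + z ^ 2) with hr
  have hr2 : r ^ 2 = x ^ 2 + y ^ 2 + z ^ 2 := Real.sq_sqrt (by positivity)
  obtain ⟨p, q, s, hx, hy, hz, hn⟩ : ∃ p q s : ℝ, x = r * p ∧ y = r * q ∧ z = r * s ∧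
      p ^ 2 + q ^ 2 + s ^ 2 = 1 := by
    -- With vanishing imaginary part any unit axis will do.
    by_cases h0 : r = 0
    · rw [h0] at hr2
      exact ⟨1, 0, 0, by nlinarith [sq_nonneg x, sq_nonneg y, sq_nonneg z],
        by nlinarith [sq_nonneg x, sq_nonneg y, sq_nonneg z],
        by nlinarith [sq_nonneg x, sq_nonneg y, sq_nonneg z], by norm_num⟩
    · refine ⟨x / r, y / r, z / r, by field_simp, by field_simp, by field_simp, ?_⟩
      field_simp
      exact hr2.symm
  obtain ⟨φ, hc, hs⟩ := exists_polar w r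
  rw [hr2, show w ^ 2 + (x ^ 2 + y ^ 2 + z ^ 2) = 1 by linarith, Real.sqrt_one, one_mul] at hc hs
  -- `A`, `B` and `-iAB` behave like three Pauli matrices, so the unit combination `N` is an
  -- involution and the quaternion is the rotation about `N` by `φ`.
  set N : Op n := (p : ℂ) • A + (q : ℂ) • B + (-(Complex.I * s)) • (A * B) with hN
  have hNN : N * N = 1 := by
    have hn' : (p : ℂ) ^ 2 + (q : ℂ) ^ 2 + (s : ℂ) ^ 2 = 1 := by exact_mod_cast hn
    have : N * N = ((p : ℂ) ^ 2 + (q : ℂ) ^ 2 + (s : ℂ) ^ 2) • (1 : Op n) := by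
      rw [hN]
      simp only [add_mul, mul_add, smul_mul_assoc, mul_smul_comm, hA, hB, hAB, h1, h2, h3, h4, h5]
      match_scalars <;> ring_nf
      simp only [Complex.I_sq]; ring_nf
    rw [this, hn', one_smul]
  refine ⟨-φ * p, -φ * q, -φ * s, ?_⟩
  have hexp : (-φ * p) • (Complex.I • A) + (-φ * q) • (Complex.I • B) + (-φ * s) • (A * B) =
      (-(Complex.I * (φ : ℂ))) • N := by
    rw [hN]
    simp only [← Complex.coe_smul]
    push_cast
    match_scalars <;> ring_nf
    simp [Complex.I_sq]
  rw [hexp, ← rot, rot_eq_cos_sin hNN, ← hc, ← hs, quat, hN, hx, hy, hz]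
  push_cast
  match_scalars <;> ring_nf
  simp [Complex.I_sq]

end TFXY

namespace TFXY

/-! ### Words in a family of idempotents satisfying the braid relations -/

/-- The relations of the `0`-Hecke monoid for the generators `r_1, …, r_N`. -/
structure IsHecke {W : Type*} [Monoid W] (N : ℕ) (r : ℕ → W) : Prop where
  idem : ∀ i, 1 ≤ i → i ≤ N → r i * r i = r i
  comm : ∀ i j, 1 ≤ i → i + 1 < j → j ≤ N → r i * r j = r j * r i
  braid : ∀ i, 1 ≤ i → i + 1 ≤ N → r i * r (i + 1) * r i = r (i + 1) * r i * r (i + 1)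

/-- The product of the generators along a list of indices. -/
def word {W : Type*} [Monoid W] (r : ℕ → W) (l : List ℕ) : W := (l.map r).prod

section Word

variable {W : Type*} [Monoid W] {r : ℕ → W} {N : ℕ}

@[simp] theorem word_nil : word r [] = 1 := rfl

@[simp] theorem word_cons (k : ℕ) (l : List ℕ) : word r (k :: l) = r k * word r l := by
  simp [word]

@[simp] theorem word_append (l l' : List ℕ) : word r (l ++ l') = word r l * word r l' := by
  simp [word]

theorem commute_word {x : W} {l : List ℕ} (h : ∀ k ∈ l, Commute x (r k)) :
    Commute x (word r l) := by
  induction l with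
  | nil => exact Commute.one_right x
  | cons k l ih =>
    rw [word_cons]
    exact (h k (by simp)).mul_right (ih fun j hj => h j (by simp [hj]))

theorem IsHecke.commute (H : IsHecke N r) {i j : ℕ} (hi : 1 ≤ i) (hi' : i ≤ N) (hj : 1 ≤ j)
    (hj' : j ≤ N) (h : i + 1 < j ∨ j + 1 < i) : Commute (r i) (r j) := by
  rcases h with h | h
  · exact H.comm i j hi h hj'
  · exact (H.comm j i hj h hi').symm

theorem IsHecke.cascade_mul_last (H : IsHecke N r) {j : ℕ} (hj : 1 ≤ j) (hjN : j ≤ N) :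
    word r (cascadeIdx j N) * r N = word r (cascadeIdx j N) := by
  have h : cascadeIdx j N = List.range' j (N - j) ++ [N] := by
    rw [cascadeIdx, show N + 1 - j = (N - j) + 1 by omega, List.range'_concat]
    simp; omega
  rw [h, word_append, word_cons, word_nil, mul_one, mul_assoc, H.idem N (by omega) le_rfl]

/-- Moving left, `r k` commutes with the generators from `k + 2` on, the braid relation trades it
for `r (k + 1)`, and this commutes with the generators below `k`. Crossing a cascade thus raises the
index by one. -/
theorem IsHecke.cascade_mul (H : IsHecke N r) {j k : ℕ} (hj : 1 ≤ j) (hjk : j ≤ k) (hk : k < N) :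
    word r (cascadeIdx j N) * r k = r (k + 1) * word r (cascadeIdx j N) := by
  have h : cascadeIdx j N = List.range' j (k - j) ++ k :: (k + 1) :: List.range' (k + 2) (N - k - 1)
      := by
    rw [cascadeIdx, show N + 1 - j = (k - j) + ((N - k - 1) + 1 + 1) by omega,
      ← List.range'_append_1, List.range'_succ, List.range'_succ]
    simp only [show j + (k - j) = k by omega]
  have h1 : Commute (r k) (word r (List.range' (k + 2) (N - k - 1))) := by
    refine commute_word fun l hl => ?_
    rw [List.mem_range'_1] at hl
    exact H.commute (by omega) (by omega) (by omega) (by omega) (by omega)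
  have h2 : Commute (r (k + 1)) (word r (List.range' j (k - j))) := by
    refine commute_word fun l hl => ?_
    rw [List.mem_range'_1] at hl
    exact H.commute (by omega) (by omega) (by omega) (by omega) (by omega)
  rw [h]
  simp only [word_append, word_cons]
  calc word r (List.range' j (k - j)) * (r k * (r (k + 1) * word r (List.range' (k + 2) (N - k - 1))))
        * r k
      = word r (List.range' j (k - j)) * (r k * r (k + 1) *
          (word r (List.range' (k + 2) (N - k - 1)) * r k)) := by simp only [mul_assoc]
    _ = word r (List.range' j (k - j)) * (r k * r (k + 1) * r k) *
          word r (List.range' (k + 2) (N - k - 1)) := by rw [← h1.eq]; simp only [mul_assoc]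
    _ = word r (List.range' j (k - j)) * r (k + 1) * (r k * r (k + 1) *
          word r (List.range' (k + 2) (N - k - 1))) := by
        rw [H.braid k (by omega) (by omega)]; simp only [mul_assoc]
    _ = _ := by rw [← h2.eq]; simp only [mul_assoc]

/-- Crossing the last cascade either meets `r N` and is absorbed by idempotence, or raises the index
by one, so that the remaining cascades, which start one higher, absorb it by induction. -/
theorem IsHecke.triangle_suffix_mul (H : IsHecke N r) (d : ℕ) : ∀ m k, m + d = N → 1 ≤ m → m ≤ k →
    k ≤ N → word r ((List.range' m (d + 1)).reverse.flatMap fun k => cascadeIdx k N) * r k =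
      word r ((List.range' m (d + 1)).reverse.flatMap fun k => cascadeIdx k N) := by
  induction d with
  | zero =>
    intro m k hm h1 hmk hk
    obtain rfl : k = N := by omega
    simpa using H.cascade_mul_last h1 (by omega)
  | succ d ih =>
    intro m k hm h1 hmk hk
    rw [List.range'_succ, List.reverse_cons, List.flatMap_append, word_append, mul_assoc]
    simp only [List.flatMap_cons, List.flatMap_nil, List.append_nil]
    rcases hk.lt_or_eq with hk' | rfl
    · rw [H.cascade_mul h1 hmk hk', ← mul_assoc,
        ih (m + 1) (k + 1) (by omega) (by omega) (by omega) (by omega)]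
    · rw [H.cascade_mul_last h1 (by omega)]

theorem IsHecke.triangle_mul (H : IsHecke N r) {k : ℕ} (hk : 1 ≤ k) (hk' : k ≤ N) :
    word r (triangleIdx N) * r k = word r (triangleIdx N) := by
  have := H.triangle_suffix_mul (N - 1) 1 k (by omega) le_rfl hk hk'
  rwa [show N - 1 + 1 = N by omega] at this

/-! ### From the triangle to the square. -/

theorem IsHecke.shift_mul_cascade (H : IsHecke N r) {j s : ℕ} (hj : 1 ≤ j) (hs : j ≤ s) (L : ℕ)
    (hL : s + L ≤ N) : word r (List.range' (s + 1) L) * word r (cascadeIdx j N) =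
      word r (cascadeIdx j N) * word r (List.range' s L) := by
  induction L with
  | zero => simp
  | succ L ih =>
    rw [List.range'_concat, List.range'_concat, word_append, word_append, word_cons, word_cons,
      word_nil, mul_one, mul_one, one_mul, mul_assoc, show s + 1 + L = s + L + 1 by ring,
      ← H.cascade_mul hj (by omega) (by omega), ← mul_assoc, ih (by omega), mul_assoc]

/-- The cascades `C_{j,N} ⋯ C_{1,N}`. -/
def cascadesIdx (N j : ℕ) : List ℕ := (List.range' 1 j).reverse.flatMap fun k => cascadeIdx k N

theorem cascadesIdx_succ (N j : ℕ) :
    cascadesIdx N (j + 1) = cascadeIdx (j + 1) N ++ cascadesIdx N j := by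
  rw [cascadesIdx, List.range'_concat, List.reverse_append]
  simp [cascadesIdx, add_comm]

/-- Each of the `j` cascades crossed from left to right lowers the indices of the run by one. -/
theorem IsHecke.shift_mul_cascades (H : IsHecke N r) {a : ℕ} (ha : 1 ≤ a) (L j : ℕ)
    (h : a + j + L ≤ N + 1) : word r (List.range' (a + j) L) * word r (cascadesIdx N j) =
      word r (cascadesIdx N j) * word r (List.range' a L) := by
  induction j with
  | zero => simp [cascadesIdx]
  | succ j ih =>
    rw [cascadesIdx_succ, word_append, ← mul_assoc, ← add_assoc,
      H.shift_mul_cascade (by omega) (by omega) L (by omega), mul_assoc, ih (by omega), mul_assoc]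

/-- The cascades `C_{k,N}` over decreasing `k ≤ j` of parity opposite to that of `N`. -/
def squareLeft (N j : ℕ) : List ℕ :=
  ((List.range' 1 j).reverse.filter fun k => k % 2 ≠ N % 2).flatMap (fun k => cascadeIdx k N)

/-- The cascades `C_{1,m}` over decreasing odd `m` with `N - j < m ≤ N`. -/
def squareRight (N j : ℕ) : List ℕ :=
  ((List.range' (N + 1 - j) j).reverse.filter fun k => k % 2 = 1).flatMap (fun k => cascadeIdx 1 k)

theorem squareIdx_eq (N : ℕ) : squareIdx N = squareLeft N N ++ squareRight N N := by
  rw [squareIdx, squareLeft, squareRight, show N + 1 - N = 1 by omega]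

theorem squareLeft_succ (N j : ℕ) : squareLeft N (j + 1) =
    (if (j + 1) % 2 ≠ N % 2 then cascadeIdx (j + 1) N else []) ++ squareLeft N j := by
  rw [squareLeft, List.range'_concat, List.reverse_append, squareLeft, add_comm 1]
  by_cases h : (j + 1) % 2 = N % 2 <;> simp [h]

theorem squareRight_succ {N j : ℕ} (h : j < N) : squareRight N (j + 1) =
    squareRight N j ++ (if (j + 1) % 2 ≠ N % 2 then [] else cascadeIdx 1 (N - j)) := by
  rw [squareRight, show N + 1 - (j + 1) = N - j by omega, List.range'_succ, List.reverse_cons,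
    List.filter_append, List.flatMap_append, squareRight, show N - j + 1 = N + 1 - j by omega]
  congr 1
  by_cases h' : (j + 1) % 2 = N % 2
  · simp [h', show (N - j) % 2 = 1 by omega]
  · simp [h', show (N - j) % 2 ≠ 1 by omega]

/-- The new cascade `C_{j+1,N}` stays on the left if `j + 1` and `N` have opposite parity. Otherwise
it slides through the `j` cascades behind it and arrives on the right as `C_{1,N-j}`, where `N - j`
is odd. -/
theorem IsHecke.cascades_eq (H : IsHecke N r) {j : ℕ} (hj : j ≤ N) :
    word r (cascadesIdx N j) = word r (squareLeft N j) * word r (squareRight N j) := by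
  induction j with
  | zero => simp [cascadesIdx, squareLeft, squareRight]
  | succ j ih =>
    rw [squareLeft_succ, squareRight_succ (by omega)]
    split_ifs with h
    · rw [cascadesIdx_succ, word_append, ih (by omega)]
      simp [mul_assoc]
    · have hs := H.shift_mul_cascades le_rfl (N - j) j (by omega)
      have e1 : cascadeIdx (j + 1) N = List.range' (1 + j) (N - j) := by
        rw [cascadeIdx, add_comm j]; congr 1; omega
      rw [cascadesIdx_succ, word_append, e1, hs, ih (by omega)]
      simp [cascadeIdx, mul_assoc]

theorem IsHecke.triangle_eq_square (H : IsHecke N r) :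
    word r (triangleIdx N) = word r (squareIdx N) := by
  rw [squareIdx_eq, word_append, ← H.cascades_eq le_rfl, triangleIdx, cascadesIdx]

/-- The symmetry of the chain that exchanges its ends; it yields the mirror image of every
factorisation. -/
theorem IsHecke.reflect (H : IsHecke N r) : IsHecke N fun k => r (N + 1 - k) where
  idem i h1 h2 := H.idem _ (by omega) (by omega)
  comm i j h1 h2 h3 := H.commute (by omega) (by omega) (by omega) (by omega) (by omega)
  braid i h1 h2 := by
    have := H.braid (N - i) (by omega) (by omega)
    rw [show N + 1 - i = N - i + 1 by omega, show N + 1 - (i + 1) = N - i by omega]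
    exact this.symm

/-- The three words use only the generators `3,4,5`, then `1,2,3`, then `3,4,5`. On TFIM rotations
these triples are two overlapping blocks, which is the origin of the turnover of six-parameter
blocks. -/
theorem IsHecke.triangle_five (H : IsHecke 5 r) : word r (triangleIdx 5) =
    word r [5, 4, 5, 3, 4, 5] * word r [2, 3, 1, 2] * word r [4, 3, 5, 4, 5] := by
  have h : triangleIdx 5 = [5, 4, 5, 3, 4, 5] ++ [2, 3] ++ [4, 5] ++ [1, 2, 3, 4, 5] := by decide
  have h15 := H.comm 1 5 (by omega) (by omega) (by omega)
  have h14 := H.comm 1 4 (by omega) (by omega) (by omega)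
  have h25 := H.comm 2 5 (by omega) (by omega) (by omega)
  have h24 := H.comm 2 4 (by omega) (by omega) (by omega)
  have h35 := H.comm 3 5 (by omega) (by omega) (by omega)
  -- Only commutations of distant generators: `1` and `2` move to the front, and `3` moves past `5`.
  have e : word r [4, 5] * word r [1, 2, 3, 4, 5] = word r [1, 2] * word r [4, 3, 5, 4, 5] := by
    simp only [word_cons, word_nil, mul_one]
    calc r 4 * r 5 * (r 1 * (r 2 * (r 3 * (r 4 * r 5))))
        = r 4 * (r 5 * r 1) * (r 2 * (r 3 * (r 4 * r 5))) := by simp only [mul_assoc]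
      _ = r 4 * r 1 * (r 5 * r 2) * (r 3 * (r 4 * r 5)) := by
          rw [← h15]; simp only [mul_assoc]
      _ = r 4 * r 1 * (r 2 * r 5) * (r 3 * (r 4 * r 5)) := by rw [h25]
      _ = r 1 * (r 4 * r 2) * (r 5 * r 3) * (r 4 * r 5) := by
          rw [← h14]; simp only [mul_assoc]
      _ = _ := by rw [← h24, ← h35]; simp only [mul_assoc]
  rw [h, word_append, word_append, mul_assoc, e, word_append]
  simp only [word_cons, word_nil, mul_one, mul_assoc]

end Word

/-! ### Block products as products of sets -/

section Blocks

open scoped Pointwise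

variable {M P : Type*} [Monoid M] {B : ℕ → P → M} {N : ℕ}

/-- Fusion and turnover change the parameters, so they are not identities between operators. Between
the sets of all values of the blocks they become equations, and word arguments apply in the monoid
of sets. -/
theorem blockProducts_eq_word (B : ℕ → P → M) (idx : List ℕ) :
    blockProducts B idx = word (fun k => Set.range (B k)) idx := by
  induction idx with
  | nil =>
    ext U
    simp only [blockProducts, List.map_eq_nil_iff, Set.mem_ofPred_eq, exists_eq_left, word_nil,
      List.map_nil, List.prod_nil, Set.mem_one]
    exact eq_comm
  | cons k l ih =>
    rw [word_cons, ← ih]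
    ext U
    simp only [blockProducts, Set.mem_ofPred_eq, Set.mem_mul, Set.mem_range]
    constructor
    · rintro ⟨C, hC, rfl⟩
      cases C with
      | nil => simp at hC
      | cons g C =>
        simp only [List.map_cons, List.cons.injEq] at hC
        exact ⟨B k g.2, ⟨g.2, rfl⟩, (C.map fun g => B g.1 g.2).prod, ⟨C, hC.2, rfl⟩,
          by simp [hC.1]⟩
    · rintro ⟨_, ⟨θ, rfl⟩, _, ⟨C, hC, rfl⟩, rfl⟩
      exact ⟨(k, θ) :: C, by simp [hC], by simp⟩

theorem one_mem_word {r : ℕ → Set M} {idx : List ℕ} (h : ∀ k ∈ idx, (1 : M) ∈ r k) :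
    (1 : M) ∈ word r idx := by
  induction idx with
  | nil => simp
  | cons k l ih =>
    rw [word_cons]
    exact ⟨1, h k (by simp), 1, ih fun j hj => h j (by simp [hj]), one_mul 1⟩

theorem word_subset_submonoid {r : ℕ → Set M} {idx : List ℕ} (S : Submonoid M)
    (h : ∀ k ∈ idx, r k ⊆ S) : word r idx ⊆ S := by
  induction idx with
  | nil => simp
  | cons k l ih =>
    rw [word_cons]
    rintro _ ⟨x, hx, y, hy, rfl⟩
    exact S.mul_mem (h k (by simp) hx) (ih (fun j hj => h j (by simp [hj])) hy)

theorem isCompact_word [TopologicalSpace M] [ContinuousMul M] {r : ℕ → Set M} {idx : List ℕ}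
    (h : ∀ k ∈ idx, IsCompact (r k)) : IsCompact (word r idx) := by
  induction idx with
  | nil => simp [word]
  | cons k l ih =>
    rw [word_cons]
    exact (h k (by simp)).mul (ih fun j hj => h j (by simp [hj]))

theorem mem_triangleIdx {N k : ℕ} (h : k ∈ triangleIdx N) : 1 ≤ k ∧ k ≤ N := by
  simp only [triangleIdx, cascadeIdx, List.mem_flatMap, List.mem_reverse, List.mem_range'_1] at h
  omega

/-- The triangle absorbs the word on its right and contains `1`, so each `x` in the word is `1 * x`
in the triangle. -/
theorem IsHecke.word_subset_triangle {r : ℕ → Set M} (H : IsHecke N r)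
    (h1 : ∀ k, 1 ≤ k → k ≤ N → (1 : M) ∈ r k) {idx : List ℕ} (h : ∀ k ∈ idx, 1 ≤ k ∧ k ≤ N) :
    word r idx ⊆ word r (triangleIdx N) := by
  have habs : word r (triangleIdx N) * word r idx = word r (triangleIdx N) := by
    induction idx with
    | nil => simp
    | cons k l ih =>
      rw [word_cons, ← mul_assoc, H.triangle_mul (h k (by simp)).1 (h k (by simp)).2,
        ih fun j hj => h j (by simp [hj])]
  intro x hx
  rw [← habs]
  exact ⟨1, one_mem_word fun k hk => h1 k (mem_triangleIdx hk).1 (mem_triangleIdx hk).2, x, hx,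
    one_mul x⟩

/-- The elements of the triangle are exactly the finite products of elements of `r_1, …, r_N`. -/
theorem IsHecke.closure_eq_triangle {r : ℕ → Set M} (H : IsHecke N r)
    (h1 : ∀ k, 1 ≤ k → k ≤ N → (1 : M) ∈ r k) :
    (Submonoid.closure {x | ∃ k, 1 ≤ k ∧ k ≤ N ∧ x ∈ r k} : Set M) = word r (triangleIdx N) := by
  apply Set.Subset.antisymm
  · intro x hx
    obtain ⟨l, hl, rfl⟩ := Submonoid.exists_list_of_mem_closure hx
    have : ∃ idx : List ℕ, (∀ k ∈ idx, 1 ≤ k ∧ k ≤ N) ∧ l.prod ∈ word r idx := by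
      clear hx
      induction l with
      | nil => exact ⟨[], by simp⟩
      | cons y l ih =>
        obtain ⟨idx, h2, h3⟩ := ih fun z hz => hl z (by simp [hz])
        obtain ⟨k, hk1, hk2, hk3⟩ := hl y (by simp)
        refine ⟨k :: idx, ?_, ?_⟩
        · simpa [hk1, hk2] using h2
        · rw [word_cons, List.prod_cons]; exact Set.mul_mem_mul hk3 h3
    obtain ⟨idx, h2, h3⟩ := this
    exact H.word_subset_triangle h1 h2 h3
  · exact word_subset_submonoid _ fun k hk x hx =>
      Submonoid.subset_closure ⟨k, (mem_triangleIdx hk).1, (mem_triangleIdx hk).2, hx⟩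

end Blocks

/-! ### Size and depth of the triangle and of the square -/

theorem length_cascadeIdx (i j : ℕ) : (cascadeIdx i j).length = j + 1 - i := by
  simp [cascadeIdx]

/-- The sum of the lengths `N + 1 - k` for `k ≤ j`, doubled and rearranged to avoid division and
subtraction. -/
theorem length_cascadesIdx {N j : ℕ} (hj : j ≤ N) :
    2 * (cascadesIdx N j).length + j * j = j * (2 * N + 1) := by
  induction j with
  | zero => simp [cascadesIdx]
  | succ j ih =>
    rw [cascadesIdx_succ, List.length_append, length_cascadeIdx]
    have h1 := ih (by omega)
    obtain ⟨m, rfl⟩ : ∃ m, N = j + 1 + m := ⟨N - (j + 1), by omega⟩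
    rw [show j + 1 + m + 1 - (j + 1) = m + 1 by omega]
    linarith

theorem length_triangleIdx (N : ℕ) : (triangleIdx N).length = (N + 1) * N / 2 := by
  have h := length_cascadesIdx (le_refl N)
  have h2 : 2 * (triangleIdx N).length = (N + 1) * N := by
    change 2 * (cascadesIdx N N).length = _
    linarith
  omega

/-- A cascade that changes sides keeps its length `N - j`. -/
theorem length_square_parts {N j : ℕ} (hj : j ≤ N) :
    (squareLeft N j).length + (squareRight N j).length = (cascadesIdx N j).length := by
  induction j with
  | zero => simp [cascadesIdx, squareLeft, squareRight]
  | succ j ih =>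
    have h1 := ih (by omega)
    rw [cascadesIdx_succ, squareLeft_succ, squareRight_succ (by omega)]
    simp only [List.length_append]
    split_ifs
    · simp only [length_cascadeIdx, List.length_nil]; omega
    · simp only [length_cascadeIdx, List.length_nil]; omega

theorem length_squareIdx (N : ℕ) : (squareIdx N).length = (N + 1) * N / 2 := by
  rw [squareIdx_eq, List.length_append, length_square_parts le_rfl, ← length_triangleIdx]
  rfl

/-- In a circuit of blocks labelled by time layers, blocks sharing a qubit are in order. -/
def LayerOrder (p q : ℕ × ℕ) : Prop := p.1 ≤ q.1 + 1 → q.1 ≤ p.1 + 1 → p.2 < q.2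

theorem hasDepthLE_of_pairwise {L : List (ℕ × ℕ)} {d : ℕ} (h : L.Pairwise LayerOrder)
    (hd : ∀ p ∈ L, p.2 < d) : HasDepthLE (L.map Prod.fst) d := by
  refine ⟨fun p => ⟨(L[p.1]'(by simpa using p.2)).2, hd _ (List.getElem_mem _)⟩, ?_⟩
  intro p q hpq h1 h2
  have hp : p.1 < L.length := by simpa using p.2
  have hq : q.1 < L.length := by simpa using q.2
  simp only [List.get_eq_getElem, List.getElem_map] at h1 h2
  exact List.pairwise_iff_getElem.1 h p.1 q.1 hp hq hpq h1 h2

theorem map_fst_labelled_flatMap (l : List ℕ) (f : ℕ → List ℕ) (t : ℕ → ℕ → ℕ) :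
    (l.flatMap fun k => (f k).map fun j => (j, t k j)).map Prod.fst = l.flatMap f := by
  rw [List.map_flatMap]
  congr 1; funext k
  simp [Function.comp_def]

theorem pairwise_labelled_cascade {i j : ℕ} {t : ℕ → ℕ}
    (ht : ∀ a b, i ≤ a → a < b → b ≤ j → t a < t b) :
    ((cascadeIdx i j).map fun a => (a, t a)).Pairwise LayerOrder := by
  rw [List.pairwise_map, cascadeIdx]
  refine (List.pairwise_lt_range' (s := i) (n := j + 1 - i) 1).imp_of_mem ?_
  intro a b ha hb hab _ _
  rw [List.mem_range'_1] at ha hb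
  exact ht a b (by omega) hab (by omega)

theorem pairwise_gt_reverse_range' (s n : ℕ) :
    (List.range' s n).reverse.Pairwise fun a b => b < a :=
  List.pairwise_reverse.2 (List.pairwise_lt_range' 1)

theorem hasDepthLE_triangleIdx (N : ℕ) : HasDepthLE (triangleIdx N) (2 * N - 1) := by
  -- Cascade `k` starts in layer `N - k`, one layer after cascade `k + 1`, and advances one block
  -- per layer. The last layer, at `k = 1` and `j = N`, is `2N - 2`.
  rw [triangleIdx, ← map_fst_labelled_flatMap _ _ fun k j => N + j - 2 * k]
  apply hasDepthLE_of_pairwise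
  · rw [List.pairwise_flatMap]
    constructor
    · intro k hk
      simp only [List.mem_reverse, List.mem_range'_1] at hk
      exact pairwise_labelled_cascade fun a b _ _ _ => by omega
    · refine (pairwise_gt_reverse_range' 1 N).imp_of_mem ?_
      intro k l hk hl hkl x hx y hy
      simp only [List.mem_reverse, List.mem_range'_1, List.mem_map, cascadeIdx] at hk hl hx hy
      obtain ⟨a, ha, rfl⟩ := hx
      obtain ⟨b, hb, rfl⟩ := hy
      intro h1 h2
      simp only at h1 h2 ⊢
      omega
  · simp only [List.mem_flatMap, List.mem_reverse, List.mem_range'_1, List.mem_map, cascadeIdx]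
    rintro _ ⟨k, hk, a, ha, rfl⟩
    simp only
    omega

theorem hasDepthLE_squareIdx (N : ℕ) : HasDepthLE (squareIdx N) (N + 1) := by
  -- All left cascades start in layer `0`, and the spacing by two keeps them in order; all right
  -- cascades end in layer `N`. A clash between the two halves would need both `C_{1,N}` on the left
  -- and `C_{1,N}` on the right, which the parity conditions forbid.
  rw [squareIdx, ← map_fst_labelled_flatMap _ (fun k => cascadeIdx k N) fun k j => j - k,
    ← map_fst_labelled_flatMap _ (fun k => cascadeIdx 1 k) fun k j => N - k + j, ← List.map_append]
  apply hasDepthLE_of_pairwise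
  · rw [List.pairwise_append, List.pairwise_flatMap, List.pairwise_flatMap]
    refine ⟨⟨?_, ?_⟩, ⟨?_, ?_⟩, ?_⟩
    · intro k hk
      exact pairwise_labelled_cascade fun a b _ _ _ => by omega
    · refine ((pairwise_gt_reverse_range' 1 N).filter _).imp_of_mem ?_
      intro k l hk hl hkl x hx y hy
      simp only [List.mem_filter, List.mem_reverse, List.mem_range'_1, List.mem_map, cascadeIdx,
        decide_eq_true_eq] at hk hl hx hy
      obtain ⟨a, ha, rfl⟩ := hx
      obtain ⟨b, hb, rfl⟩ := hy
      intro h1 h2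
      simp only at h1 h2 ⊢
      omega
    · intro k hk
      exact pairwise_labelled_cascade fun a b _ _ _ => by omega
    · refine ((pairwise_gt_reverse_range' 1 N).filter _).imp_of_mem ?_
      intro k l hk hl hkl x hx y hy
      simp only [List.mem_filter, List.mem_reverse, List.mem_range'_1, List.mem_map, cascadeIdx,
        decide_eq_true_eq] at hk hl hx hy
      obtain ⟨a, ha, rfl⟩ := hx
      obtain ⟨b, hb, rfl⟩ := hy
      intro h1 h2
      simp only at h1 h2 ⊢
      omega
    · intro x hx y hy
      simp only [List.mem_flatMap, List.mem_filter, List.mem_reverse, List.mem_range'_1,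
        List.mem_map, cascadeIdx, decide_eq_true_eq] at hx hy
      obtain ⟨k, hk, a, ha, rfl⟩ := hx
      obtain ⟨l, hl, b, hb, rfl⟩ := hy
      intro h1 h2
      simp only at h1 h2 ⊢
      omega
  · simp only [List.mem_append, List.mem_flatMap, List.mem_filter, List.mem_reverse,
      List.mem_range'_1, List.mem_map, cascadeIdx]
    rintro _ (⟨k, hk, a, ha, rfl⟩ | ⟨k, hk, a, ha, rfl⟩)
    · simp only; omega
    · simp only; omega

end TFXY

namespace TFXY

/-! ### Lie algebras spanned by bivectors -/

variable {n : ℕ}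

/-- The real span of the products `γ_a γ_b` with distinct `a, b ∈ W`. -/
noncomputable def bivSpan (n : ℕ) (W : Set ℕ) : Submodule ℝ (Op n) :=
  Submodule.span ℝ {x | ∃ a ∈ W, ∃ b ∈ W, a ≠ b ∧ maj n a * maj n b = x}

theorem biv_mem_bivSpan {W : Set ℕ} {a b : ℕ} (ha : a ∈ W) (hb : b ∈ W) (h : a ≠ b) :
    maj n a * maj n b ∈ bivSpan n W :=
  Submodule.subset_span ⟨a, ha, b, hb, h, rfl⟩

theorem bivSpan_mono {W W' : Set ℕ} (h : W ⊆ W') : bivSpan n W ≤ bivSpan n W' := by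
  refine Submodule.span_mono ?_
  rintro x ⟨a, ha, b, hb, hab, rfl⟩
  exact ⟨a, h ha, b, h hb, hab, rfl⟩

theorem maj_mul_maj_mul (n a : ℕ) (x : Op n) : maj n a * (maj n a * x) = x := by
  rw [← mul_assoc, maj_mul_self, one_mul]

theorem biv_mul_self {a b : ℕ} (ha : a ∈ Set.Icc 1 (2 * n)) (hb : b ∈ Set.Icc 1 (2 * n))
    (h : a ≠ b) : maj n a * maj n b * (maj n a * maj n b) = -1 := by
  have h1 := maj_anticomm ha.1 ha.2 hb.1 hb.2 h
  calc maj n a * maj n b * (maj n a * maj n b)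
      = maj n a * maj n b * -(maj n b * maj n a) := by rw [h1]
    _ = -(maj n a * (maj n b * (maj n b * maj n a))) := by simp only [mul_neg, mul_assoc]
    _ = -1 := by rw [maj_mul_maj_mul, maj_mul_self]

theorem biv_commute {a b c d : ℕ} (ha : a ∈ Set.Icc 1 (2 * n)) (hb : b ∈ Set.Icc 1 (2 * n))
    (hc : c ∈ Set.Icc 1 (2 * n)) (hd : d ∈ Set.Icc 1 (2 * n)) (hac : a ≠ c) (had : a ≠ d)
    (hbc : b ≠ c) (hbd : b ≠ d) : Commute (maj n a * maj n b) (maj n c * maj n d) := by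
  have h1 := maj_anticomm ha.1 ha.2 hc.1 hc.2 hac
  have h2 := maj_anticomm ha.1 ha.2 hd.1 hd.2 had
  have h3 := maj_anticomm hb.1 hb.2 hc.1 hc.2 hbc
  have h4 := maj_anticomm hb.1 hb.2 hd.1 hd.2 hbd
  have e1 : ∀ x, maj n a * (maj n c * x) = -(maj n c * (maj n a * x)) := fun x => by
    rw [← mul_assoc, h1]; simp [mul_assoc]
  have e3 : ∀ x, maj n b * (maj n c * x) = -(maj n c * (maj n b * x)) := fun x => by
    rw [← mul_assoc, h3]; simp [mul_assoc]
  have e2 : ∀ x, maj n a * (maj n d * x) = -(maj n d * (maj n a * x)) := fun x => by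
    rw [← mul_assoc, h2]; simp [mul_assoc]
  rw [Commute, SemiconjBy]
  simp only [mul_assoc]
  rw [e3, h4]
  simp only [mul_neg, neg_neg]
  rw [e1, e2, mul_neg, neg_neg]

theorem lie_biv_chain {a b c : ℕ} (ha : a ∈ Set.Icc 1 (2 * n)) (hb : b ∈ Set.Icc 1 (2 * n))
    (hc : c ∈ Set.Icc 1 (2 * n)) (hab : a ≠ b) (hac : a ≠ c) (hbc : b ≠ c) :
    ⁅maj n a * maj n b, maj n b * maj n c⁆ = (2 : ℝ) • (maj n a * maj n c) := by
  have h2 := maj_anticomm hc.1 hc.2 ha.1 ha.2 hac.symm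
  have h3 := maj_anticomm hb.1 hb.2 hc.1 hc.2 hbc
  have h4 := maj_anticomm hb.1 hb.2 ha.1 ha.2 hab.symm
  have e1 : maj n a * maj n b * (maj n b * maj n c) = maj n a * maj n c := by
    rw [mul_assoc, maj_mul_maj_mul]
  have e2 : maj n b * maj n c * (maj n a * maj n b) = -(maj n a * maj n c) := by
    calc maj n b * maj n c * (maj n a * maj n b)
        = maj n b * (maj n c * maj n a) * maj n b := by simp only [mul_assoc]
      _ = -(maj n b * maj n a * (maj n c * maj n b)) := by
          rw [h2]; simp only [mul_neg, neg_mul, mul_assoc]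
      _ = maj n a * (maj n b * (maj n c * maj n b)) := by
          rw [h4]; simp only [neg_mul, neg_neg, mul_assoc]
      _ = maj n a * ((maj n b * maj n c) * maj n b) := by simp only [mul_assoc]
      _ = _ := by rw [h3]; simp only [neg_mul, mul_neg, mul_assoc, maj_mul_self, mul_one]
  rw [Ring.lie_def, e1, e2, sub_neg_eq_add, two_smul]

theorem lie_mem_span {s : Set (Op n)}
    (h : ∀ x ∈ s, ∀ y ∈ s, ⁅x, y⁆ ∈ Submodule.span ℝ s) {x y : Op n}
    (hx : x ∈ Submodule.span ℝ s) (hy : y ∈ Submodule.span ℝ s) :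
    ⁅x, y⁆ ∈ Submodule.span ℝ s := by
  induction hx using Submodule.span_induction with
  | mem x hx =>
    induction hy using Submodule.span_induction with
    | mem y hy => exact h x hx y hy
    | zero => rw [lie_zero]; exact Submodule.zero_mem _
    | add y z _ _ hy hz => rw [lie_add]; exact Submodule.add_mem _ hy hz
    | smul c y _ hy => rw [lie_smul]; exact Submodule.smul_mem _ c hy
  | zero => rw [zero_lie]; exact Submodule.zero_mem _
  | add x z _ _ hx hz => rw [add_lie]; exact Submodule.add_mem _ hx hz
  | smul c x _ hx => rw [smul_lie]; exact Submodule.smul_mem _ c hx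

/-- The span of a set that is closed under brackets is the Lie algebra generated by any of its
Lie-generating subsets. -/
theorem lieSpan_toSubmodule_eq {s t : Set (Op n)}
    (h : ∀ x ∈ s, ∀ y ∈ s, ⁅x, y⁆ ∈ Submodule.span ℝ s) (hts : t ⊆ Submodule.span ℝ s)
    (hst : s ⊆ LieSubalgebra.lieSpan ℝ (Op n) t) :
    (LieSubalgebra.lieSpan ℝ (Op n) t).toSubmodule = Submodule.span ℝ s := by
  let L : LieSubalgebra ℝ (Op n) :=
    { Submodule.span ℝ s with lie_mem' := fun hx hy => lie_mem_span h hx hy }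
  apply le_antisymm
  · exact (LieSubalgebra.lieSpan_le (K := L)).2 hts
  · exact Submodule.span_le.2 hst

/-- Disjoint index pairs commute. If an index is shared, antisymmetry brings it to the middle and
the bracket is again a bivector, or zero. -/
theorem lie_biv_mem {W : Set ℕ} (hW : W ⊆ Set.Icc 1 (2 * n)) {a b c d : ℕ} (ha : a ∈ W)
    (hb : b ∈ W) (hc : c ∈ W) (hd : d ∈ W) (hab : a ≠ b) (hcd : c ≠ d) :
    ⁅maj n a * maj n b, maj n c * maj n d⁆ ∈ bivSpan n W := by
  have hanti : ∀ {a b}, a ∈ W → b ∈ W → a ≠ b → maj n a * maj n b = -(maj n b * maj n a) :=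
    fun {a b} ha hb h => maj_anticomm (hW ha).1 (hW ha).2 (hW hb).1 (hW hb).2 h
  have hchain : ∀ {a b c}, a ∈ W → b ∈ W → c ∈ W → a ≠ b → b ≠ c →
      ⁅maj n a * maj n b, maj n b * maj n c⁆ ∈ bivSpan n W := by
    intro a b c ha hb hc hab hbc
    by_cases hac : a = c
    · subst hac
      rw [hanti hb ha hbc, lie_neg, lie_self, neg_zero]
      exact Submodule.zero_mem _
    · rw [lie_biv_chain (hW ha) (hW hb) (hW hc) hab hac hbc]
      exact Submodule.smul_mem _ _ (biv_mem_bivSpan ha hc hac)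
  by_cases h1 : b = c
  · subst h1; exact hchain ha hb hd hab hcd
  by_cases h2 : b = d
  · subst h2
    rw [hanti hc hd hcd, lie_neg]
    exact Submodule.neg_mem _ (hchain ha hb hc hab h1)
  by_cases h3 : a = c
  · subst h3
    rw [hanti ha hb hab, neg_lie]
    exact Submodule.neg_mem _ (hchain hb ha hd hab.symm hcd)
  by_cases h4 : a = d
  · subst h4
    rw [hanti ha hb hab, hanti hc hd hcd, neg_lie, lie_neg, neg_neg]
    exact hchain hb ha hc hab.symm h3
  · rw [(biv_commute (hW ha) (hW hb) (hW hc) (hW hd) h3 h4 h1 h2).lie_eq]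
    exact Submodule.zero_mem _

/-- Bracketing with `γ_b γ_{b+1}` moves the right end of a bivector from `b` to `b + 1`. -/
theorem biv_mem_of_adjacent {L : LieSubalgebra ℝ (Op n)} {p q : ℕ} (hp : 1 ≤ p) (hq : q ≤ 2 * n)
    (h : ∀ k, p ≤ k → k + 1 ≤ q → maj n k * maj n (k + 1) ∈ L) {a b : ℕ} (ha : p ≤ a)
    (hab : a < b) (hb : b ≤ q) : maj n a * maj n b ∈ L := by
  induction b, hab using Nat.le_induction with
  | base => exact h a ha hb
  | succ b hab ih =>
    have h1 := L.lie_mem (ih (by omega)) (h b (by omega) hb)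
    rw [lie_biv_chain ⟨by omega, by omega⟩ ⟨by omega, by omega⟩ ⟨by omega, by omega⟩ (by omega)
      (by omega) (by omega)] at h1
    have h2 := L.smul_mem (1 / 2 : ℝ) h1
    rwa [smul_smul, show (1 / 2 : ℝ) * 2 = 1 by norm_num, one_smul] at h2

/-- A set of bivector combinations of an interval that contains all `γ_k γ_{k+1}` generates the Lie
algebra of all bivectors of the interval. -/
theorem lieSpan_eq_bivSpan {p q : ℕ} (hp : 1 ≤ p) (hq : q ≤ 2 * n) {t : Set (Op n)}
    (ht : t ⊆ bivSpan n (Set.Icc p q))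
    (h : ∀ k, p ≤ k → k + 1 ≤ q → maj n k * maj n (k + 1) ∈ t) :
    (LieSubalgebra.lieSpan ℝ (Op n) t).toSubmodule = bivSpan n (Set.Icc p q) := by
  have hW : Set.Icc p q ⊆ Set.Icc 1 (2 * n) := Set.Icc_subset_Icc hp hq
  refine lieSpan_toSubmodule_eq ?_ ht ?_
  · rintro _ ⟨a, ha, b, hb, hab, rfl⟩ _ ⟨c, hc, d, hd, hcd, rfl⟩
    exact lie_biv_mem hW ha hb hc hd hab hcd
  · rintro _ ⟨a, ha, b, hb, hab, rfl⟩
    have key : ∀ {a b}, p ≤ a → a < b → b ≤ q →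
        maj n a * maj n b ∈ LieSubalgebra.lieSpan ℝ (Op n) t := fun h1 h2 h3 =>
      biv_mem_of_adjacent hp hq (fun k h4 h5 => LieSubalgebra.subset_lieSpan (h k h4 h5)) h1 h2 h3
    rcases Nat.lt_or_ge a b with h' | h'
    · exact key ha.1 h' hb.2
    · rw [maj_anticomm (hW ha).1 (hW ha).2 (hW hb).1 (hW hb).2 hab]
      exact neg_mem (key hb.1 (by omega) ha.2)

/-! ### Bases of bivectors -/

/-- `v` lists the bivectors `γ_{o+a} γ_{o+b}`, `1 ≤ a < b ≤ w`, up to sign. -/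
structure IsBivBasis (n o w : ℕ) {m : ℕ} (v : Fin m → Op n) (p q : Fin m → ℕ) (s : Fin m → ℝ) :
    Prop where
  bound : o + w ≤ 2 * n
  eq : ∀ k, v k = s k • (maj n (o + p k) * maj n (o + q k))
  sign : ∀ k, s k * s k = 1
  lt : ∀ k, 1 ≤ p k ∧ p k < q k ∧ q k ≤ w
  inj : ∀ k l, p k = p l → q k = q l → k = l
  surj : ∀ b < w + 1, ∀ a < b, 1 ≤ a → ∃ k, p k = a ∧ q k = b

theorem IsBivBasis.span_eq {o w m : ℕ} {v : Fin m → Op n} {p q : Fin m → ℕ} {s : Fin m → ℝ}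
    (h : IsBivBasis n o w v p q s) :
    Submodule.span ℝ (Set.range v) = bivSpan n (Set.Icc (o + 1) (o + w)) := by
  have hw := h.bound
  apply le_antisymm
  · rw [Submodule.span_le]
    rintro _ ⟨k, rfl⟩
    obtain ⟨h1, h2, h3⟩ := h.lt k
    rw [h.eq]
    exact Submodule.smul_mem _ _ (biv_mem_bivSpan ⟨by omega, by omega⟩ ⟨by omega, by omega⟩
      (by omega))
  · rw [bivSpan, Submodule.span_le]
    rintro _ ⟨a, ha, b, hb, hab, rfl⟩
    have key : ∀ {a b}, o + 1 ≤ a → a < b → b ≤ o + w →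
        maj n a * maj n b ∈ Submodule.span ℝ (Set.range v) := by
      intro a b h1 h2 h3
      obtain ⟨k, hk, hk'⟩ := h.surj (b - o) (by omega) (a - o) (by omega) (by omega)
      have e : s k • v k = maj n a * maj n b := by
        rw [h.eq, smul_smul, h.sign, one_smul, hk, hk', show o + (a - o) = a by omega,
          show o + (b - o) = b by omega]
      rw [← e]
      exact Submodule.smul_mem _ _ (Submodule.subset_span ⟨k, rfl⟩)
    rcases Nat.lt_or_ge a b with h' | h'
    · exact key ha.1 h' hb.2
    · rw [maj_anticomm (by have := ha.1; omega) (by have := ha.2; omega) (by have := hb.1; omega)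
        (by have := hb.2; omega) hab]
      exact neg_mem (key hb.1 (by omega) ha.2)

/-- Twice the part of an operator that anticommutes with `γ_u`. -/
noncomputable def majOdd (n u : ℕ) : Op n →ₗ[ℝ] Op n :=
  LinearMap.id - (LinearMap.mulLeft ℝ (maj n u)).comp (LinearMap.mulRight ℝ (maj n u))

theorem majOdd_apply (n u : ℕ) (x : Op n) : majOdd n u x = x - maj n u * (x * maj n u) := rfl

theorem majOdd_biv {a b u : ℕ} (ha : a ∈ Set.Icc 1 (2 * n)) (hb : b ∈ Set.Icc 1 (2 * n))
    (hu : u ∈ Set.Icc 1 (2 * n)) (hab : a ≠ b) : majOdd n u (maj n a * maj n b) =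
      if u = a ∨ u = b then (2 : ℝ) • (maj n a * maj n b) else 0 := by
  have e : ∀ {c}, c ∈ Set.Icc 1 (2 * n) → u ≠ c → ∀ x,
      maj n u * (maj n c * x) = -(maj n c * (maj n u * x)) := by
    intro c hc h x
    rw [← mul_assoc, maj_anticomm hu.1 hu.2 hc.1 hc.2 h]; simp [mul_assoc]
  rw [majOdd_apply, mul_assoc]
  by_cases h1 : u = a
  · subst h1
    rw [if_pos (Or.inl rfl), maj_mul_maj_mul, maj_anticomm hb.1 hb.2 hu.1 hu.2 hab.symm,
      sub_neg_eq_add, two_smul]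
  by_cases h2 : u = b
  · subst h2
    rw [if_pos (Or.inr rfl), maj_mul_self, mul_one, maj_anticomm hu.1 hu.2 ha.1 ha.2 h1,
      sub_neg_eq_add, two_smul]
  · rw [if_neg (by tauto), e ha h1, e hb h2, maj_mul_self, mul_one, mul_neg, neg_neg, sub_self]

theorem biv_ne_zero {a b : ℕ} (ha : a ∈ Set.Icc 1 (2 * n)) (hb : b ∈ Set.Icc 1 (2 * n))
    (h : a ≠ b) : maj n a * maj n b ≠ 0 := by
  intro h0
  have := biv_mul_self ha hb h
  rw [h0, zero_mul] at this
  exact one_ne_zero (neg_eq_zero.1 this.symm)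

/-- Applying `majOdd` for both indices of the `k`-th bivector multiplies it by four and kills every
other one, because two bivectors of the list never share both indices. This reads off the `k`-th
coefficient. -/
theorem IsBivBasis.linearIndependent {o w m : ℕ} {v : Fin m → Op n} {p q : Fin m → ℕ}
    {s : Fin m → ℝ} (h : IsBivBasis n o w v p q s) : LinearIndependent ℝ v := by
  have hw := h.bound
  have hp : ∀ k, o + p k ∈ Set.Icc 1 (2 * n) := fun k => by
    have := h.lt k; exact ⟨by omega, by omega⟩
  have hq : ∀ k, o + q k ∈ Set.Icc 1 (2 * n) := fun k => by
    have := h.lt k; exact ⟨by omega, by omega⟩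
  have hpq : ∀ k, o + p k ≠ o + q k := fun k => by have := h.lt k; omega
  rw [Fintype.linearIndependent_iff]
  intro g hg k
  have h1 := congrArg (fun x => majOdd n (o + q k) (majOdd n (o + p k) x)) hg
  simp only [map_sum, map_smul, h.eq, map_zero] at h1
  rw [Finset.sum_eq_single k] at h1
  · rw [majOdd_biv (hp k) (hq k) (hp k) (hpq k), if_pos (Or.inl rfl), map_smul,
      majOdd_biv (hp k) (hq k) (hq k) (hpq k), if_pos (Or.inr rfl)] at h1
    simp only [smul_smul] at h1
    have h2 := (smul_eq_zero.1 h1).resolve_right (biv_ne_zero (hp k) (hq k) (hpq k))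
    have h3 := h.sign k
    have h4 : s k ≠ 0 := by rintro h0; rw [h0] at h3; norm_num at h3
    simpa [h4] using h2
  · intro l _ hl
    rw [majOdd_biv (hp l) (hq l) (hp k) (hpq l)]
    split_ifs with h2
    · rw [map_smul, majOdd_biv (hp l) (hq l) (hq k) (hpq l), if_neg, smul_zero, smul_zero,
        smul_zero]
      intro h3
      have hl1 := h.lt l
      have hk1 := h.lt k
      exact hl (h.inj l k (by omega) (by omega))
    · simp
  · simp

/-- The tables list the two Majorana indices, relative to `2 * j`, and the sign of each string. -/
theorem g2Basis_isBivBasis {j : ℕ} (hj : j + 1 < n) :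
    IsBivBasis n (2 * j) 4 (g2Basis n (j + 1)) ![2, 1, 2, 1, 1, 3] ![3, 4, 4, 3, 2, 4]
      ![1, -1, 1, -1, 1, 1] where
  bound := by omega
  eq := by
    intro k
    have hZ := I_smul_Z (n := n) (j := j + 1) (by omega)
    rw [show 2 * (j + 1) + 1 = 2 * j + 3 by ring, show 2 * (j + 1) + 2 = 2 * j + 4 by ring] at hZ
    fin_cases k <;> simp [g2Basis, I_smul_XX hj, I_smul_YY hj, I_smul_XY hj, I_smul_YX hj,
      I_smul_Z (show j < n by omega), hZ]
  sign := by intro k; fin_cases k <;> simp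
  lt := by decide
  inj := by decide
  surj := by decide

theorem g3Basis_isBivBasis {j : ℕ} (hj : j + 2 < n) :
    IsBivBasis n (2 * j) 6 (g3Basis n (j + 1)) ![2, 1, 2, 1, 4, 3, 4, 3, 1, 3, 5, 2, 2, 1, 1]
      ![3, 4, 4, 3, 5, 6, 6, 5, 2, 4, 6, 5, 6, 5, 6]
      ![1, -1, 1, -1, 1, -1, 1, -1, 1, 1, 1, 1, 1, -1, -1] where
  bound := by omega
  eq := by
    intro k
    have hj' : j + 1 < n := by omega
    have hZ := I_smul_Z (n := n) (j := j + 1) (by omega)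
    have hZ' := I_smul_Z (n := n) (j := j + 2) (by omega)
    have h1 := I_smul_XX (n := n) (j := j + 1) (by omega)
    have h2 := I_smul_YY (n := n) (j := j + 1) (by omega)
    have h3 := I_smul_XY (n := n) (j := j + 1) (by omega)
    have h4 := I_smul_YX (n := n) (j := j + 1) (by omega)
    simp only [mul_add, add_assoc, Nat.reduceAdd, Nat.reduceMul] at hZ hZ' h1 h2 h3 h4
    fin_cases k <;> simp [g3Basis, I_smul_XX hj', I_smul_YY hj', I_smul_XY hj', I_smul_YX hj',
      I_smul_Z (show j < n by omega), hZ, hZ', h1, h2, h3, h4, I_smul_XZX hj, I_smul_XZY hj,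
      I_smul_YZX hj, I_smul_YZY hj, add_assoc]
  sign := by intro k; fin_cases k <;> simp
  lt := by decide
  inj := by decide
  surj := by decide

theorem exponents_subset {j : ℕ} (hj : j + 1 < n) :
    exponents n (j + 1) ⊆ bivSpan n (Set.Icc (2 * j + 1) (2 * j + 4)) := by
  have h := (g2Basis_isBivBasis hj).span_eq
  rw [← h]
  have hm : ∀ k, g2Basis n (j + 1) k ∈ Submodule.span ℝ (Set.range (g2Basis n (j + 1))) :=
    fun k => Submodule.subset_span ⟨k, rfl⟩
  rintro x (rfl | rfl | rfl | rfl)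
  · exact hm 4
  · exact hm 5
  · exact hm 0
  · exact hm 1

theorem adjacent_mem_exponents {j k : ℕ} (hj : j + 1 < n) (h1 : 2 * j + 1 ≤ k)
    (h2 : k + 1 ≤ 2 * j + 4) : maj n k * maj n (k + 1) ∈ exponents n (j + 1) := by
  obtain rfl | rfl | rfl : k = 2 * j + 1 ∨ k = 2 * j + 2 ∨ k = 2 * (j + 1) + 1 := by omega
  · rw [← I_smul_Z (by omega)]; simp [exponents]
  · rw [← I_smul_XX hj]; simp [exponents]
  · rw [← I_smul_Z (by omega)]; simp [exponents]

theorem g2_toSubmodule {j : ℕ} (hj : j + 1 < n) :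
    (g2 n (j + 1)).toSubmodule = bivSpan n (Set.Icc (2 * j + 1) (2 * j + 4)) :=
  lieSpan_eq_bivSpan (by omega) (by omega) (exponents_subset hj)
    fun _ h1 h2 => adjacent_mem_exponents hj h1 h2

theorem g3_toSubmodule {j : ℕ} (hj : j + 2 < n) :
    (g3 n (j + 1)).toSubmodule = bivSpan n (Set.Icc (2 * j + 1) (2 * j + 6)) := by
  refine lieSpan_eq_bivSpan (by omega) (by omega) (Set.union_subset ?_ ?_) fun k h1 h2 => ?_
  · exact (exponents_subset (by omega)).trans
      (bivSpan_mono (Set.Icc_subset_Icc le_rfl (by omega)))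
  · exact (exponents_subset (j := j + 1) (by omega)).trans
      (bivSpan_mono (Set.Icc_subset_Icc (by omega) (by omega)))
  · rcases Nat.lt_or_ge k (2 * j + 4) with h | h
    · exact Or.inl (adjacent_mem_exponents (by omega) h1 (by omega))
    · exact Or.inr (adjacent_mem_exponents (j := j + 1) (by omega) (by omega) (by omega))

/-! ### Fixed points of the conjugation by `Z` -/

/-- Conjugation by `T` flips the sign of `γ_u` and `γ_v` and fixes the other Majoranas of `W`. A
bivector is therefore fixed exactly when it contains both or neither of them. -/
theorem fixedPoints_bivSpan {W : Set ℕ} (hW : W ⊆ Set.Icc 1 (2 * n)) {u v : ℕ} (hu : u ∈ W)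
    (hv : v ∈ W) (huv : u ≠ v) {T : Op n} (hT : Complex.I • T = maj n u * maj n v) (x : Op n) :
    (x ∈ bivSpan n W ∧ T * x * T = x) ↔
      x ∈ bivSpan n (W \ {u, v}) ⊔ Submodule.span ℝ {Complex.I • T} := by
  have hT' : T = (-Complex.I) • (maj n u * maj n v) := by rw [← hT, smul_smul]; simp
  have hTT : T * T = 1 := by
    rw [hT', smul_mul_assoc, mul_smul_comm, biv_mul_self (hW hu) (hW hv) huv, smul_smul]
    simp
  have hanti : ∀ {a b}, a ∈ W → b ∈ W → a ≠ b → maj n a * maj n b = -(maj n b * maj n a) :=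
    fun {a b} ha hb h => maj_anticomm (hW ha).1 (hW ha).2 (hW hb).1 (hW hb).2 h
  have hin : ∀ {a}, a = u ∨ a = v → T * maj n a = -(maj n a * T) := by
    rintro a (rfl | rfl)
    · rw [hT', smul_mul_assoc, mul_smul_comm, maj_mul_maj_mul, hanti hu hv huv, neg_mul, mul_assoc,
        maj_mul_self, mul_one, smul_neg]
    · rw [hT', smul_mul_assoc, mul_smul_comm, mul_assoc, maj_mul_self, mul_one, hanti hu hv huv,
        mul_neg, maj_mul_maj_mul, smul_neg, neg_neg]
  have hout : ∀ {a}, a ∈ W → ¬(a = u ∨ a = v) → T * maj n a = maj n a * T := by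
    intro a ha h
    push Not at h
    rw [hT', smul_mul_assoc, mul_smul_comm, mul_assoc, hanti hv ha h.2.symm, mul_neg, ← mul_assoc,
      hanti hu ha h.1.symm, neg_mul, neg_neg, mul_assoc]
  -- `K` is twice the averaging projection onto the fixed points, so a fixed `x` is `K x / 2`, and
  -- it suffices to evaluate `K` on bivectors.
  let K : Op n →ₗ[ℝ] Op n :=
    LinearMap.id + (LinearMap.mulRight ℝ T).comp (LinearMap.mulLeft ℝ T)
  have hK : ∀ y, K y = y + T * y * T := fun y => rfl
  constructor
  · rintro ⟨hx, hfix⟩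
    have hle : bivSpan n W ≤
        (bivSpan n (W \ {u, v}) ⊔ Submodule.span ℝ {Complex.I • T}).comap K := by
      rw [bivSpan, Submodule.span_le]
      rintro _ ⟨a, ha, b, hb, hab, rfl⟩
      have hab' : T * (maj n a * maj n b) * T = T * maj n a * (maj n b * T) := by
        simp only [mul_assoc]
      rw [SetLike.mem_coe, Submodule.mem_comap, hK, hab']
      by_cases h1 : a = u ∨ a = v
      · by_cases h2 : b = u ∨ b = v
        · refine Submodule.mem_sup_right ?_
          have e : maj n a * maj n b ∈ Submodule.span ℝ {Complex.I • T} := by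
            rw [hT]
            rcases h1 with rfl | rfl <;> rcases h2 with rfl | rfl
            · exact absurd rfl hab
            · exact Submodule.mem_span_singleton_self _
            · rw [hanti ha hb hab]
              exact neg_mem (Submodule.mem_span_singleton_self _)
            · exact absurd rfl hab
          rw [hin h1, ← neg_neg (maj n b * T), ← hin h2, neg_mul_neg, mul_assoc, ← mul_assoc T,
            hTT, one_mul]
          exact add_mem e e
        · rw [hin h1, ← hout hb h2, neg_mul, mul_assoc, ← mul_assoc T, hTT, one_mul,
            add_neg_cancel]
          exact Submodule.zero_mem _
      · by_cases h2 : b = u ∨ b = v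
        · rw [hout ha h1, ← neg_neg (maj n b * T), ← hin h2, mul_neg, mul_assoc, ← mul_assoc T,
            hTT, one_mul, add_neg_cancel]
          exact Submodule.zero_mem _
        · refine Submodule.mem_sup_left ?_
          have e : maj n a * maj n b ∈ bivSpan n (W \ {u, v}) :=
            biv_mem_bivSpan ⟨ha, h1⟩ ⟨hb, h2⟩ hab
          rw [hout ha h1, ← hout hb h2, mul_assoc, ← mul_assoc T, hTT, one_mul]
          exact add_mem e e
    have h1 : (1 / 2 : ℝ) • K x ∈ bivSpan n (W \ {u, v}) ⊔ Submodule.span ℝ {Complex.I • T} :=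
      Submodule.smul_mem _ _ (hle hx)
    rw [hK, hfix, ← two_smul ℝ x, smul_smul, show (1 / 2 : ℝ) * 2 = 1 by norm_num, one_smul] at h1
    exact h1
  · intro hx
    have hle : bivSpan n (W \ {u, v}) ⊔ Submodule.span ℝ {Complex.I • T} ≤
        bivSpan n W ⊓ LinearMap.eqLocus ((LinearMap.mulRight ℝ T).comp (LinearMap.mulLeft ℝ T))
          LinearMap.id := by
      refine sup_le (Submodule.span_le.2 ?_) (Submodule.span_le.2 ?_)
      · rintro _ ⟨a, ha, b, hb, hab, rfl⟩
        refine ⟨biv_mem_bivSpan ha.1 hb.1 hab, ?_⟩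
        change T * (maj n a * maj n b) * T = maj n a * maj n b
        rw [← mul_assoc, hout ha.1 ha.2, mul_assoc, mul_assoc, ← hout hb.1 hb.2, ← mul_assoc T, hTT,
          one_mul]
      · rintro _ rfl
        refine ⟨hT ▸ biv_mem_bivSpan hu hv huv, ?_⟩
        change T * (Complex.I • T) * T = Complex.I • T
        rw [mul_smul_comm, hTT, smul_mul_assoc, one_mul]
    exact hle hx

theorem fixedPoints_g3_right {j : ℕ} (hj : j + 2 < n) (x : Op n) :
    (x ∈ g3 n (j + 1) ∧ Z n (j + 3) * x * Z n (j + 3) = x) ↔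
      x ∈ (g2 n (j + 1)).toSubmodule ⊔ Submodule.span ℝ {Complex.I • Z n (j + 3)} := by
  rw [← LieSubalgebra.mem_toSubmodule, g3_toSubmodule hj, g2_toSubmodule (by omega),
    fixedPoints_bivSpan (u := 2 * j + 5) (v := 2 * j + 6)
    (Set.Icc_subset_Icc (by omega) (by omega)) ⟨by omega, by omega⟩ ⟨by omega, by omega⟩ (by omega)
    (I_smul_Z (j := j + 2) (by omega))]
  congr! 3
  ext a
  simp only [Set.mem_sdiff, Set.mem_Icc, Set.mem_insert_iff, Set.mem_singleton_iff]
  omega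

theorem fixedPoints_g3_left {j : ℕ} (hj : j + 2 < n) (x : Op n) :
    (x ∈ g3 n (j + 1) ∧ Z n (j + 1) * x * Z n (j + 1) = x) ↔
      x ∈ (g2 n (j + 2)).toSubmodule ⊔ Submodule.span ℝ {Complex.I • Z n (j + 1)} := by
  rw [← LieSubalgebra.mem_toSubmodule, g3_toSubmodule hj, g2_toSubmodule (j := j + 1) (by omega),
    fixedPoints_bivSpan (u := 2 * j + 1) (v := 2 * j + 2)
    (Set.Icc_subset_Icc (by omega) (by omega)) ⟨by omega, by omega⟩ ⟨by omega, by omega⟩ (by omega)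
    (I_smul_Z (j := j) (by omega))]
  congr! 3
  ext a
  simp only [Set.mem_sdiff, Set.mem_Icc, Set.mem_insert_iff, Set.mem_singleton_iff]
  omega

/-! ### The two copies of `su(2)` -/

theorem su2_entries (A : su2) : (A.1 0 0).re = 0 ∧ (A.1 1 1).re = 0 ∧
    (A.1 1 1).im = -(A.1 0 0).im ∧ (A.1 1 0).re = -(A.1 0 1).re ∧
      (A.1 1 0).im = (A.1 0 1).im := by
  obtain ⟨A, hA, ht⟩ := A
  have h00 := congrFun (congrFun hA 0) 0
  have h01 := congrFun (congrFun hA 0) 1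
  have h11 := congrFun (congrFun hA 1) 1
  rw [Matrix.trace_fin_two] at ht
  simp only [Matrix.conjTranspose_apply, Matrix.neg_apply, Complex.ext_iff, Complex.star_def,
    Complex.conj_re, Complex.conj_im, Complex.neg_re, Complex.neg_im, Complex.add_re,
    Complex.add_im, Complex.zero_re, Complex.zero_im] at h00 h01 h11 ht
  refine ⟨?_, ?_, ?_, ?_, ?_⟩ <;> linarith [h00.1, h01.1, h01.2, h11.1, ht.1, ht.2]

/-- Three elements with the commutation relations of `su(2)` define a homomorphism. -/
noncomputable def su2Hom (u : Fin 3 → Op n) (ε : ℝ) (hε : ε * ε = 1)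
    (h01 : ⁅u 0, u 1⁆ = (2 * ε) • u 2) (h12 : ⁅u 1, u 2⁆ = (2 * ε) • u 0)
    (h20 : ⁅u 2, u 0⁆ = (2 * ε) • u 1) : su2 →ₗ⁅ℝ⁆ Op n where
  toFun A := (A.1 0 1).im • u 0 + (A.1 0 0).im • u 1 + (ε * (A.1 0 1).re) • u 2
  map_add' A B := by
    change (A.1 0 1 + B.1 0 1).im • u 0 + (A.1 0 0 + B.1 0 0).im • u 1 +
      (ε * (A.1 0 1 + B.1 0 1).re) • u 2 = _
    simp only [Complex.add_im, Complex.add_re]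
    module
  map_smul' c A := by
    change (c • A.1 0 1).im • u 0 + (c • A.1 0 0).im • u 1 + (ε * (c • A.1 0 1).re) • u 2 = _
    simp only [Complex.smul_im, Complex.smul_re, RingHom.id_apply, smul_eq_mul]
    module
  map_lie' := by
    intro A B
    obtain ⟨a1, a2, a3, a4, a5⟩ := su2_entries A
    obtain ⟨b1, b2, b3, b4, b5⟩ := su2_entries B
    have h10 : ⁅u 1, u 0⁆ = -((2 * ε) • u 2) := by rw [← h01, lie_skew]
    have h21 : ⁅u 2, u 1⁆ = -((2 * ε) • u 0) := by rw [← h12, lie_skew]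
    have h02 : ⁅u 0, u 2⁆ = -((2 * ε) • u 1) := by rw [← h20, lie_skew]
    simp only [lie_add, add_lie, lie_smul, smul_lie, lie_self, h01, h12, h20, h10, h21, h02]
    simp only [LieSubalgebra.coe_bracket, Ring.lie_def, Matrix.sub_apply, Matrix.mul_apply,
      Fin.sum_univ_two, Complex.add_re, Complex.add_im, Complex.sub_re, Complex.sub_im,
      Complex.mul_re, Complex.mul_im, a1, a2, a3, a4, a5, b1, b2, b3, b4, b5]
    match_scalars
    · linear_combination (-2 * (A.1 0 0).im * (B.1 0 1).re + 2 * (A.1 0 1).re * (B.1 0 0).im) * hε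
    · linear_combination (2 * (A.1 0 1).im * (B.1 0 1).re - 2 * (A.1 0 1).re * (B.1 0 1).im) * hε
    · ring

/-- `su2Hom` is injective by independence, and its range is closed under brackets, so the generated
Lie algebra is no larger than the span. The sign `ε` allows both orientations of the triple. -/
theorem su2_of_triple (u : Fin 3 → Op n) (ε : ℝ) (hε : ε * ε = 1)
    (h01 : ⁅u 0, u 1⁆ = (2 * ε) • u 2) (h12 : ⁅u 1, u 2⁆ = (2 * ε) • u 0)
    (h20 : ⁅u 2, u 0⁆ = (2 * ε) • u 1) (hu : LinearIndependent ℝ u) :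
    (LieSubalgebra.lieSpan ℝ (Op n) (Set.range u)).toSubmodule =
        Submodule.span ℝ (Set.range u) ∧
      Nonempty (LieSubalgebra.lieSpan ℝ (Op n) (Set.range u) ≃ₗ⁅ℝ⁆ su2) := by
  set f := su2Hom u ε hε h01 h12 h20
  have hf : ∀ A, f A = (A.1 0 1).im • u 0 + (A.1 0 0).im • u 1 + (ε * (A.1 0 1).re) • u 2 :=
    fun A => rfl
  have hε0 : ε ≠ 0 := by rintro rfl; norm_num at hε
  have hinj : Function.Injective f := by
    rw [injective_iff_map_eq_zero]
    intro A hA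
    have h := Fintype.linearIndependent_iff.1 hu ![(A.1 0 1).im, (A.1 0 0).im, ε * (A.1 0 1).re]
      (by rw [Fin.sum_univ_three]; exact (hf A).symm.trans hA)
    have e0 : (A.1 0 1).im = 0 := h 0
    have e1 : (A.1 0 0).im = 0 := h 1
    have e2 : (A.1 0 1).re = 0 := (mul_eq_zero.1 (h 2)).resolve_left hε0
    obtain ⟨a1, a2, a3, a4, a5⟩ := su2_entries A
    apply Subtype.ext
    ext i j
    fin_cases i <;> fin_cases j <;> apply Complex.ext <;> simp [*]
  have hrange : f.range.toSubmodule = Submodule.span ℝ (Set.range u) := by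
    apply le_antisymm
    · rintro _ ⟨A, rfl⟩
      have hm : ∀ k, u k ∈ Submodule.span ℝ (Set.range u) :=
        fun k => Submodule.subset_span ⟨k, rfl⟩
      change f A ∈ _
      rw [hf]
      exact add_mem (add_mem (Submodule.smul_mem _ _ (hm 0)) (Submodule.smul_mem _ _ (hm 1)))
        (Submodule.smul_mem _ _ (hm 2))
    · rw [Submodule.span_le]
      rintro _ ⟨k, rfl⟩
      -- The preimages are `iX`, `iZ` and `ε iY`.
      fin_cases k
      · refine ⟨⟨!![0, Complex.I; Complex.I, 0], ?_, ?_⟩, ?_⟩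
        · ext i j; fin_cases i <;> fin_cases j <;> simp [Matrix.conjTranspose_apply]
        · simp [Matrix.trace_fin_two]
        · change f _ = _; rw [hf]; simp
      · refine ⟨⟨!![Complex.I, 0; 0, -Complex.I], ?_, ?_⟩, ?_⟩
        · ext i j; fin_cases i <;> fin_cases j <;> simp [Matrix.conjTranspose_apply]
        · simp [Matrix.trace_fin_two]
        · change f _ = _; rw [hf]; simp
      · refine ⟨⟨!![0, (ε : ℂ); -(ε : ℂ), 0], ?_, ?_⟩, ?_⟩
        · ext i j; fin_cases i <;> fin_cases j <;> simp [Matrix.conjTranspose_apply]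
        · simp [Matrix.trace_fin_two]
        · change f _ = _; rw [hf]; simp [hε]
  have heq : LieSubalgebra.lieSpan ℝ (Op n) (Set.range u) = f.range := by
    apply le_antisymm
    · rw [LieSubalgebra.lieSpan_le]
      intro x hx
      have : x ∈ f.range.toSubmodule := hrange ▸ Submodule.subset_span hx
      exact this
    · intro x hx
      have h1 : x ∈ f.range.toSubmodule := hx
      rw [hrange] at h1
      exact LieSubalgebra.submodule_span_le_lieSpan h1
  rw [heq]
  exact ⟨hrange, ⟨(LieEquiv.ofInjective f hinj).symm⟩⟩

theorem lie_eq_zero_of_span {s t : Set (Op n)} (h : ∀ x ∈ s, ∀ y ∈ t, ⁅x, y⁆ = 0) {x y : Op n}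
    (hx : x ∈ Submodule.span ℝ s) (hy : y ∈ Submodule.span ℝ t) : ⁅x, y⁆ = 0 := by
  induction hx using Submodule.span_induction with
  | mem x hx =>
    induction hy using Submodule.span_induction with
    | mem y hy => exact h x hx y hy
    | zero => rw [lie_zero]
    | add y z _ _ hy hz => rw [lie_add, hy, hz, add_zero]
    | smul c y _ hy => rw [lie_smul, hy, smul_zero]
  | zero => rw [zero_lie]
  | add x z _ _ hx hz => rw [add_lie, hx, hz, add_zero]
  | smul c x _ hx => rw [smul_lie, hx, smul_zero]

/-- The three elements spanning one of the two copies of `su(2)` in the bivectors of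
`γ_{o+1}, …, γ_{o+4}`. -/
noncomputable def chiralTriple (n o : ℕ) (σ : ℝ) : Fin 3 → Op n :=
  ![(1 / 2 : ℝ) • (maj n (o + 2) * maj n (o + 3) + σ • (maj n (o + 1) * maj n (o + 4))),
    (1 / 2 : ℝ) • (maj n (o + 1) * maj n (o + 2) + σ • (maj n (o + 3) * maj n (o + 4))),
    (1 / 2 : ℝ) • (maj n (o + 2) * maj n (o + 4) - σ • (maj n (o + 1) * maj n (o + 3)))]

/-- These are the self-dual and anti-self-dual halves of `so(4)`: each vector joins a bivector to
the complementary one with a relative sign fixed by `σ`. The rewriting orders all Majorana products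
by index. -/
theorem chiralTriple_relations {o : ℕ} (ho : o + 4 ≤ 2 * n) (σ : ℝ) (hσ : σ * σ = 1) :
    ⁅chiralTriple n o σ 0, chiralTriple n o σ 1⁆ = (2 * σ) • chiralTriple n o σ 2 ∧
    ⁅chiralTriple n o σ 1, chiralTriple n o σ 2⁆ = (2 * σ) • chiralTriple n o σ 0 ∧
    ⁅chiralTriple n o σ 2, chiralTriple n o σ 0⁆ = (2 * σ) • chiralTriple n o σ 1 ∧
    ∀ i j, ⁅chiralTriple n o σ i, chiralTriple n o (-σ) j⁆ = 0 := by
  have anti : ∀ a b, a < b → b ≤ 4 → 1 ≤ a →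
      maj n (o + b) * maj n (o + a) = -(maj n (o + a) * maj n (o + b)) := fun a b h1 h2 h3 =>
    maj_anticomm (by omega) (by omega) (by omega) (by omega) (by omega)
  have anti' : ∀ a b, a < b → b ≤ 4 → 1 ≤ a → ∀ x,
      maj n (o + b) * (maj n (o + a) * x) = -(maj n (o + a) * (maj n (o + b) * x)) :=
    fun a b h1 h2 h3 x => by rw [← mul_assoc, anti a b h1 h2 h3]; simp [mul_assoc]
  have h21 := anti 1 2 (by omega) (by omega) (by omega)
  have h31 := anti 1 3 (by omega) (by omega) (by omega)
  have h32 := anti 2 3 (by omega) (by omega) (by omega)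
  have h42 := anti 2 4 (by omega) (by omega) (by omega)
  have h43 := anti 3 4 (by omega) (by omega) (by omega)
  have h21' := anti' 1 2 (by omega) (by omega) (by omega)
  have h31' := anti' 1 3 (by omega) (by omega) (by omega)
  have h41' := anti' 1 4 (by omega) (by omega) (by omega)
  have h32' := anti' 2 3 (by omega) (by omega) (by omega)
  have h42' := anti' 2 4 (by omega) (by omega) (by omega)
  have h43' := anti' 3 4 (by omega) (by omega) (by omega)
  have e0 : ∀ σ : ℝ, chiralTriple n o σ 0 = (1 / 2 : ℝ) • (maj n (o + 2) * maj n (o + 3) +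
    σ • (maj n (o + 1) * maj n (o + 4))) := fun _ => rfl
  have e1 : ∀ σ : ℝ, chiralTriple n o σ 1 = (1 / 2 : ℝ) • (maj n (o + 1) * maj n (o + 2) +
    σ • (maj n (o + 3) * maj n (o + 4))) := fun _ => rfl
  have e2 : ∀ σ : ℝ, chiralTriple n o σ 2 = (1 / 2 : ℝ) • (maj n (o + 2) * maj n (o + 4) -
    σ • (maj n (o + 1) * maj n (o + 3))) := fun _ => rfl
  have hσ2 : σ ^ 2 = 1 := by rw [sq, hσ]
  refine ⟨?_, ?_, ?_, fun i j => ?_⟩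
  rotate_left 3
  · fin_cases i <;> fin_cases j <;>
    · simp only [Fin.zero_eta, Fin.mk_one, Fin.reduceFinMk, e0, e1, e2, Ring.lie_def, mul_add,
        add_mul, smul_mul_assoc, mul_smul_comm, mul_sub, sub_mul, smul_add, smul_sub, mul_assoc,
        h21, h31, h32, h42, h43, h21', h31', h41', h32', h42', h43', maj_mul_self,
        maj_mul_maj_mul, mul_neg, neg_neg, mul_one, smul_neg]
      match_scalars <;> ring_nf <;> simp only [hσ2] <;> norm_num
  all_goals
    simp only [e0, e1, e2, Ring.lie_def, mul_add, add_mul, smul_mul_assoc, mul_smul_comm, mul_sub,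
      sub_mul, smul_add, smul_sub, mul_assoc, h21, h31, h32, h42, h43, h21', h31', h41', h32',
      h42', h43', maj_mul_self, maj_mul_maj_mul, mul_neg, neg_neg, mul_one, smul_neg]
    match_scalars <;> ring_nf <;> norm_num [hσ2]

theorem chiralTriple_linearIndependent {j : ℕ} (hj : j + 1 < n) (σ : ℝ) :
    LinearIndependent ℝ (chiralTriple n (2 * j) σ) := by
  have h := (g2Basis_isBivBasis hj).linearIndependent
  have hg := (g2Basis_isBivBasis hj).eq
  rw [Fintype.linearIndependent_iff] at h ⊢
  intro g hg0
  -- The same combination expanded over `g2Basis`; the strings `YY` and `YX` are negative bivectors.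
  have key := h ![g 0 / 2, -(σ * g 0 / 2), g 2 / 2, σ * g 2 / 2, g 1 / 2, σ * g 1 / 2] (by
    rw [← hg0, Fin.sum_univ_three, Fin.sum_univ_six]
    simp only [hg, chiralTriple]
    simp
    module)
  intro k
  fin_cases k
  · simpa using key 0
  · simpa using key 4
  · simpa using key 2

theorem gPlusBasis_eq {j : ℕ} (hj : j + 1 < n) :
    gPlusBasis n (j + 1) = chiralTriple n (2 * j) (-1) := by
  have hZ := I_smul_Z (n := n) (j := j + 1) (by omega)
  simp only [mul_add, add_assoc, Nat.reduceAdd, Nat.reduceMul] at hZ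
  have half : ∀ x y : Op n, (Complex.I / 2) • (x + y) = (1 / 2 : ℝ) • (Complex.I • x + Complex.I • y)
      := by
    intro x y; rw [← Complex.coe_smul]; push_cast; module
  rw [gPlusBasis, chiralTriple]
  simp only [sub_eq_add_neg, half, smul_neg, I_smul_XX hj, I_smul_YY hj, I_smul_XY hj,
    I_smul_YX hj, I_smul_Z (show j < n by omega), add_assoc, Nat.reduceAdd, hZ, neg_smul, one_smul,
    neg_neg]

theorem gMinusBasis_eq {j : ℕ} (hj : j + 1 < n) :
    gMinusBasis n (j + 1) = chiralTriple n (2 * j) 1 := by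
  have hZ := I_smul_Z (n := n) (j := j + 1) (by omega)
  simp only [mul_add, add_assoc, Nat.reduceAdd, Nat.reduceMul] at hZ
  have half : ∀ x y : Op n, (Complex.I / 2) • (x + y) = (1 / 2 : ℝ) • (Complex.I • x + Complex.I • y)
      := by
    intro x y; rw [← Complex.coe_smul]; push_cast; module
  rw [gMinusBasis, chiralTriple]
  simp only [sub_eq_add_neg, half, smul_neg, I_smul_XX hj, I_smul_YY hj, I_smul_XY hj,
    I_smul_YX hj, I_smul_Z (show j < n by omega), add_assoc, Nat.reduceAdd, hZ, one_smul, neg_neg]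

theorem span_chiralTriple_sup {j : ℕ} (hj : j + 1 < n) :
    Submodule.span ℝ (Set.range (chiralTriple n (2 * j) (-1))) ⊔
      Submodule.span ℝ (Set.range (chiralTriple n (2 * j) 1)) =
        bivSpan n (Set.Icc (2 * j + 1) (2 * j + 4)) := by
  rw [← (g2Basis_isBivBasis hj).span_eq, ← Submodule.span_union]
  have hg := (g2Basis_isBivBasis hj).eq
  apply le_antisymm
  · rw [Submodule.span_le]
    rw [(g2Basis_isBivBasis hj).span_eq]
    have hm : ∀ a b, 1 ≤ a → a < b → b ≤ 4 → maj n (2 * j + a) * maj n (2 * j + b) ∈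
        bivSpan n (Set.Icc (2 * j + 1) (2 * j + 4)) := fun a b h1 h2 h3 =>
      biv_mem_bivSpan ⟨by omega, by omega⟩ ⟨by omega, by omega⟩ (by omega)
    have key : ∀ σ k, chiralTriple n (2 * j) σ k ∈
        bivSpan n (Set.Icc (2 * j + 1) (2 * j + 4)) := by
      intro σ k
      fin_cases k
      · exact Submodule.smul_mem _ _ (add_mem (hm 2 3 (by omega) (by omega) (by omega))
          (Submodule.smul_mem _ _ (hm 1 4 (by omega) (by omega) (by omega))))
      · exact Submodule.smul_mem _ _ (add_mem (hm 1 2 (by omega) (by omega) (by omega))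
          (Submodule.smul_mem _ _ (hm 3 4 (by omega) (by omega) (by omega))))
      · exact Submodule.smul_mem _ _ (sub_mem (hm 2 4 (by omega) (by omega) (by omega))
          (Submodule.smul_mem _ _ (hm 1 3 (by omega) (by omega) (by omega))))
    rintro x (⟨k, rfl⟩ | ⟨k, rfl⟩) <;> exact key _ k
  · rw [Submodule.span_le]
    have hm : ∀ k, chiralTriple n (2 * j) (-1) k ∈ Submodule.span ℝ
        (Set.range (chiralTriple n (2 * j) (-1)) ∪ Set.range (chiralTriple n (2 * j) 1)) :=
      fun k => Submodule.subset_span (Or.inl ⟨k, rfl⟩)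
    have hp : ∀ k, chiralTriple n (2 * j) 1 k ∈ Submodule.span ℝ
        (Set.range (chiralTriple n (2 * j) (-1)) ∪ Set.range (chiralTriple n (2 * j) 1)) :=
      fun k => Submodule.subset_span (Or.inr ⟨k, rfl⟩)
    have e : ∀ k, g2Basis n (j + 1) k = ![chiralTriple n (2 * j) 1 0 + chiralTriple n (2 * j) (-1) 0,
        chiralTriple n (2 * j) (-1) 0 - chiralTriple n (2 * j) 1 0,
        chiralTriple n (2 * j) 1 2 + chiralTriple n (2 * j) (-1) 2,
        chiralTriple n (2 * j) 1 2 - chiralTriple n (2 * j) (-1) 2,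
        chiralTriple n (2 * j) 1 1 + chiralTriple n (2 * j) (-1) 1,
        chiralTriple n (2 * j) 1 1 - chiralTriple n (2 * j) (-1) 1] k := by
      intro k
      fin_cases k <;> simp [hg, chiralTriple] <;> module
    rintro _ ⟨k, rfl⟩
    rw [e]
    fin_cases k
    · exact add_mem (hp 0) (hm 0)
    · exact sub_mem (hm 0) (hp 0)
    · exact add_mem (hp 2) (hm 2)
    · exact sub_mem (hp 2) (hm 2)
    · exact add_mem (hp 1) (hm 1)
    · exact sub_mem (hp 1) (hm 1)

theorem disjoint_span_chiralTriple {j : ℕ} (hj : j + 1 < n) :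
    Disjoint (Submodule.span ℝ (Set.range (chiralTriple n (2 * j) (-1))))
      (Submodule.span ℝ (Set.range (chiralTriple n (2 * j) 1))) := by
  have hg := (g2Basis_isBivBasis hj).eq
  rw [Submodule.disjoint_def]
  intro x h1 h2
  obtain ⟨a, ha⟩ := (Submodule.mem_span_range_iff_exists_fun ℝ).1 h1
  obtain ⟨b, hb⟩ := (Submodule.mem_span_range_iff_exists_fun ℝ).1 h2
  have key := Fintype.linearIndependent_iff.1 (g2Basis_isBivBasis hj).linearIndependent
    ![(a 0 - b 0) / 2, (a 0 + b 0) / 2, (a 2 - b 2) / 2, -((a 2 + b 2) / 2), (a 1 - b 1) / 2,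
      -((a 1 + b 1) / 2)] (by
    have : x - x = 0 := sub_self x
    nth_rewrite 1 [← ha] at this
    rw [← hb] at this
    rw [← this, Fin.sum_univ_three, Fin.sum_univ_three, Fin.sum_univ_six]
    simp only [hg, chiralTriple]
    simp
    module)
  have k0 : (a 0 - b 0) / 2 = 0 := key 0
  have k1 : (a 0 + b 0) / 2 = 0 := key 1
  have k2 : (a 2 - b 2) / 2 = 0 := key 2
  have k3 : -((a 2 + b 2) / 2) = 0 := key 3
  have k4 : (a 1 - b 1) / 2 = 0 := key 4
  have k5 : -((a 1 + b 1) / 2) = 0 := key 5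
  rw [← ha, Fin.sum_univ_three, show a 0 = 0 by linarith, show a 1 = 0 by linarith,
    show a 2 = 0 by linarith]
  simp

/-- The two-site algebra: its basis and its splitting into two commuting copies of `su(2)`. -/
theorem g2_structure {j : ℕ} (hj : j + 1 < n) :
    LinearIndependent ℝ (g2Basis n (j + 1)) ∧
    (g2 n (j + 1)).toSubmodule = Submodule.span ℝ (Set.range (g2Basis n (j + 1))) ∧
    (gPlus n (j + 1)).toSubmodule = Submodule.span ℝ (Set.range (gPlusBasis n (j + 1))) ∧
    (gMinus n (j + 1)).toSubmodule = Submodule.span ℝ (Set.range (gMinusBasis n (j + 1))) ∧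
    Nonempty (gPlus n (j + 1) ≃ₗ⁅ℝ⁆ su2) ∧ Nonempty (gMinus n (j + 1) ≃ₗ⁅ℝ⁆ su2) ∧
    (∀ x ∈ gPlus n (j + 1), ∀ y ∈ gMinus n (j + 1), ⁅x, y⁆ = 0) ∧
    (gPlus n (j + 1)).toSubmodule ⊔ (gMinus n (j + 1)).toSubmodule =
      (g2 n (j + 1)).toSubmodule ∧
    Disjoint (gPlus n (j + 1)).toSubmodule (gMinus n (j + 1)).toSubmodule := by
  obtain ⟨p1, p2, p3, p4⟩ :=
    chiralTriple_relations (n := n) (o := 2 * j) (by omega) (-1) (by norm_num)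
  obtain ⟨m1, m2, m3, -⟩ :=
    chiralTriple_relations (n := n) (o := 2 * j) (by omega) 1 (by norm_num)
  obtain ⟨hp, hp'⟩ := su2_of_triple _ (-1) (by norm_num) p1 p2 p3
    (chiralTriple_linearIndependent hj _)
  obtain ⟨hm, hm'⟩ := su2_of_triple _ 1 (by norm_num) m1 m2 m3
    (chiralTriple_linearIndependent hj _)
  rw [← gPlusBasis_eq hj] at hp hp'
  rw [← gMinusBasis_eq hj] at hm hm'
  change (gPlus n (j + 1)).toSubmodule = _ at hp
  change (gMinus n (j + 1)).toSubmodule = _ at hm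
  refine ⟨(g2Basis_isBivBasis hj).linearIndependent, ?_, hp, hm, hp', hm', ?_, ?_, ?_⟩
  · rw [g2_toSubmodule hj, (g2Basis_isBivBasis hj).span_eq]
  · intro x hx y hy
    rw [← LieSubalgebra.mem_toSubmodule, hp, gPlusBasis_eq hj] at hx
    rw [← LieSubalgebra.mem_toSubmodule, hm, gMinusBasis_eq hj] at hy
    refine lie_eq_zero_of_span ?_ hx hy
    rintro _ ⟨i, rfl⟩ _ ⟨k, rfl⟩
    have := p4 i k
    rwa [neg_neg] at this
  · rw [hp, hm, gPlusBasis_eq hj, gMinusBasis_eq hj, span_chiralTriple_sup hj, g2_toSubmodule hj]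
  · rw [hp, hm, gPlusBasis_eq hj, gMinusBasis_eq hj]
    exact disjoint_span_chiralTriple hj

end TFXY

namespace TFXY

variable {n : ℕ}

/-! ### The groups generated by TFIM rotations -/

theorem tfimGen_mul_self {k : ℕ} (h1 : 1 ≤ k) (h2 : k + 1 ≤ 2 * n) :
    tfimGen n k * tfimGen n k = 1 := by
  rw [tfimGen, smul_mul_assoc, mul_smul_comm,
    biv_mul_self ⟨h1, by omega⟩ ⟨by omega, h2⟩ (by omega), smul_smul]
  simp

theorem tfimGen_commute {k l : ℕ} (h1 : 1 ≤ k) (h2 : k + 1 < l) (h3 : l + 1 ≤ 2 * n) :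
    Commute (tfimGen n k) (tfimGen n l) :=
  ((biv_commute ⟨by omega, by omega⟩ ⟨by omega, by omega⟩ ⟨by omega, by omega⟩ ⟨by omega, by omega⟩
    (by omega) (by omega) (by omega) (by omega)).smul_left _).smul_right _

theorem tfimGen_anticomm {k : ℕ} (h1 : 1 ≤ k) (h2 : k + 2 ≤ 2 * n) :
    tfimGen n (k + 1) * tfimGen n k = -(tfimGen n k * tfimGen n (k + 1)) := by
  have e1 : maj n (k + 1) * maj n (k + 2) * (maj n k * maj n (k + 1)) =
      -(maj n k * maj n (k + 1) * (maj n (k + 1) * maj n (k + 2))) := by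
    have h := lie_biv_chain (n := n) (a := k) (b := k + 1) (c := k + 2) ⟨by omega, by omega⟩
      ⟨by omega, by omega⟩ ⟨by omega, by omega⟩ (by omega) (by omega) (by omega)
    rw [Ring.lie_def, sub_eq_iff_eq_add, ← sub_eq_iff_eq_add', mul_assoc (maj n k),
      maj_mul_maj_mul] at h
    rw [← h, mul_assoc (maj n k), maj_mul_maj_mul, two_smul]
    abel
  rw [tfimGen, tfimGen, smul_mul_assoc, mul_smul_comm, smul_mul_assoc, mul_smul_comm, e1, smul_neg,
    smul_neg]

section Groups

open scoped Pointwise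

theorem set_mul_comm_of_commute {M : Type*} [Monoid M] {s t : Set M}
    (h : ∀ x ∈ s, ∀ y ∈ t, Commute x y) : s * t = t * s := by
  ext z
  constructor
  · rintro ⟨x, hx, y, hy, rfl⟩
    exact ⟨y, hy, x, hx, (h x hx y hy).symm⟩
  · rintro ⟨y, hy, x, hx, rfl⟩
    exact ⟨x, hx, y, hy, h x hx y hy⟩

theorem tfim_turnover_subset {A B : Op n} (hA : A * A = 1) (hB : B * B = 1)
    (hAB : B * A = -(A * B)) :
    Set.range (rot A) * Set.range (rot B) * Set.range (rot A) ⊆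
      Set.range (rot B) * Set.range (rot A) * Set.range (rot B) := by
  rintro _ ⟨_, ⟨_, ⟨α, rfl⟩, _, ⟨β, rfl⟩, rfl⟩, _, ⟨γ, rfl⟩, rfl⟩
  obtain ⟨a, b, c, h⟩ := rot_turnover hA hB hAB α β γ
  exact ⟨_, ⟨_, ⟨a, rfl⟩, _, ⟨b, rfl⟩, rfl⟩, _, ⟨c, rfl⟩, h.symm⟩

/-- Idempotence is addition of angles, and the braid relation is the Euler turnover applied in both
directions. -/
theorem tfim_isHecke {p N : ℕ} (h : p + N + 1 ≤ 2 * n) :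
    IsHecke N fun k => Set.range (rot (tfimGen n (p + k))) where
  idem i _ _ := by
    apply Set.Subset.antisymm
    · rintro _ ⟨_, ⟨a, rfl⟩, _, ⟨b, rfl⟩, rfl⟩
      exact ⟨a + b, rot_add _ a b⟩
    · rintro _ ⟨a, rfl⟩
      exact ⟨_, ⟨0, rfl⟩, _, ⟨a, rfl⟩, by simp [rot_zero]⟩
  comm i j h1 h2 h3 := by
    refine set_mul_comm_of_commute ?_
    rintro _ ⟨a, rfl⟩ _ ⟨b, rfl⟩
    exact rot_commute (tfimGen_commute (by omega) (by omega) (by omega)) a b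
  braid i h1 h2 := by
    have hA := tfimGen_mul_self (n := n) (k := p + i) (by omega) (by omega)
    have hB := tfimGen_mul_self (n := n) (k := p + (i + 1)) (by omega) (by omega)
    have hAB := tfimGen_anticomm (n := n) (k := p + i) (by omega) (by omega)
    rw [add_assoc] at hAB
    exact Set.Subset.antisymm (tfim_turnover_subset hA hB hAB)
      (tfim_turnover_subset hB hA (by rw [hAB, neg_neg]))

/-- The group generated by the rotations `exp(-iθ P_k)`, `p < k ≤ p + N`, of the TFIM. -/
noncomputable def rotGroup (n p N : ℕ) : Submonoid (Op n) :=
  Submonoid.closure {x | ∃ k, 1 ≤ k ∧ k ≤ N ∧ x ∈ Set.range (rot (tfimGen n (p + k)))}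

theorem rot_mem_rotGroup {p N m : ℕ} (h1 : p + 1 ≤ m) (h2 : m ≤ p + N) (t : ℝ) :
    rot (tfimGen n m) t ∈ rotGroup n p N :=
  Submonoid.subset_closure ⟨m - p, by omega, by omega, t, by rw [show p + (m - p) = m by omega]⟩

theorem rotGroup_le_iff {p N : ℕ} {S : Submonoid (Op n)} :
    rotGroup n p N ≤ S ↔ ∀ m, p + 1 ≤ m → m ≤ p + N → ∀ t, rot (tfimGen n m) t ∈ S := by
  constructor
  · intro h m h1 h2 t
    exact h (rot_mem_rotGroup h1 h2 t)
  · intro h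
    rw [rotGroup, Submonoid.closure_le]
    rintro _ ⟨k, h1, h2, t, rfl⟩
    exact h (p + k) (by omega) (by omega) t

theorem rotGroup_mono {p N p' N' : ℕ} (h1 : p' ≤ p) (h2 : p + N ≤ p' + N') :
    rotGroup n p N ≤ rotGroup n p' N' :=
  rotGroup_le_iff.2 fun _ h3 h4 t => rot_mem_rotGroup (by omega) (by omega) t

theorem rotGroup_eq_word {p N : ℕ} (h : p + N + 1 ≤ 2 * n) :
    (rotGroup n p N : Set (Op n)) =
      word (fun k => Set.range (rot (tfimGen n (p + k)))) (triangleIdx N) :=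
  (tfim_isHecke h).closure_eq_triangle fun _ _ _ => ⟨0, rot_zero _⟩

/-- A group generated by circles need not be closed; compression makes this one a product of
finitely many circles along a fixed word. -/
theorem isCompact_rotGroup {p N : ℕ} (h : p + N + 1 ≤ 2 * n) :
    IsCompact (rotGroup n p N : Set (Op n)) := by
  rw [rotGroup_eq_word h]
  refine isCompact_word fun k hk => ?_
  have := mem_triangleIdx hk
  exact isCompact_range_rot (tfimGen_mul_self (by omega) (by omega))

theorem rot_tfimGen_eq_exp (k : ℕ) (t : ℝ) :
    rot (tfimGen n k) (-t) = NormedSpace.exp (t • (maj n k * maj n (k + 1))) := by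
  rw [rot, tfimGen, smul_smul, ← Complex.coe_smul]
  congr 2
  push_cast
  linear_combination (-(t : ℂ)) * Complex.I_mul_I

/-- The parameter `π/4` is a quarter turn of the plane of `γ_b` and `γ_{b+1}`, because conjugation
doubles the angle; it takes `γ_b` to `γ_{b+1}`. -/
theorem rot_mul_biv {a b : ℕ} (ha : 1 ≤ a) (hab : a < b) (hb : b + 1 ≤ 2 * n) :
    rot (tfimGen n b) (Real.pi / 4) * (maj n a * maj n b) =
      maj n a * maj n (b + 1) * rot (tfimGen n b) (Real.pi / 4) := by
  have hba := maj_anticomm (n := n) (a := b) (b := a) (by omega) (by omega) (by omega) (by omega)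
    (by omega)
  have hb'a := maj_anticomm (n := n) (a := b + 1) (b := a) (by omega) (by omega) (by omega)
    (by omega) (by omega)
  have hbb := maj_anticomm (n := n) (a := b + 1) (b := b) (by omega) (by omega) (by omega)
    (by omega) (by omega)
  have e1 : maj n b * maj n (b + 1) * (maj n a * maj n b) = -(maj n a * maj n (b + 1)) := by
    calc maj n b * maj n (b + 1) * (maj n a * maj n b)
        = maj n b * (maj n (b + 1) * maj n a) * maj n b := by simp only [mul_assoc]
      _ = -(maj n b * maj n a * (maj n (b + 1) * maj n b)) := by
          rw [hb'a]; simp only [mul_neg, neg_mul, mul_assoc]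
      _ = -(maj n a * (maj n b * (maj n b * maj n (b + 1)))) := by
          rw [hba, hbb]; simp only [mul_neg, neg_mul, mul_assoc, neg_neg]
      _ = _ := by rw [maj_mul_maj_mul]
  have e2 : maj n a * maj n (b + 1) * (maj n b * maj n (b + 1)) = -(maj n a * maj n b) := by
    rw [mul_assoc, ← mul_assoc (maj n (b + 1)), hbb, neg_mul, mul_assoc, maj_mul_self, mul_one,
      mul_neg]
  rw [rot_eq_cos_sin (tfimGen_mul_self (by omega) hb), Real.cos_pi_div_four, Real.sin_pi_div_four,
    tfimGen]
  simp only [sub_mul, mul_sub, smul_mul_assoc, mul_smul_comm, one_mul, mul_one, e1, e2]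
  match_scalars <;> ring_nf <;> simp only [Complex.I_sq] <;> ring_nf

/-- Conjugation by quarter turns stretches an adjacent bivector to `γ_a γ_b`, one index at a time.
-/
theorem exp_biv_mem_rotGroup {p N a b : ℕ} (h : p + N + 1 ≤ 2 * n) (ha : p + 1 ≤ a) (hab : a < b)
    (hb : b ≤ p + N + 1) (t : ℝ) :
    NormedSpace.exp (t • (maj n a * maj n b)) ∈ rotGroup n p N := by
  induction b, hab using Nat.le_induction with
  | base =>
    rw [← rot_tfimGen_eq_exp]
    exact rot_mem_rotGroup ha (by omega) _
  | succ b hab ih =>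
    have h1 : rot (tfimGen n b) (Real.pi / 4) * NormedSpace.exp (t • (maj n a * maj n b)) =
        NormedSpace.exp (t • (maj n a * maj n (b + 1))) * rot (tfimGen n b) (Real.pi / 4) :=
      mul_exp_of_mul_eq (by
        rw [mul_smul_comm, smul_mul_assoc, rot_mul_biv (by omega) (by omega) (by omega)])
    have h2 : rot (tfimGen n b) (Real.pi / 4) * NormedSpace.exp (t • (maj n a * maj n b)) *
        rot (tfimGen n b) (-(Real.pi / 4)) = NormedSpace.exp (t • (maj n a * maj n (b + 1))) := by
      rw [h1, mul_assoc, ← rot_add, add_neg_cancel, rot_zero, mul_one]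
    rw [← h2]
    exact mul_mem (mul_mem (rot_mem_rotGroup (by omega) (by omega) _) (ih (by omega)))
      (rot_mem_rotGroup (by omega) (by omega) _)

theorem exp_mem_rotGroup {p N : ℕ} (h : p + N + 1 ≤ 2 * n) {x : Op n}
    (hx : x ∈ bivSpan n (Set.Icc (p + 1) (p + N + 1))) :
    NormedSpace.exp x ∈ rotGroup n p N := by
  refine exp_mem_of_isCompact_of_span _ (isCompact_rotGroup h) _ ?_ hx
  rintro _ ⟨a, ha, b, hb, hab, rfl⟩ t
  rcases Nat.lt_or_ge a b with h' | h'
  · exact exp_biv_mem_rotGroup h ha.1 h' hb.2 t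
  · have h1 := ha.1
    have h2 := ha.2
    have h3 := hb.1
    have h4 := hb.2
    rw [maj_anticomm (by omega) (by omega) (by omega) (by omega) hab, smul_neg, ← neg_smul]
    exact exp_biv_mem_rotGroup h h3 (by omega) h2 _

/-- The group of the Lie algebra of bivectors is generated by the TFIM rotations. -/
theorem expGroup_eq_rotGroup {p N : ℕ} (h : p + N + 1 ≤ 2 * n) {g : LieSubalgebra ℝ (Op n)}
    (hg : g.toSubmodule = bivSpan n (Set.Icc (p + 1) (p + N + 1))) :
    expGroup g = rotGroup n p N := by
  apply le_antisymm
  · rw [expGroup, Submonoid.closure_le]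
    rintro _ ⟨x, hx, rfl⟩
    rw [← LieSubalgebra.mem_toSubmodule, hg] at hx
    exact exp_mem_rotGroup h hx
  · rw [rotGroup_le_iff]
    intro m h1 h2 t
    refine Submonoid.subset_closure ⟨(-t) • (maj n m * maj n (m + 1)), ?_, ?_⟩
    · rw [← LieSubalgebra.mem_toSubmodule, hg]
      exact Submodule.smul_mem _ _ (biv_mem_bivSpan ⟨by omega, by omega⟩ ⟨by omega, by omega⟩
        (by omega))
    · rw [← rot_tfimGen_eq_exp, neg_neg]

end Groups

/-! ### The six-parameter block -/

/-- Euler products `exp(-i a A) exp(-i b B) exp(-i c A)`. -/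
noncomputable def euler (A B : Op n) (v : Fin 3 → ℝ) : Op n :=
  rot A (v 0) * rot B (v 1) * rot A (v 2)

/-- After fusing the inner `A` factors the product has the shape `ABABA`; the turnover `BAB = ABA`
in the middle lets the outer factors fuse. -/
theorem exists_euler_mul {A B : Op n} (hA : A * A = 1) (hB : B * B = 1) (hAB : B * A = -(A * B))
    (v w : Fin 3 → ℝ) : ∃ z, euler A B v * euler A B w = euler A B z := by
  obtain ⟨a, b, c, h⟩ := rot_turnover hB hA (by rw [hAB, neg_neg]) (v 1) (v 2 + w 0) (w 1)
  refine ⟨![v 0 + a, b, c + w 2], ?_⟩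
  calc euler A B v * euler A B w
      = rot A (v 0) * (rot B (v 1) * (rot A (v 2) * rot A (w 0)) * rot B (w 1)) * rot A (w 2) := by
        simp only [euler, mul_assoc]
    _ = _ := by
        rw [← rot_add, h]
        simp [euler, rot_add, mul_assoc]

/-- Anticommuting involutions `A, B` and a commuting involution `c`. -/
structure IsChiral (A B c : Op n) : Prop where
  hA : A * A = 1
  hB : B * B = 1
  hc : c * c = 1
  hAB : B * A = -(A * B)
  hcA : Commute c A
  hcB : Commute c B

/-- The product of `rot A`, `rot (cA)`, `rot B`, `rot (-cB)`, `rot A`, `rot (cA)`. -/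
noncomputable def chiralBlock (A B c : Op n) (θ : Fin 6 → ℝ) : Op n :=
  rot A (θ 0) * rot (c * A) (θ 1) * rot B (θ 2) * rot (-(c * B)) (θ 3) * rot A (θ 4) *
    rot (c * A) (θ 5)

/-- The combination of two operators in the eigenspaces of the involution `c`. -/
noncomputable def glue (c x y : Op n) : Op n :=
  ((1 / 2 : ℝ) • (1 + c)) * x + ((1 / 2 : ℝ) • (1 - c)) * y

section Chiral

variable {A B c : Op n}

/-- `(1 ± c)/2` are complementary projections that commute with `x` and `y`. -/
theorem glue_mul (hc : c * c = 1) {x y : Op n} (hx : Commute c x) (hy : Commute c y)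
    (x' y' : Op n) : glue c x y * glue c x' y' = glue c (x * x') (y * y') := by
  have hcc : ∀ z, c * (c * z) = z := fun z => by rw [← mul_assoc, hc, one_mul]
  have hxc : ∀ z, x * (c * z) = c * (x * z) := fun z => by rw [← mul_assoc, ← hx.eq, mul_assoc]
  have hyc : ∀ z, y * (c * z) = c * (y * z) := fun z => by rw [← mul_assoc, ← hy.eq, mul_assoc]
  simp only [glue, smul_mul_assoc, add_mul, sub_mul, one_mul, mul_add, mul_sub, mul_smul_comm,
    smul_add, smul_sub, mul_assoc, hcc, hxc, hyc]
  module

theorem IsChiral.commute_euler (h : IsChiral A B c) (v : Fin 3 → ℝ) : Commute c (euler A B v) := by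
  have h1 : ∀ t, Commute c (rot A t) := fun t => mul_rot h.hcA t
  have h2 : ∀ t, Commute c (rot B t) := fun t => mul_rot h.hcB t
  exact ((h1 _).mul_right (h2 _)).mul_right (h1 _)

/-- Where `c = 1`, the operators `cA` and `-cB` act as `A` and `-B`; where `c = -1`, as `-A` and
`B`. In each eigenspace the six rotations merge into one Euler product whose angles are sums or
differences. -/
theorem IsChiral.chiralBlock_eq (h : IsChiral A B c) (θ : Fin 6 → ℝ) :
    chiralBlock A B c θ = glue c (euler A B ![θ 0 + θ 1, θ 2 - θ 3, θ 4 + θ 5])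
      (euler A B ![θ 0 - θ 1, θ 2 + θ 3, θ 4 - θ 5]) := by
  have hA : ∀ x : Op n, (∃ r s : ℝ, x = r • (1 : Op n) + s • c) → x * A = A * x := by
    rintro _ ⟨r, s, rfl⟩
    simp [add_mul, mul_add, h.hcA.eq]
  have hB : ∀ x : Op n, (∃ r s : ℝ, x = r • (1 : Op n) + s • c) → x * B = B * x := by
    rintro _ ⟨r, s, rfl⟩
    simp [add_mul, mul_add, h.hcB.eq]
  set p : Op n := (1 / 2 : ℝ) • (1 + c) with hp
  set m : Op n := (1 / 2 : ℝ) • (1 - c) with hm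
  have hp' : ∃ r s : ℝ, p = r • (1 : Op n) + s • c := ⟨1 / 2, 1 / 2, by rw [hp, smul_add]⟩
  have hm' : ∃ r s : ℝ, m = r • (1 : Op n) + s • c := ⟨1 / 2, -(1 / 2), by rw [hm]; module⟩
  have hpc : p * c = p := by rw [hp, smul_mul_assoc, add_mul, h.hc, one_mul, add_comm]
  have hmc : m * c = -m := by
    rw [hm, smul_mul_assoc, sub_mul, h.hc, one_mul, ← smul_neg, neg_sub]
  have pA := fun t => mul_rot (hA p hp') t
  have mA := fun t => mul_rot (hA m hm') t
  have pB := fun t => mul_rot (hB p hp') t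
  have mB := fun t => mul_rot (hB m hm') t
  have pC : ∀ t, p * rot (c * A) t = rot A t * p :=
    mul_rot (by rw [← mul_assoc, hpc, hA p hp'])
  have mC : ∀ t, m * rot (c * A) t = rot A (-t) * m := fun t => by
    rw [← rot_neg_left]
    exact mul_rot (by rw [← mul_assoc, hmc, neg_mul, neg_mul, hA m hm']) t
  have pD : ∀ t, p * rot (-(c * B)) t = rot B (-t) * p := fun t => by
    rw [← rot_neg_left]
    exact mul_rot (by rw [mul_neg, ← mul_assoc, hpc, neg_mul, hB p hp']) t
  have mD : ∀ t, m * rot (-(c * B)) t = rot B t * m :=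
    mul_rot (by rw [mul_neg, ← mul_assoc, hmc, neg_mul, neg_neg, hB m hm'])
  have hone : p + m = 1 := by rw [hp, hm]; module
  have h1 : p * chiralBlock A B c θ =
      euler A B ![θ 0 + θ 1, θ 2 - θ 3, θ 4 + θ 5] * p := by
    simp only [chiralBlock, ← mul_assoc]
    rw [pA, mul_assoc _ p, pC, ← mul_assoc, mul_assoc _ p, pB, ← mul_assoc, mul_assoc _ p, pD,
      ← mul_assoc, mul_assoc _ p, pA, ← mul_assoc, mul_assoc _ p, pC]
    simp [euler, rot_add, sub_eq_add_neg, mul_assoc]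
  have h2 : m * chiralBlock A B c θ =
      euler A B ![θ 0 - θ 1, θ 2 + θ 3, θ 4 - θ 5] * m := by
    simp only [chiralBlock, ← mul_assoc]
    rw [mA, mul_assoc _ m, mC, ← mul_assoc, mul_assoc _ m, mB, ← mul_assoc, mul_assoc _ m, mD,
      ← mul_assoc, mul_assoc _ m, mA, ← mul_assoc, mul_assoc _ m, mC]
    simp [euler, rot_add, sub_eq_add_neg, mul_assoc]
  have hcomm : ∀ v, p * euler A B v = euler A B v * p := fun v => by
    have := (h.commute_euler v).eq
    rw [hp, smul_mul_assoc, mul_smul_comm, add_mul, mul_add, one_mul, mul_one, this]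
  have hcomm' : ∀ v, m * euler A B v = euler A B v * m := fun v => by
    have := (h.commute_euler v).eq
    rw [hm, smul_mul_assoc, mul_smul_comm, sub_mul, mul_sub, one_mul, mul_one, this]
  rw [glue, hcomm, hcomm', ← h1, ← h2, ← add_mul, hone, one_mul]

theorem IsChiral.exists_chiralBlock_eq_glue (h : IsChiral A B c) (v w : Fin 3 → ℝ) :
    ∃ θ, chiralBlock A B c θ = glue c (euler A B v) (euler A B w) := by
  -- The inverse of the angle map in `chiralBlock_eq`: half sums and half differences. Hence the two
  -- Euler triples are independent.
  refine ⟨![(v 0 + w 0) / 2, (v 0 - w 0) / 2, (v 1 + w 1) / 2, (w 1 - v 1) / 2, (v 2 + w 2) / 2,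
    (v 2 - w 2) / 2], ?_⟩
  rw [h.chiralBlock_eq]
  congr 2
  · ext k; fin_cases k <;> simp <;> ring
  · ext k; fin_cases k <;> simp <;> ring

theorem IsChiral.exists_chiralBlock_mul (h : IsChiral A B c) (θ η : Fin 6 → ℝ) :
    ∃ ζ, chiralBlock A B c θ * chiralBlock A B c η = chiralBlock A B c ζ := by
  rw [h.chiralBlock_eq θ, h.chiralBlock_eq η,
    glue_mul h.hc (h.commute_euler _) (h.commute_euler _)]
  obtain ⟨v, hv⟩ := exists_euler_mul h.hA h.hB h.hAB ![θ 0 + θ 1, θ 2 - θ 3, θ 4 + θ 5]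
    ![η 0 + η 1, η 2 - η 3, η 4 + η 5]
  obtain ⟨w, hw⟩ := exists_euler_mul h.hA h.hB h.hAB ![θ 0 - θ 1, θ 2 + θ 3, θ 4 - θ 5]
    ![η 0 - η 1, η 2 + η 3, η 4 - η 5]
  rw [hv, hw]
  obtain ⟨ζ, hζ⟩ := h.exists_chiralBlock_eq_glue v w
  exact ⟨ζ, hζ.symm⟩

theorem glue_exp (hc : c * c = 1) {x y : Op n} (hx : Commute c x) (hy : Commute c y) :
    NormedSpace.exp (glue c x y) = glue c (NormedSpace.exp x) (NormedSpace.exp y) := by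
  have hcx : c * NormedSpace.exp x = NormedSpace.exp x * c := mul_exp_of_mul_eq hx
  have hcy : c * NormedSpace.exp y = NormedSpace.exp y * c := mul_exp_of_mul_eq hy
  have hcc : ∀ z, c * (c * z) = z := fun z => by rw [← mul_assoc, hc, one_mul]
  have h1 : ((1 / 2 : ℝ) • (1 + c)) * NormedSpace.exp (glue c x y) =
      NormedSpace.exp x * ((1 / 2 : ℝ) • (1 + c)) := by
    refine mul_exp_of_mul_eq ?_
    simp only [glue, smul_mul_assoc, mul_smul_comm, add_mul, sub_mul, mul_add, mul_sub, one_mul,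
      mul_one, smul_add, smul_sub, hx.eq, hy.eq]
    rw [← hx.eq, ← hy.eq, hcc, hcc]
    module
  have h2 : ((1 / 2 : ℝ) • (1 - c)) * NormedSpace.exp (glue c x y) =
      NormedSpace.exp y * ((1 / 2 : ℝ) • (1 - c)) := by
    refine mul_exp_of_mul_eq ?_
    simp only [glue, smul_mul_assoc, mul_smul_comm, add_mul, sub_mul, mul_add, mul_sub, one_mul,
      mul_one, smul_add, smul_sub, hx.eq, hy.eq]
    rw [← hx.eq, ← hy.eq, hcc, hcc]
    module
  have hone : ((1 / 2 : ℝ) • (1 + c)) + ((1 / 2 : ℝ) • (1 - c)) = 1 := by module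
  calc NormedSpace.exp (glue c x y)
      = (((1 / 2 : ℝ) • (1 + c)) + ((1 / 2 : ℝ) • (1 - c))) * NormedSpace.exp (glue c x y) := by
        rw [hone, one_mul]
    _ = _ := by
        rw [add_mul, h1, h2, glue]
        simp only [smul_mul_assoc, mul_smul_comm, add_mul, sub_mul, mul_add, mul_sub, one_mul,
          mul_one, hcx, hcy]

/-- Both Euler products are exponentials of imaginary quaternions, and exponentials glue. Closure of
the span under multiplication by `c` on the exponents keeps the glued exponent inside. -/
theorem IsChiral.chiralBlock_eq_exp (h : IsChiral A B c) (θ : Fin 6 → ℝ) :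
    ∃ k ∈ Submodule.span ℝ {Complex.I • A, Complex.I • (c * A), Complex.I • B,
        Complex.I • -(c * B), A * B, c * (A * B)},
      chiralBlock A B c θ = NormedSpace.exp k := by
  set V := Submodule.span ℝ {Complex.I • A, Complex.I • (c * A), Complex.I • B,
    Complex.I • -(c * B), A * B, c * (A * B)} with hV
  have key : ∀ v : Fin 3 → ℝ, ∃ x : Op n, Commute c x ∧ x ∈ V ∧ c * x ∈ V ∧
      euler A B v = NormedSpace.exp x := by
    intro v
    obtain ⟨a, b, d, hx⟩ := quat_eq_exp h.hA h.hB h.hAB (euler_norm (v 0) (v 1) (v 2))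
    have hm : ∀ y ∈ ({Complex.I • A, Complex.I • (c * A), Complex.I • B,
        Complex.I • -(c * B), A * B, c * (A * B)} : Set (Op n)), y ∈ V :=
      fun y hy => Submodule.subset_span hy
    refine ⟨_, ?_, ?_, ?_, (euler_eq_quat h.hA h.hB h.hAB _ _ _).trans hx⟩
    · exact (((h.hcA.smul_right _).smul_right _).add_right ((h.hcB.smul_right _).smul_right _)
        ).add_right ((h.hcA.mul_right h.hcB).smul_right _)
    · exact add_mem (add_mem (Submodule.smul_mem _ _ (hm _ (by simp)))
        (Submodule.smul_mem _ _ (hm _ (by simp)))) (Submodule.smul_mem _ _ (hm _ (by simp)))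
    · have e : c * (a • (Complex.I • A) + b • (Complex.I • B) + d • (A * B)) =
          a • (Complex.I • (c * A)) + (-b) • (Complex.I • -(c * B)) + d • (c * (A * B)) := by
        simp only [mul_add, mul_smul_comm, smul_neg, neg_smul, neg_neg]
      rw [e]
      exact add_mem (add_mem (Submodule.smul_mem _ _ (hm _ (by simp)))
        (Submodule.smul_mem _ _ (hm _ (by simp)))) (Submodule.smul_mem _ _ (hm _ (by simp)))
  rw [h.chiralBlock_eq]
  obtain ⟨x, hx1, hx2, hx3, hx4⟩ := key ![θ 0 + θ 1, θ 2 - θ 3, θ 4 + θ 5]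
  obtain ⟨y, hy1, hy2, hy3, hy4⟩ := key ![θ 0 - θ 1, θ 2 + θ 3, θ 4 - θ 5]
  refine ⟨glue c x y, ?_, ?_⟩
  · rw [glue, smul_mul_assoc, smul_mul_assoc, add_mul, sub_mul, one_mul, one_mul]
    exact add_mem (Submodule.smul_mem _ _ (add_mem hx2 hx3))
      (Submodule.smul_mem _ _ (sub_mem hy2 hy3))
  · rw [hx4, hy4, glue_exp h.hc hx1 hy1]

end Chiral

end TFXY

namespace TFXY

variable {n j : ℕ}

/-! ### Blocks of the chain -/

theorem tfimGen_odd (hj : j < n) : tfimGen n (2 * j + 1) = Z n (j + 1) := by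
  rw [tfimGen, ← I_smul_Z hj, smul_smul]; simp

theorem tfimGen_even (hj : j + 1 < n) :
    tfimGen n (2 * j + 2) = X n (j + 1) * X n (j + 2) := by
  rw [tfimGen, ← I_smul_XX hj, smul_smul]; simp

theorem Z_commute (n i k : ℕ) : Commute (Z n i) (Z n k) := by
  by_cases h : i = k
  · rw [h]
  · exact site_commute h _ _

theorem ZZ_mul_XX (hj : j + 1 < n) :
    Z n (j + 1) * Z n (j + 2) * (X n (j + 1) * X n (j + 2)) = -(Y n (j + 1) * Y n (j + 2)) := by
  have h := (site_commute (n := n) (show j + 2 ≠ j + 1 by omega) pZ pX).eq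
  calc Z n (j + 1) * Z n (j + 2) * (X n (j + 1) * X n (j + 2))
      = site n (j + 1) pZ * (site n (j + 2) pZ * site n (j + 1) pX) * site n (j + 2) pX := by
        simp only [X, Z, mul_assoc]
    _ = (site n (j + 1) pZ * site n (j + 1) pX) * (site n (j + 2) pZ * site n (j + 2) pX) := by
        rw [h]; simp only [mul_assoc]
    _ = _ := by
        rw [site_mul, site_mul, pZ_mul_pX, site_smul (by omega) (by omega),
          site_smul (by omega) (by omega), smul_mul_smul_comm, Complex.I_mul_I, neg_one_smul, Y, Y]

theorem Z_mul_XX_left (hj : j + 1 < n) :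
    Z n (j + 1) * (X n (j + 1) * X n (j + 2)) = Complex.I • (Y n (j + 1) * X n (j + 2)) := by
  rw [← mul_assoc, Z, X, site_mul, pZ_mul_pX, site_smul (by omega) (by omega), smul_mul_assoc, Y]

theorem Z_mul_XX_right (hj : j + 1 < n) :
    Z n (j + 2) * (X n (j + 1) * X n (j + 2)) = Complex.I • (X n (j + 1) * Y n (j + 2)) := by
  have h := (site_commute (n := n) (show j + 2 ≠ j + 1 by omega) pZ pX).eq
  rw [← mul_assoc, Z, X, h, mul_assoc, X, site_mul, pZ_mul_pX, site_smul (by omega) (by omega),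
    mul_smul_comm, Y]

theorem Z_mul_self (n i : ℕ) : Z n i * Z n i = 1 := by
  rw [Z, site_mul, pZ_mul_pZ, site_one]

/-- The involution `c` is the parity `Z_i Z_{i+1}` of the bond; it commutes with `XX` because two
signs cancel. -/
theorem isChiral_block (hj : j + 1 < n) :
    IsChiral (Z n (j + 1)) (X n (j + 1) * X n (j + 2)) (Z n (j + 1) * Z n (j + 2)) := by
  have hA := tfimGen_mul_self (n := n) (k := 2 * j + 1) (by omega) (by omega)
  have hB := tfimGen_mul_self (n := n) (k := 2 * j + 2) (by omega) (by omega)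
  have hC := tfimGen_mul_self (n := n) (k := 2 * (j + 1) + 1) (by omega) (by omega)
  have hAB := tfimGen_anticomm (n := n) (k := 2 * j + 1) (by omega) (by omega)
  have hBC := tfimGen_anticomm (n := n) (k := 2 * j + 2) (by omega) (by omega)
  rw [tfimGen_even hj, show 2 * j + 2 + 1 = 2 * (j + 1) + 1 by ring, tfimGen_odd (by omega)] at hBC
  rw [tfimGen_odd (by omega), tfimGen_even hj] at hAB
  rw [tfimGen_odd (by omega)] at hA hC
  rw [tfimGen_even hj] at hB
  have hAC := Z_commute n (j + 1) (j + 2)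
  refine ⟨hA, hB, ?_, hAB, ?_, ?_⟩
  · rw [mul_assoc, ← mul_assoc (Z n (j + 2)), ← hAC.eq, mul_assoc (Z n (j + 1)), ← mul_assoc, hA,
      one_mul]
    exact hC
  · exact (Commute.refl _).mul_left hAC.symm
  · rw [Commute, SemiconjBy, mul_assoc, hBC, mul_neg, ← mul_assoc, ← mul_assoc (_ * _) (Z n (j + 1)), hAB,
      neg_mul]

theorem ZZ_mul_Z (n j : ℕ) : Z n (j + 1) * Z n (j + 2) * Z n (j + 1) = Z n (j + 2) := by
  rw [(Z_commute n (j + 1) (j + 2)).eq, mul_assoc, Z_mul_self, mul_one]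

theorem block_eq_chiralBlock (hj : j + 1 < n) (θ : Fin 6 → ℝ) : block n (j + 1) θ =
    chiralBlock (Z n (j + 1)) (X n (j + 1) * X n (j + 2)) (Z n (j + 1) * Z n (j + 2)) θ := by
  rw [chiralBlock, ZZ_mul_XX hj, neg_neg, ZZ_mul_Z, block]

/-- The blocks on a bond are a submonoid. -/
noncomputable def blockMonoid (hj : j + 1 < n) : Submonoid (Op n) where
  carrier := Set.range (block n (j + 1))
  mul_mem' := by
    rintro _ _ ⟨θ, rfl⟩ ⟨η, rfl⟩
    obtain ⟨ζ, hζ⟩ := (isChiral_block hj).exists_chiralBlock_mul θ η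
    refine ⟨ζ, ?_⟩
    rw [block_eq_chiralBlock hj, block_eq_chiralBlock hj, block_eq_chiralBlock hj, hζ]
  one_mem' := ⟨0, by simp [block, rot_zero]⟩

/-- All four exponents of a block are bivectors of its four Majoranas. Conversely, the blocks form a
monoid containing the three generating rotations, each obtained by setting the other angles to zero.
-/
theorem range_block (hj : j + 1 < n) :
    Set.range (block n (j + 1)) = (rotGroup n (2 * j) 3 : Set (Op n)) := by
  apply Set.Subset.antisymm
  · rintro _ ⟨θ, rfl⟩
    have h1 : ∀ t, rot (Z n (j + 1)) t ∈ rotGroup n (2 * j) 3 := fun t => by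
      rw [← tfimGen_odd (by omega)]; exact rot_mem_rotGroup (by omega) (by omega) t
    have h2 : ∀ t, rot (Z n (j + 2)) t ∈ rotGroup n (2 * j) 3 := fun t => by
      rw [← tfimGen_odd (by omega)]; exact rot_mem_rotGroup (by omega) (by omega) t
    have h3 : ∀ t, rot (X n (j + 1) * X n (j + 2)) t ∈ rotGroup n (2 * j) 3 := fun t => by
      rw [← tfimGen_even hj]; exact rot_mem_rotGroup (by omega) (by omega) t
    have h4 : ∀ t, rot (Y n (j + 1) * Y n (j + 2)) t ∈ rotGroup n (2 * j) 3 := fun t => by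
      have e : rot (Y n (j + 1) * Y n (j + 2)) t =
          NormedSpace.exp (t • (maj n (2 * j + 1) * maj n (2 * j + 4))) := by
        rw [← neg_neg (maj n (2 * j + 1) * maj n (2 * j + 4)), ← I_smul_YY hj, rot,
          ← Complex.coe_smul]
        congr 1; module
      rw [e]
      exact exp_biv_mem_rotGroup (by omega) (by omega) (by omega) (by omega) t
    exact mul_mem (mul_mem (mul_mem (mul_mem (mul_mem (h1 _) (h2 _)) (h3 _)) (h4 _)) (h1 _)) (h2 _)
  · have h : rotGroup n (2 * j) 3 ≤ blockMonoid hj := by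
      rw [rotGroup_le_iff]
      intro m h1 h2 t
      obtain rfl | rfl | rfl : m = 2 * j + 1 ∨ m = 2 * j + 2 ∨ m = 2 * (j + 1) + 1 := by omega
      · exact ⟨![t, 0, 0, 0, 0, 0], by simp [block, rot_zero, tfimGen_odd (show j < n by omega)]⟩
      · exact ⟨![0, 0, t, 0, 0, 0], by simp [block, rot_zero, tfimGen_even hj, add_assoc]⟩
      · exact ⟨![0, t, 0, 0, 0, 0], by simp [block, rot_zero, tfimGen_odd hj, add_assoc]⟩
    exact h

theorem expGroup_g2 (hj : j + 1 < n) : expGroup (g2 n (j + 1)) = rotGroup n (2 * j) 3 :=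
  expGroup_eq_rotGroup (by omega) (g2_toSubmodule hj)

theorem expGroup_g3 (hj : j + 2 < n) : expGroup (g3 n (j + 1)) = rotGroup n (2 * j) 5 :=
  expGroup_eq_rotGroup (by omega) (g3_toSubmodule hj)

theorem range_block_eq_expGroup (hj : j + 1 < n) :
    Set.range (block n (j + 1)) = (expGroup (g2 n (j + 1)) : Set (Op n)) := by
  rw [range_block hj, expGroup_g2 hj]

/-- The exponential map of the two-site group is surjective. -/
theorem exists_exp_of_mem_expGroup_g2 (hj : j + 1 < n) {U : Op n}
    (hU : U ∈ expGroup (g2 n (j + 1))) : ∃ k ∈ g2 n (j + 1), U = NormedSpace.exp k := by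
  rw [← SetLike.mem_coe, ← range_block_eq_expGroup hj] at hU
  obtain ⟨θ, rfl⟩ := hU
  obtain ⟨k, hk, hk'⟩ := (isChiral_block hj).chiralBlock_eq_exp θ
  refine ⟨k, ?_, (block_eq_chiralBlock hj θ).trans hk'⟩
  rw [← LieSubalgebra.mem_toSubmodule, g2_toSubmodule hj, ← (g2Basis_isBivBasis hj).span_eq]
  refine Submodule.span_le.2 ?_ hk
  have hm : ∀ k, g2Basis n (j + 1) k ∈ Submodule.span ℝ (Set.range (g2Basis n (j + 1))) :=
    fun k => Submodule.subset_span ⟨k, rfl⟩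
  rw [ZZ_mul_XX hj, neg_neg, ← mul_assoc _ (Z n (j + 1)) (X n (j + 1) * X n (j + 2)), ZZ_mul_Z,
    Z_mul_XX_left hj, Z_mul_XX_right hj]
  rintro x (rfl | rfl | rfl | rfl | rfl | rfl)
  · exact hm 4
  · exact hm 5
  · exact hm 0
  · exact hm 1
  · exact hm 3
  · exact hm 2

/-! ### Three sites -/

section ThreeSites

open scoped Pointwise

theorem blockProducts_three {M P : Type*} [Monoid M] (B : ℕ → P → M) (i k l : ℕ) :
    blockProducts B [i, k, l] = Set.range (B i) * Set.range (B k) * Set.range (B l) := by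
  rw [blockProducts_eq_word]
  simp [mul_assoc]

theorem word_congr {W : Type*} [Monoid W] {r r' : ℕ → W} {l : List ℕ} (h : ∀ k ∈ l, r k = r' k) :
    word r l = word r' l := by
  rw [word, word, List.map_congr_left h]

theorem rotGroup_mul_three_subset {p N q q' q'' N' : ℕ} (h1 : p ≤ q) (h1' : q + N' ≤ p + N)
    (h2 : p ≤ q') (h2' : q' + N' ≤ p + N) (h3 : p ≤ q'') (h3' : q'' + N' ≤ p + N) :
    (rotGroup n q N' : Set (Op n)) * rotGroup n q' N' * rotGroup n q'' N' ⊆ rotGroup n p N := by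
  rintro _ ⟨_, ⟨x, hx, y, hy, rfl⟩, z, hz, rfl⟩
  exact mul_mem (mul_mem (rotGroup_mono h1 h1' hx) (rotGroup_mono h2 h2' hy))
    (rotGroup_mono h3 h3' hz)

/-- Relative to `2 * j`, the generators `1,2,3` span the left block and `3,4,5` the right one, so
`triangle_five` distributes the whole group over three blocks. -/
theorem blockProducts_right_left_right (hj : j + 2 < n) :
    blockProducts (block n) [j + 2, j + 1, j + 2] = (expGroup (g3 n (j + 1)) : Set (Op n)) := by
  rw [blockProducts_three, range_block (show j + 1 < n by omega), range_block hj, expGroup_g3 hj]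
  apply Set.Subset.antisymm
  · exact rotGroup_mul_three_subset (by omega) (by omega) (by omega) (by omega) (by omega)
      (by omega)
  · rw [rotGroup_eq_word (by omega), (tfim_isHecke (by omega)).triangle_five]
    refine Set.mul_subset_mul (Set.mul_subset_mul ?_ ?_) ?_ <;>
    · refine word_subset_submonoid _ fun k hk => ?_
      rintro _ ⟨t, rfl⟩
      simp only [List.mem_cons, List.not_mem_nil, or_false] at hk
      exact rot_mem_rotGroup (by omega) (by omega) t

/-- The same factorisation for the reflected generators, where `k ↦ 6 - k` exchanges the two blocks.
-/
theorem blockProducts_left_right_left (hj : j + 2 < n) :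
    blockProducts (block n) [j + 1, j + 2, j + 1] = (expGroup (g3 n (j + 1)) : Set (Op n)) := by
  rw [blockProducts_three, range_block (show j + 1 < n by omega), range_block hj, expGroup_g3 hj]
  apply Set.Subset.antisymm
  · exact rotGroup_mul_three_subset (by omega) (by omega) (by omega) (by omega) (by omega)
      (by omega)
  · have H := (tfim_isHecke (n := n) (p := 2 * j) (N := 5) (by omega)).reflect
    have h1 : (rotGroup n (2 * j) 5 : Set (Op n)) ⊆
        word (fun k => Set.range (rot (tfimGen n (2 * j + (5 + 1 - k))))) (triangleIdx 5) := by
      rw [← H.closure_eq_triangle fun _ _ _ => ⟨0, rot_zero _⟩]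
      refine SetLike.coe_subset_coe.2 (rotGroup_le_iff.2 fun m hm hm' t => ?_)
      exact Submonoid.subset_closure ⟨2 * j + 6 - m, by omega, by omega, t, by congr 2; omega⟩
    refine h1.trans ?_
    rw [H.triangle_five]
    refine Set.mul_subset_mul (Set.mul_subset_mul ?_ ?_) ?_ <;>
    · refine word_subset_submonoid _ fun k hk => ?_
      rintro _ ⟨t, rfl⟩
      simp only [List.mem_cons, List.not_mem_nil, or_false] at hk
      exact rot_mem_rotGroup (by omega) (by omega) t

theorem blockProducts_tfim_triangle (hj : j + 2 < n) :
    blockProducts (fun k => tfimBlock n (2 * (j + 1) - 2 + k)) (triangleIdx 5) =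
      (expGroup (g3 n (j + 1)) : Set (Op n)) := by
  rw [expGroup_g3 hj, rotGroup_eq_word (by omega), blockProducts_eq_word]
  refine word_congr fun k hk => ?_
  have := mem_triangleIdx hk
  congr 1
  funext t
  rw [tfimBlock_eq_rot (by omega) (by omega), show 2 * (j + 1) - 2 + k = 2 * j + k by omega]

/-! ### Cartan decompositions of the three-site group. -/

theorem rot_eq_exp_real (P : Op n) (t : ℝ) :
    rot P t = NormedSpace.exp ((-t) • (Complex.I • P)) := by
  rw [rot, ← Complex.coe_smul, smul_smul]
  congr 2; push_cast; ring

theorem XX_commute_YY (hj : j + 1 < n) :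
    Commute (X n (j + 1) * X n (j + 2)) (Y n (j + 1) * Y n (j + 2)) := by
  rw [← neg_neg (Y n (j + 1) * Y n (j + 2)), ← ZZ_mul_XX hj]
  exact ((isChiral_block hj).hcB.symm.mul_right (Commute.refl _)).neg_right

/-- A product of exponentials of a fixed point and of a commuting rotation. -/
theorem exists_exp_mul_rot {g : LieSubalgebra ℝ (Op n)} {T k : Op n} (hTT : T * T = 1) (hk : k ∈ g)
    (hT : Complex.I • T ∈ g) (hfix : T * k * T = k) (t : ℝ) :
    ∃ k' ∈ g, T * k' * T = k' ∧ NormedSpace.exp k * rot T t = NormedSpace.exp k' ∧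
      rot T t * NormedSpace.exp k = NormedSpace.exp k' := by
  have hcomm : Commute k T := by
    rw [Commute, SemiconjBy]
    nth_rewrite 2 [← hfix]
    rw [← mul_assoc, ← mul_assoc, hTT, one_mul]
  refine ⟨k + (-t) • (Complex.I • T), add_mem hk (g.smul_mem _ hT), ?_, ?_, ?_⟩
  · rw [mul_add, add_mul, hfix, mul_smul_comm, mul_smul_comm, hTT, smul_mul_assoc, smul_mul_assoc,
      one_mul]
  · rw [rot_eq_exp_real, ← Matrix.exp_add_of_commute _ _ ((hcomm.smul_right _).smul_right _)]
  · rw [rot_eq_exp_real, add_comm,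
      ← Matrix.exp_add_of_commute _ _ ((hcomm.symm.smul_left _).smul_left _)]

theorem exists_exp_middle (hj : j + 1 < n) (s t : ℝ) :
    ∃ h ∈ Submodule.span ℝ {Complex.I • (X n (j + 1) * X n (j + 2)),
      Complex.I • (Y n (j + 1) * Y n (j + 2))},
      rot (X n (j + 1) * X n (j + 2)) s * rot (Y n (j + 1) * Y n (j + 2)) t =
        NormedSpace.exp h := by
  refine ⟨(-s) • (Complex.I • (X n (j + 1) * X n (j + 2))) +
    (-t) • (Complex.I • (Y n (j + 1) * Y n (j + 2))), ?_, ?_⟩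
  · exact add_mem (Submodule.smul_mem _ _ (Submodule.subset_span (by simp)))
      (Submodule.smul_mem _ _ (Submodule.subset_span (by simp)))
  · rw [rot_eq_exp_real, rot_eq_exp_real, ← Matrix.exp_add_of_commute]
    exact ((((XX_commute_YY hj).smul_left _).smul_left _).smul_right _).smul_right _

/-- Assembling the factors of a Cartan decomposition. -/
theorem cartan_assemble {g : LieSubalgebra ℝ (Op n)} {T x₁ x₂ mid : Op n} (hTT : T * T = 1)
    (hT : Complex.I • T ∈ g) (h₁ : x₁ ∈ g ∧ T * x₁ * T = x₁) (h₂ : x₂ ∈ g ∧ T * x₂ * T = x₂)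
    (s t : ℝ) :
    ∃ k₁ ∈ g, ∃ k₂ ∈ g, T * k₁ * T = k₁ ∧ T * k₂ * T = k₂ ∧
      NormedSpace.exp x₁ * rot T s * NormedSpace.exp mid * (rot T t * NormedSpace.exp x₂) =
        NormedSpace.exp k₁ * NormedSpace.exp mid * NormedSpace.exp k₂ := by
  obtain ⟨k₁, h1, h2, h3, -⟩ := exists_exp_mul_rot hTT h₁.1 hT h₁.2 s
  obtain ⟨k₂, h4, h5, -, h6⟩ := exists_exp_mul_rot hTT h₂.1 hT h₂.2 t
  exact ⟨k₁, h1, k₂, h4, h2, h5, by rw [h3, h6]⟩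

/-- In `B_i B_{i+1} B_i` the middle block consists of `Z` rotations around the `XX` and `YY`
rotations. Its rotations about the shared qubit join the outer blocks, whose group has a surjective
exponential; those about the last qubit commute with the outer exponents and are added to them. -/
theorem cartan_right (hj : j + 2 < n) {G : Op n} (hG : G ∈ expGroup (g3 n (j + 1))) :
    ∃ k₁ ∈ g3 n (j + 1), ∃ k₂ ∈ g3 n (j + 1),
      Z n (j + 3) * k₁ * Z n (j + 3) = k₁ ∧ Z n (j + 3) * k₂ * Z n (j + 3) = k₂ ∧
      ∃ h ∈ Submodule.span ℝ {Complex.I • (X n (j + 2) * X n (j + 3)),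
          Complex.I • (Y n (j + 2) * Y n (j + 3))},
        G = NormedSpace.exp k₁ * NormedSpace.exp h * NormedSpace.exp k₂ := by
  rw [← SetLike.mem_coe, ← blockProducts_left_right_left hj, blockProducts_three,
    range_block_eq_expGroup (show j + 1 < n by omega)] at hG
  obtain ⟨_, ⟨b₁, hb₁, _, ⟨θ, rfl⟩, rfl⟩, b₂, hb₂, rfl⟩ := hG
  have hZ : ∀ t, rot (Z n (j + 2)) t ∈ expGroup (g2 n (j + 1)) := fun t => by
    rw [expGroup_g2 (by omega), ← tfimGen_odd (by omega)]
    exact rot_mem_rotGroup (by omega) (by omega) t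
  obtain ⟨x₁, hx₁, e₁⟩ := exists_exp_of_mem_expGroup_g2 (by omega) (mul_mem hb₁ (hZ (θ 0)))
  obtain ⟨x₂, hx₂, e₂⟩ := exists_exp_of_mem_expGroup_g2 (by omega) (mul_mem (hZ (θ 4)) hb₂)
  have hfix := fun x => fixedPoints_g3_right hj (x := x)
  obtain ⟨h, h7, h8⟩ := exists_exp_middle (n := n) (j := j + 1) (by omega) (θ 2) (θ 3)
  obtain ⟨k₁, h1, k₂, h2, h3, h4, h5⟩ := cartan_assemble (mid := h) (Z_mul_self n (j + 3))
    ((hfix (Complex.I • Z n (j + 3))).2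
      (Submodule.mem_sup_right (Submodule.mem_span_singleton_self _))).1
    ((hfix x₁).2 (Submodule.mem_sup_left hx₁)) ((hfix x₂).2 (Submodule.mem_sup_left hx₂)) (θ 1) (θ 5)
  refine ⟨k₁, h1, k₂, h2, h3, h4, h, h7, ?_⟩
  have hcomm := (rot_commute (Z_commute n (j + 2) (j + 3)) (θ 4) (θ 5)).eq
  rw [← h5, ← e₁, ← e₂, ← h8, ← mul_assoc (rot (Z n (j + 3)) (θ 5)), ← hcomm, block]
  simp only [mul_assoc]

/-- The mirror image, starting from `B_{i+1} B_i B_{i+1}`; now the first qubit supplies the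
commuting rotations. -/
theorem cartan_left (hj : j + 2 < n) {G : Op n} (hG : G ∈ expGroup (g3 n (j + 1))) :
    ∃ k₁ ∈ g3 n (j + 1), ∃ k₂ ∈ g3 n (j + 1),
      Z n (j + 1) * k₁ * Z n (j + 1) = k₁ ∧ Z n (j + 1) * k₂ * Z n (j + 1) = k₂ ∧
      ∃ h ∈ Submodule.span ℝ {Complex.I • (X n (j + 1) * X n (j + 2)),
          Complex.I • (Y n (j + 1) * Y n (j + 2))},
        G = NormedSpace.exp k₁ * NormedSpace.exp h * NormedSpace.exp k₂ := by
  rw [← SetLike.mem_coe, ← blockProducts_right_left_right hj, blockProducts_three,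
    range_block_eq_expGroup hj] at hG
  obtain ⟨_, ⟨b₁, hb₁, _, ⟨θ, rfl⟩, rfl⟩, b₂, hb₂, rfl⟩ := hG
  have hZ : ∀ t, rot (Z n (j + 2)) t ∈ expGroup (g2 n (j + 2)) := fun t => by
    rw [expGroup_g2 hj, ← tfimGen_odd (j := j + 1) (by omega)]
    exact rot_mem_rotGroup (by omega) (by omega) t
  obtain ⟨x₁, hx₁, e₁⟩ := exists_exp_of_mem_expGroup_g2 hj (mul_mem hb₁ (hZ (θ 1)))
  obtain ⟨x₂, hx₂, e₂⟩ := exists_exp_of_mem_expGroup_g2 hj (mul_mem (hZ (θ 5)) hb₂)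
  have hfix := fun x => fixedPoints_g3_left hj (x := x)
  obtain ⟨h, h7, h8⟩ := exists_exp_middle (n := n) (j := j) (by omega) (θ 2) (θ 3)
  obtain ⟨k₁, h1, k₂, h2, h3, h4, h5⟩ := cartan_assemble (mid := h) (Z_mul_self n (j + 1))
    ((hfix (Complex.I • Z n (j + 1))).2
      (Submodule.mem_sup_right (Submodule.mem_span_singleton_self _))).1
    ((hfix x₁).2 (Submodule.mem_sup_left hx₁)) ((hfix x₂).2 (Submodule.mem_sup_left hx₂)) (θ 0) (θ 4)
  refine ⟨k₁, h1, k₂, h2, h3, h4, h, h7, ?_⟩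
  have hcomm := (rot_commute (Z_commute n (j + 1) (j + 2)) (θ 0) (θ 1)).eq
  rw [← h5, ← e₁, ← e₂, ← h8, mul_assoc b₁, ← hcomm, block]
  simp only [mul_assoc]

/-! ### Compression -/

/-- The first bound says that the two groups involve disjoint sets of Majoranas. Commutation passes
from generators to the groups through centralizers, one side at a time. -/
theorem rotGroup_commute {p N p' N' : ℕ} (h : p + N + 1 < p' + 1) (h' : p' + N' + 1 ≤ 2 * n)
    {x y : Op n} (hx : x ∈ rotGroup n p N) (hy : y ∈ rotGroup n p' N') : Commute x y := by
  have h1 : ∀ m, p + 1 ≤ m → m ≤ p + N → ∀ t, Commute (rot (tfimGen n m) t) y := by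
    intro m h1 h2 t
    have h3 : rotGroup n p' N' ≤ Submonoid.centralizer {rot (tfimGen n m) t} := by
      rw [rotGroup_le_iff]
      intro m' h3 h4 t'
      rw [Submonoid.mem_centralizer_iff]
      rintro _ rfl
      exact rot_commute (tfimGen_commute (by omega) (by omega) (by omega)) t t'
    exact Submonoid.mem_centralizer_iff.1 (h3 hy) _ rfl
  have h2 : rotGroup n p N ≤ Submonoid.centralizer {y} := by
    rw [rotGroup_le_iff]
    intro m h3 h4 t
    rw [Submonoid.mem_centralizer_iff]
    rintro _ rfl
    exact (h1 m h3 h4 t).symm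
  exact (Submonoid.mem_centralizer_iff.1 (h2 hx) y rfl).symm

theorem block_commute {i k : ℕ} (hi : 1 ≤ i) (hik : i + 1 < k) (hk : k + 1 ≤ n) (α β : Fin 6 → ℝ) :
    Commute (block n i α) (block n k β) := by
  obtain ⟨a, rfl⟩ : ∃ a, i = a + 1 := ⟨i - 1, by omega⟩
  obtain ⟨b, rfl⟩ : ∃ b, k = b + 1 := ⟨k - 1, by omega⟩
  have h1 : block n (a + 1) α ∈ rotGroup n (2 * a) 3 := by
    rw [← SetLike.mem_coe, ← range_block (by omega)]; exact ⟨α, rfl⟩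
  have h2 : block n (b + 1) β ∈ rotGroup n (2 * b) 3 := by
    rw [← SetLike.mem_coe, ← range_block (by omega)]; exact ⟨β, rfl⟩
  exact rotGroup_commute (by omega) (by omega) h1 h2

/-- Both products of sets are the whole three-site group. -/
theorem block_braid {i : ℕ} (h1 : 1 ≤ i) (h2 : i + 2 ≤ n) :
    Set.range (block n i) * Set.range (block n (i + 1)) * Set.range (block n i) =
      Set.range (block n (i + 1)) * Set.range (block n i) * Set.range (block n (i + 1)) := by
  obtain ⟨a, rfl⟩ : ∃ a, i = a + 1 := ⟨i - 1, by omega⟩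
  rw [← blockProducts_three, ← blockProducts_three]
  exact (blockProducts_left_right_left (by omega)).trans
    (blockProducts_right_left_right (by omega)).symm

/-- Six-parameter blocks thus obey the same relations as the one-parameter rotations, and the
compression of words applies a second time. -/
theorem block_isHecke (n : ℕ) : IsHecke (n - 1) fun k => Set.range (block n k) where
  idem i h1 h2 := by
    obtain ⟨a, rfl⟩ : ∃ a, i = a + 1 := ⟨i - 1, by omega⟩
    rw [range_block (by omega), coe_mul_coe]
  comm i k h1 h2 h3 := by
    refine set_mul_comm_of_commute ?_
    rintro _ ⟨α, rfl⟩ _ ⟨β, rfl⟩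
    exact block_commute h1 h2 (by omega) α β
  braid i h1 h2 := block_braid h1 (by omega)

theorem one_mem_range_block (n k : ℕ) : (1 : Op n) ∈ Set.range (block n k) :=
  ⟨0, by simp [block, rot_zero]⟩

theorem block_isBlock (n : ℕ) : IsBlock (n - 1) (block n) where
  fusion i h1 h2 α β := by
    have h := (block_isHecke n).idem i h1 h2
    have : block n i α * block n i β ∈ Set.range (block n i) := by
      rw [← h]; exact Set.mul_mem_mul ⟨α, rfl⟩ ⟨β, rfl⟩
    obtain ⟨a, ha⟩ := this
    exact ⟨a, ha.symm⟩
  commutation i k h1 h2 h3 h4 h α β := by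
    rcases h with h | h
    · exact block_commute h1 h (by omega) α β
    · exact (block_commute h3 h (by omega) β α).symm
  turnover i h1 h2 α β γ := by
    have : block n i α * block n (i + 1) β * block n i γ ∈
        Set.range (block n i) * Set.range (block n (i + 1)) * Set.range (block n i) :=
      Set.mul_mem_mul (Set.mul_mem_mul ⟨α, rfl⟩ ⟨β, rfl⟩) ⟨γ, rfl⟩
    rw [block_braid h1 (by omega)] at this
    obtain ⟨_, ⟨_, ⟨a, rfl⟩, _, ⟨b, rfl⟩, rfl⟩, _, ⟨c, rfl⟩, h⟩ := this
    exact ⟨a, b, c, h.symm⟩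

theorem block_turnover_reverse {i : ℕ} (h1 : 1 ≤ i) (h2 : i + 2 ≤ n) (α β γ : Fin 6 → ℝ) :
    ∃ a b c, block n (i + 1) α * block n i β * block n (i + 1) γ =
      block n i a * block n (i + 1) b * block n i c := by
  have : block n (i + 1) α * block n i β * block n (i + 1) γ ∈
      Set.range (block n (i + 1)) * Set.range (block n i) * Set.range (block n (i + 1)) :=
    Set.mul_mem_mul (Set.mul_mem_mul ⟨α, rfl⟩ ⟨β, rfl⟩) ⟨γ, rfl⟩
  rw [← block_braid h1 h2] at this
  obtain ⟨_, ⟨_, ⟨a, rfl⟩, _, ⟨b, rfl⟩, rfl⟩, _, ⟨c, rfl⟩, h⟩ := this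
  exact ⟨a, b, c, h.symm⟩

theorem blockProducts_triangle_eq_square (n : ℕ) :
    blockProducts (block n) (triangleIdx (n - 1)) =
      blockProducts (block n) (squareIdx (n - 1)) := by
  rw [blockProducts_eq_word, blockProducts_eq_word, (block_isHecke n).triangle_eq_square]

theorem blockProducts_subset_triangle {idx : List ℕ} (h : ∀ k ∈ idx, 1 ≤ k ∧ k + 1 ≤ n) :
    blockProducts (block n) idx ⊆ blockProducts (block n) (triangleIdx (n - 1)) := by
  rw [blockProducts_eq_word, blockProducts_eq_word]
  refine (block_isHecke n).word_subset_triangle (fun k _ _ => one_mem_range_block n k) fun k hk => ?_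
  have := h k hk
  omega

/-- The group of all circuits made of blocks. -/
noncomputable def circuitGroup (n : ℕ) : Submonoid (Op n) :=
  Submonoid.closure {x | ∃ k, 1 ≤ k ∧ k ≤ n - 1 ∧ x ∈ Set.range (block n k)}

theorem circuitGroup_eq_triangle (n : ℕ) :
    (circuitGroup n : Set (Op n)) = blockProducts (block n) (triangleIdx (n - 1)) := by
  rw [blockProducts_eq_word]
  exact (block_isHecke n).closure_eq_triangle fun k _ _ => one_mem_range_block n k

theorem mem_triangle_inter_square {U : Op n} (hU : U ∈ circuitGroup n) :
    U ∈ blockProducts (block n) (triangleIdx (n - 1)) ∩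
      blockProducts (block n) (squareIdx (n - 1)) := by
  rw [← blockProducts_triangle_eq_square, Set.inter_self, ← circuitGroup_eq_triangle]
  exact hU

theorem range_block_subset_circuitGroup {k : ℕ} (h1 : 1 ≤ k) (h2 : k + 1 ≤ n) :
    Set.range (block n k) ⊆ circuitGroup n :=
  fun _ hx => Submonoid.subset_closure ⟨k, h1, by omega, hx⟩

end ThreeSites

end TFXY

namespace TFXY

variable {n j : ℕ}

/-! ### Trotter steps of the generalized TFXY Hamiltonian -/

theorem g2Basis_mem_g2 (hj : j + 1 < n) (k : Fin 6) : g2Basis n (j + 1) k ∈ g2 n (j + 1) := by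
  rw [← LieSubalgebra.mem_toSubmodule, g2_toSubmodule hj, ← (g2Basis_isBivBasis hj).span_eq]
  exact Submodule.subset_span ⟨k, rfl⟩

theorem rot_mem_expGroup {g : LieSubalgebra ℝ (Op n)} {P : Op n} (hP : Complex.I • P ∈ g) (t : ℝ) :
    rot P t ∈ expGroup g :=
  Submonoid.subset_closure ⟨(-t) • (Complex.I • P), g.smul_mem _ hP, (rot_eq_exp_real P t).symm⟩

/-- The Pauli strings assigned to the block `k` in the zigzag order. -/
def bondTerms (n k : ℕ) : List (Kind × ℕ) :=
  [(Kind.xx, k), (Kind.yy, k), (Kind.xy, k), (Kind.yx, k), (Kind.z, k)] ++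
    if k + 1 = n then [(Kind.z, n)] else []

theorem I_smul_pauliTerm_mem (hj : j + 1 < n) {τ : Kind × ℕ} (hτ : τ ∈ bondTerms n (j + 1)) :
    Complex.I • pauliTerm n τ ∈ g2 n (j + 1) := by
  have hm := g2Basis_mem_g2 hj
  rw [bondTerms, List.mem_append] at hτ
  rcases hτ with hτ | hτ
  · simp only [List.mem_cons, List.not_mem_nil, or_false] at hτ
    rcases hτ with rfl | rfl | rfl | rfl | rfl
    · exact hm 0
    · exact hm 1
    · exact hm 2
    · exact hm 3
    · exact hm 4
  · split_ifs at hτ with h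
    · rw [List.mem_singleton] at hτ
      subst hτ h
      exact hm 5
    · simp at hτ

theorem rot_pauliTerm_mem (hj : j + 1 < n) {τ : Kind × ℕ} (hτ : τ ∈ bondTerms n (j + 1)) (t : ℝ) :
    rot (pauliTerm n τ) t ∈ expGroup (g2 n (j + 1)) :=
  rot_mem_expGroup (I_smul_pauliTerm_mem hj hτ) t

theorem mem_zigzagIdx {N k : ℕ} : k ∈ zigzagIdx N ↔ 1 ≤ k ∧ k ≤ N := by
  simp only [zigzagIdx, List.mem_append, List.mem_filter, List.mem_range'_1, decide_eq_true_eq]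
  omega

theorem nodup_zigzagIdx (N : ℕ) : (zigzagIdx N).Nodup := by
  have h : (List.range' 1 N).Nodup := List.nodup_range'
  refine List.nodup_append'.2 ⟨h.filter _, h.filter _, ?_⟩
  intro k h1 h2
  simp only [List.mem_filter, decide_eq_true_eq] at h1 h2
  omega

theorem mem_bondTerms {k i : ℕ} {κ : Kind} : (κ, i) ∈ bondTerms n k ↔
    i = k ∨ (κ = Kind.z ∧ i = n ∧ k + 1 = n) := by
  rw [bondTerms]
  split_ifs with h <;> cases κ <;> simp [h]

/-- Bond `k` takes the term `Z_k`, which leaves only `Z_n`; the last bond takes it as well, so each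
string occurs once. -/
theorem isTermOrder_zigzag (hn : 2 ≤ n) :
    IsTermOrder n ((zigzagIdx (n - 1)).flatMap (bondTerms n)) := by
  constructor
  · rw [List.nodup_flatMap]
    constructor
    · intro k hk
      rw [mem_zigzagIdx] at hk
      rw [bondTerms]
      split_ifs with h
      · simp; omega
      · simp
    · refine List.Pairwise.imp_of_mem ?_ (nodup_zigzagIdx (n - 1))
      intro a b ha hb hab
      rw [mem_zigzagIdx] at ha hb
      rintro ⟨κ, i⟩ h1 h2
      rw [mem_bondTerms] at h1 h2
      omega
  · rintro ⟨κ, i⟩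
    simp only [List.mem_flatMap, mem_zigzagIdx, mem_bondTerms]
    constructor
    · rintro ⟨k, hk, rfl | ⟨rfl, rfl, h⟩⟩
      · cases κ <;> simp only [IsTerm] <;> omega
      · simp only [IsTerm]; omega
    · intro h
      by_cases hi : i ≤ n - 1
      · refine ⟨i, ⟨?_, hi⟩, Or.inl rfl⟩
        cases κ <;> exact h.1
      · cases κ
        case z =>
          have h1 : 1 ≤ i ∧ i ≤ n := h
          exact ⟨n - 1, by omega, Or.inr ⟨rfl, by omega, by omega⟩⟩
        all_goals
          have h1 : 1 ≤ i ∧ i + 1 ≤ n := h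
          omega

section Trotter

open scoped Pointwise

theorem prod_map_flatMap_mem_word {M ι : Type*} [Monoid M] {r : ℕ → Set M} {idx : List ℕ}
    {g : ℕ → List ι} {f : ι → M} (h : ∀ k ∈ idx, ((g k).map f).prod ∈ r k) :
    ((idx.flatMap g).map f).prod ∈ word r idx := by
  induction idx with
  | nil => simp
  | cons k l ih =>
    rw [List.flatMap_cons, List.map_append, List.prod_append, word_cons]
    exact Set.mul_mem_mul (h k (by simp)) (ih fun m hm => h m (by simp [hm]))

/-- All factors assigned to one bond lie in its two-site group, so their product is a single block,
whatever the coefficients. -/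
theorem trotterStep_zigzag (h : Kind × ℕ → ℝ) (dt : ℝ) :
    trotterStep n h dt ((zigzagIdx (n - 1)).flatMap (bondTerms n)) ∈
      blockProducts (block n) (zigzagIdx (n - 1)) := by
  rw [blockProducts_eq_word, trotterStep]
  refine prod_map_flatMap_mem_word fun k hk => ?_
  rw [mem_zigzagIdx] at hk
  obtain ⟨a, rfl⟩ : ∃ a, k = a + 1 := ⟨k - 1, by omega⟩
  rw [range_block_eq_expGroup (by omega)]
  refine list_prod_mem fun x hx => ?_
  obtain ⟨τ, hτ, rfl⟩ := List.mem_map.1 hx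
  exact rot_pauliTerm_mem (by omega) hτ _

end Trotter

theorem expGroup_g2_le_circuitGroup (hj : j + 1 < n) :
    expGroup (g2 n (j + 1)) ≤ circuitGroup n := by
  rw [← SetLike.coe_subset_coe, ← range_block_eq_expGroup hj]
  exact range_block_subset_circuitGroup (by omega) (by omega)

/-- The order is irrelevant because each factor alone already lies in the group of some bond. -/
theorem trotterStep_mem_circuitGroup (hn : 2 ≤ n) (h : Kind × ℕ → ℝ) (dt : ℝ)
    {l : List (Kind × ℕ)} (hl : IsTermOrder n l) : trotterStep n h dt l ∈ circuitGroup n := by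
  refine list_prod_mem fun x hx => ?_
  obtain ⟨τ, hτ, rfl⟩ := List.mem_map.1 hx
  rw [hl.2, ← (isTermOrder_zigzag hn).2, List.mem_flatMap] at hτ
  obtain ⟨k, hk, hτ⟩ := hτ
  rw [mem_zigzagIdx] at hk
  obtain ⟨a, rfl⟩ : ∃ a, k = a + 1 := ⟨k - 1, by omega⟩
  exact expGroup_g2_le_circuitGroup (by omega) (rot_pauliTerm_mem (by omega) hτ _)

/-! ### Free fermions -/

theorem annih_eq (hj : j < n) :
    annih n (j + 1) = (1 / 2 : ℂ) • (maj n (2 * j + 1) + Complex.I • maj n (2 * j + 2)) := by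
  have h : annih n (j + 1) = strOp n (j + 1) ((1 / 2 : ℂ) • (pX + Complex.I • pY)) := by
    rw [annih, strOp, zString, site, tensorOp_mul]
    congr 1; funext k
    split_ifs <;> first | omega | simp
  rw [h, maj_odd, maj_even, strOp, site_smul (by omega) (by omega), site_add (by omega) (by omega),
    site_smul (by omega) (by omega), strOp, strOp, mul_smul_comm, mul_add, mul_smul_comm]

theorem maj_conjTranspose (n a : ℕ) : (maj n a).conjTranspose = maj n a := by
  have h : ∀ i {A : Matrix (Fin 2) (Fin 2) ℂ}, A.conjTranspose = A →
      (strOp n i A).conjTranspose = strOp n i A := by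
    intro i A hA
    rw [strOp, Matrix.conjTranspose_mul, site_conjTranspose, zString_conjTranspose, hA,
      (zString_commute_site le_rfl A).eq]
  rw [maj]
  split_ifs
  · exact h _ pX_conjTranspose
  · exact h _ pY_conjTranspose

theorem creat_eq (hj : j < n) :
    creat n (j + 1) = (1 / 2 : ℂ) • (maj n (2 * j + 1) - Complex.I • maj n (2 * j + 2)) := by
  rw [creat, annih_eq hj, Matrix.conjTranspose_smul, Matrix.conjTranspose_add,
    Matrix.conjTranspose_smul, maj_conjTranspose, maj_conjTranspose]
  simp [sub_eq_add_neg]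

theorem number_eq (hj : j < n) :
    creat n (j + 1) * annih n (j + 1) = (1 / 2 : ℝ) • ((1 : Op n) - Z n (j + 1)) := by
  have h := maj_anticomm (n := n) (a := 2 * j + 2) (b := 2 * j + 1) (by omega) (by omega) (by omega)
    (by omega) (by omega)
  rw [creat_eq hj, annih_eq hj]
  simp only [smul_mul_assoc, mul_smul_comm, sub_mul, mul_add, h, maj_mul_self, ← I_smul_Z hj,
    ← Complex.coe_smul]
  push_cast
  match_scalars <;> ring_nf <;> simp only [Complex.I_sq] <;> ring_nf

theorem hopPair_eq (hj : j + 1 < n) (α β : ℂ) : hopPair n (j + 1) α β =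
    ((α.re - β.re) / 2) • (X n (j + 1) * X n (j + 2)) +
      ((α.re + β.re) / 2) • (Y n (j + 1) * Y n (j + 2)) +
      ((β.im - α.im) / 2) • (X n (j + 1) * Y n (j + 2)) +
      ((β.im + α.im) / 2) • (Y n (j + 1) * X n (j + 2)) := by
  have anti : ∀ a b, a < b → 1 ≤ a → b ≤ 4 →
      maj n (2 * j + b) * maj n (2 * j + a) = -(maj n (2 * j + a) * maj n (2 * j + b)) :=
    fun a b h1 h2 h3 => maj_anticomm (by omega) (by omega) (by omega) (by omega) (by omega)
  have h31 := anti 1 3 (by omega) (by omega) (by omega)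
  have h41 := anti 1 4 (by omega) (by omega) (by omega)
  have h32 := anti 2 3 (by omega) (by omega) (by omega)
  have h42 := anti 2 4 (by omega) (by omega) (by omega)
  have hXX := (I_smul_XX hj).symm
  have hXY := (I_smul_XY hj).symm
  have hYX : maj n (2 * j + 1) * maj n (2 * j + 3) = -(Complex.I • (Y n (j + 1) * X n (j + 2))) := by
    rw [I_smul_YX hj, neg_neg]
  have hYY : maj n (2 * j + 1) * maj n (2 * j + 4) = -(Complex.I • (Y n (j + 1) * Y n (j + 2))) := by
    rw [I_smul_YY hj, neg_neg]
  have c1 := creat_eq (n := n) (j := j) (by omega)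
  have a1 := annih_eq (n := n) (j := j) (by omega)
  have c2 := creat_eq (n := n) (j := j + 1) (by omega)
  have a2 := annih_eq (n := n) (j := j + 1) (by omega)
  rw [show 2 * (j + 1) + 1 = 2 * j + 3 by ring, show 2 * (j + 1) + 2 = 2 * j + 4 by ring] at c2 a2
  have hα : star α = (α.re : ℂ) - α.im * Complex.I := by
    rw [Complex.star_def]; apply Complex.ext <;> simp
  have hβ : star β = (β.re : ℂ) - β.im * Complex.I := by
    rw [Complex.star_def]; apply Complex.ext <;> simp
  rw [hopPair, c1, a1, c2, a2, hα, hβ]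
  nth_rewrite 1 [← Complex.re_add_im α]
  nth_rewrite 1 [← Complex.re_add_im β]
  simp only [smul_mul_assoc, mul_smul_comm, sub_mul, mul_add, add_mul, mul_sub, h31, h41, h32, h42,
    hXX, hXY, hYX, hYY, ← Complex.coe_smul]
  push_cast
  match_scalars <;> ring_nf <;> simp only [Complex.I_sq, Complex.I_pow_four] <;>
    ring_nf

theorem exists_fermion_of_tfxy (n : ℕ) (h : Kind × ℕ → ℝ) :
    ∃ (α β : ℕ → ℂ) (γ : ℕ → ℝ) (e : ℝ),
      tfxyHamiltonian n h = fermionHamiltonian n α β γ + e • (1 : Op n) := by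
  -- These invert the coefficients in `hopPair_eq`. Since the number operator is `(1 - Z)/2`, a
  -- field `h Z` needs occupation `-2h` and the shift `h`.
  refine ⟨fun i => ⟨h (Kind.xx, i) + h (Kind.yy, i), h (Kind.yx, i) - h (Kind.xy, i)⟩,
    fun i => ⟨h (Kind.yy, i) - h (Kind.xx, i), h (Kind.yx, i) + h (Kind.xy, i)⟩,
    fun i => -2 * h (Kind.z, i), ∑ i ∈ Finset.Icc 1 n, h (Kind.z, i), ?_⟩
  rw [tfxyHamiltonian, fermionHamiltonian, add_assoc, Finset.sum_smul, ← Finset.sum_add_distrib]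
  congr 1
  · refine Finset.sum_congr rfl fun i hi => ?_
    rw [Finset.mem_Icc] at hi
    obtain ⟨a, rfl⟩ : ∃ a, i = a + 1 := ⟨i - 1, by omega⟩
    rw [hopPair_eq (by omega)]
    module
  · refine Finset.sum_congr rfl fun i hi => ?_
    rw [Finset.mem_Icc] at hi
    obtain ⟨a, rfl⟩ : ∃ a, i = a + 1 := ⟨i - 1, by omega⟩
    rw [number_eq (by omega)]
    module

theorem exists_tfxy_of_fermion (n : ℕ) (α β : ℕ → ℂ) (γ : ℕ → ℝ) :
    ∃ (h : Kind × ℕ → ℝ) (e : ℝ),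
      fermionHamiltonian n α β γ = tfxyHamiltonian n h + e • (1 : Op n) := by
  refine ⟨fun
    | (Kind.xx, i) => ((α i).re - (β i).re) / 2
    | (Kind.yy, i) => ((α i).re + (β i).re) / 2
    | (Kind.xy, i) => ((β i).im - (α i).im) / 2
    | (Kind.yx, i) => ((β i).im + (α i).im) / 2
    | (Kind.z, i) => -(γ i / 2), ∑ i ∈ Finset.Icc 1 n, γ i / 2, ?_⟩
  rw [tfxyHamiltonian, fermionHamiltonian, add_assoc, Finset.sum_smul, ← Finset.sum_add_distrib]
  congr 1
  · refine Finset.sum_congr rfl fun i hi => ?_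
    rw [Finset.mem_Icc] at hi
    obtain ⟨a, rfl⟩ : ∃ a, i = a + 1 := ⟨i - 1, by omega⟩
    rw [hopPair_eq (by omega)]
  · refine Finset.sum_congr rfl fun i hi => ?_
    rw [Finset.mem_Icc] at hi
    obtain ⟨a, rfl⟩ : ∃ a, i = a + 1 := ⟨i - 1, by omega⟩
    rw [number_eq (by omega)]
    module

theorem rot_add_smul_one (T : Op n) (e t : ℝ) :
    rot (T + e • (1 : Op n)) t = Complex.exp (Complex.I * ((-(t * e) : ℝ) : ℂ)) • rot T t := by
  have h : (-(Complex.I * (t : ℂ))) • (T + e • (1 : Op n)) = (-(Complex.I * (t : ℂ))) • T +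
      (Complex.I * ((-(t * e) : ℝ) : ℂ)) • (1 : Op n) := by
    rw [← Complex.coe_smul]
    push_cast
    module
  rw [rot, h, Matrix.exp_add_of_commute _ _ ((Commute.one_right _).smul_right _), exp_smul_one,
    mul_smul_comm, mul_one, rot]

/-- Circuits made of blocks, up to a global phase. -/
noncomputable def phaseCircuitGroup (n : ℕ) : Submonoid (Op n) where
  carrier := {x | ∃ φ : ℝ, ∃ U ∈ circuitGroup n, x = Complex.exp (Complex.I * φ) • U}
  mul_mem' := by
    rintro _ _ ⟨φ, U, hU, rfl⟩ ⟨ψ, V, hV, rfl⟩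
    refine ⟨φ + ψ, U * V, mul_mem hU hV, ?_⟩
    rw [smul_mul_smul_comm, ← Complex.exp_add]
    congr 2; push_cast; ring
  one_mem' := ⟨0, 1, one_mem _, by simp⟩

/-- A bond term minus half the sum of its two occupations lies, after multiplication by `i`, in the
two-site algebra. Its exponential is therefore a single block times a phase, with no splitting into
Pauli strings. -/
theorem rot_bondTerm_mem {p : BondTerm} (h1 : 1 ≤ p.bond) (h2 : p.bond + 1 ≤ n) (t : ℝ) :
    rot (p.op n) t ∈ phaseCircuitGroup n := by
  obtain ⟨b, α, β, l, r⟩ := p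
  obtain ⟨a, rfl⟩ : ∃ a, b = a + 1 := ⟨b - 1, by simp only at h1; omega⟩
  simp only at h2
  have hj : a + 1 < n := by omega
  have hop : BondTerm.op n ⟨a + 1, α, β, l, r⟩ = (((α.re - β.re) / 2) • (X n (a + 1) * X n (a + 2)) +
      ((α.re + β.re) / 2) • (Y n (a + 1) * Y n (a + 2)) +
      ((β.im - α.im) / 2) • (X n (a + 1) * Y n (a + 2)) +
      ((β.im + α.im) / 2) • (Y n (a + 1) * X n (a + 2)) + (-(l / 2)) • Z n (a + 1) +
      (-(r / 2)) • Z n (a + 2)) + ((l + r) / 2) • (1 : Op n) := by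
    rw [BondTerm.op]
    simp only
    rw [hopPair_eq hj, number_eq (by omega), number_eq hj]
    module
  rw [hop, rot_add_smul_one]
  refine ⟨_, _, expGroup_g2_le_circuitGroup hj (rot_mem_expGroup ?_ t), rfl⟩
  have hm := g2Basis_mem_g2 hj
  simp only [smul_add, smul_comm Complex.I (_ : ℝ)]
  exact add_mem (add_mem (add_mem (add_mem (add_mem ((g2 n (a + 1)).smul_mem _ (hm 0))
    ((g2 n (a + 1)).smul_mem _ (hm 1))) ((g2 n (a + 1)).smul_mem _ (hm 2)))
    ((g2 n (a + 1)).smul_mem _ (hm 3))) ((g2 n (a + 1)).smul_mem _ (hm 4)))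
    ((g2 n (a + 1)).smul_mem _ (hm 5))

theorem fermionTrotterStep_mem {l : List BondTerm} {H : Op n} (hl : IsBondSplitting n l H)
    (dt : ℝ) : fermionTrotterStep n dt l ∈ phaseCircuitGroup n := by
  refine list_prod_mem fun x hx => ?_
  obtain ⟨p, hp, rfl⟩ := List.mem_map.1 hx
  exact rot_bondTerm_mem (hl.1 p hp).1 (hl.1 p hp).2 dt

theorem list_ofFn_reverse_prod_mem {M : Type*} [Monoid M] {S : Submonoid M} {r : ℕ} {f : Fin r → M}
    (h : ∀ k, f k ∈ S) : (List.ofFn f).reverse.prod ∈ S := by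
  refine list_prod_mem fun x hx => ?_
  rw [List.mem_reverse, List.mem_ofFn] at hx
  obtain ⟨k, rfl⟩ := hx
  exact h k

end TFXY

/-! ### Assembly of the theorem. -/

theorem mainTheorem9 (n : ℕ) (hn : 2 ≤ n) :
    -- the TFXY mapping is a block, and the turnover also holds in the reverse direction
    IsBlock (n - 1) (block n) ∧
    (∀ i, 1 ≤ i → i + 2 ≤ n → ∀ α β γ, ∃ a b c,
      block n (i + 1) α * block n i β * block n (i + 1) γ =
        block n i a * block n (i + 1) b * block n i c) ∧
    -- the two-site algebra splits as `su(2) ⊕ su(2)`, and blocks are exactly the elements of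
    -- its group
    (∀ i, 1 ≤ i → i + 1 ≤ n →
      LinearIndependent ℝ (g2Basis n i) ∧
      (g2 n i).toSubmodule = Submodule.span ℝ (Set.range (g2Basis n i)) ∧
      (gPlus n i).toSubmodule = Submodule.span ℝ (Set.range (gPlusBasis n i)) ∧
      (gMinus n i).toSubmodule = Submodule.span ℝ (Set.range (gMinusBasis n i)) ∧
      Nonempty (gPlus n i ≃ₗ⁅ℝ⁆ su2) ∧ Nonempty (gMinus n i ≃ₗ⁅ℝ⁆ su2) ∧
      (∀ x ∈ gPlus n i, ∀ y ∈ gMinus n i, ⁅x, y⁆ = 0) ∧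
      (gPlus n i).toSubmodule ⊔ (gMinus n i).toSubmodule = (g2 n i).toSubmodule ∧
      Disjoint (gPlus n i).toSubmodule (gMinus n i).toSubmodule ∧
      Set.range (block n i) = ((expGroup (g2 n i) : Submonoid (Op n)) : Set (Op n))) ∧
    -- the three-site algebra, its two Cartan decompositions, and the three descriptions of its
    -- group: `B_i B_{i+1} B_i`, `B_{i+1} B_i B_{i+1}` and TFIM triangles on three qubits
    (∀ i, 1 ≤ i → i + 2 ≤ n →
      LinearIndependent ℝ (g3Basis n i) ∧
      (g3 n i).toSubmodule = Submodule.span ℝ (Set.range (g3Basis n i)) ∧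
      (∀ x, (x ∈ g3 n i ∧ Z n (i + 2) * x * Z n (i + 2) = x) ↔
        x ∈ (g2 n i).toSubmodule ⊔ Submodule.span ℝ {Complex.I • Z n (i + 2)}) ∧
      (∀ x, (x ∈ g3 n i ∧ Z n i * x * Z n i = x) ↔
        x ∈ (g2 n (i + 1)).toSubmodule ⊔ Submodule.span ℝ {Complex.I • Z n i}) ∧
      (∀ G ∈ expGroup (g3 n i), ∃ k₁ ∈ g3 n i, ∃ k₂ ∈ g3 n i,
        Z n (i + 2) * k₁ * Z n (i + 2) = k₁ ∧ Z n (i + 2) * k₂ * Z n (i + 2) = k₂ ∧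
        ∃ h ∈ Submodule.span ℝ {Complex.I • (X n (i + 1) * X n (i + 2)),
            Complex.I • (Y n (i + 1) * Y n (i + 2))},
          G = NormedSpace.exp k₁ * NormedSpace.exp h * NormedSpace.exp k₂) ∧
      (∀ G ∈ expGroup (g3 n i), ∃ k₁ ∈ g3 n i, ∃ k₂ ∈ g3 n i,
        Z n i * k₁ * Z n i = k₁ ∧ Z n i * k₂ * Z n i = k₂ ∧
        ∃ h ∈ Submodule.span ℝ {Complex.I • (X n i * X n (i + 1)),
            Complex.I • (Y n i * Y n (i + 1))},
          G = NormedSpace.exp k₁ * NormedSpace.exp h * NormedSpace.exp k₂) ∧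
      blockProducts (block n) [i, i + 1, i] = expGroup (g3 n i) ∧
      blockProducts (block n) [i + 1, i, i + 1] = expGroup (g3 n i) ∧
      blockProducts (fun k => tfimBlock n (2 * i - 2 + k)) (triangleIdx 5) =
        expGroup (g3 n i)) ∧
    -- size and depth of the triangle and of the square
    (triangleIdx (n - 1)).length = n * (n - 1) / 2 ∧
    (squareIdx (n - 1)).length = n * (n - 1) / 2 ∧
    HasDepthLE (triangleIdx (n - 1)) (2 * n - 3) ∧
    HasDepthLE (squareIdx (n - 1)) n ∧
    -- every circuit made of blocks compresses to a triangle and to a square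
    (∀ idx : List ℕ, (∀ k ∈ idx, 1 ≤ k ∧ k + 1 ≤ n) →
      blockProducts (block n) idx ⊆ blockProducts (block n) (triangleIdx (n - 1)) ∧
      blockProducts (block n) idx ⊆ blockProducts (block n) (squareIdx (n - 1))) ∧
    -- a suitably ordered Trotter step of the generalized TFXY Hamiltonian is a zigzag
    (∃ l, IsTermOrder n l ∧ ∀ (h : Kind × ℕ → ℝ) (dt : ℝ),
      trotterStep n h dt l ∈ blockProducts (block n) (zigzagIdx (n - 1))) ∧
    -- time-dependent Trotter circuits with any number of steps and any orders compress
    (∀ (r : ℕ) (h : Fin r → Kind × ℕ → ℝ) (dt : Fin r → ℝ) (l : Fin r → List (Kind × ℕ)),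
      (∀ k, IsTermOrder n (l k)) →
      (List.ofFn fun k => trotterStep n (h k) (dt k) (l k)).reverse.prod ∈
        blockProducts (block n) (triangleIdx (n - 1)) ∩
          blockProducts (block n) (squareIdx (n - 1))) ∧
    -- the generalized TFXY Hamiltonians are the nearest-neighbour free-fermion Hamiltonians, up to
    -- a multiple of the identity
    (∀ h : Kind × ℕ → ℝ, ∃ (α β : ℕ → ℂ) (γ : ℕ → ℝ) (e : ℝ),
      tfxyHamiltonian n h = fermionHamiltonian n α β γ + e • (1 : Op n)) ∧
    (∀ (α β : ℕ → ℂ) (γ : ℕ → ℝ), ∃ (h : Kind × ℕ → ℝ) (e : ℝ),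
      fermionHamiltonian n α β γ = tfxyHamiltonian n h + e • (1 : Op n)) ∧
    -- Trotter circuits of free-fermion Hamiltonians compress, up to a global phase
    (∀ (r : ℕ) (α β : Fin r → ℕ → ℂ) (γ : Fin r → ℕ → ℝ) (dt : Fin r → ℝ)
      (l : Fin r → List BondTerm),
      (∀ k, IsBondSplitting n (l k) (fermionHamiltonian n (α k) (β k) (γ k))) →
      ∃ (φ : ℝ) (U : Op n),
        U ∈ blockProducts (block n) (triangleIdx (n - 1)) ∩
          blockProducts (block n) (squareIdx (n - 1)) ∧
        (List.ofFn fun k => fermionTrotterStep n (dt k) (l k)).reverse.prod =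
          Complex.exp (Complex.I * φ) • U) := by
  refine ⟨block_isBlock n, fun i h1 h2 => block_turnover_reverse h1 h2, ?_, ?_, ?_, ?_, ?_, ?_, ?_,
    ⟨_, isTermOrder_zigzag hn, trotterStep_zigzag⟩, ?_, exists_fermion_of_tfxy n,
    exists_tfxy_of_fermion n, ?_⟩
  · intro i h1 h2
    -- The lemmas count qubits from `j + 1`, so that the Majorana indices `2 * j + 1, 2 * j + 2, …`
    -- involve no subtraction.
    obtain ⟨j, rfl⟩ : ∃ j, i = j + 1 := ⟨i - 1, by omega⟩
    have hj : j + 1 < n := by omega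
    obtain ⟨s1, s2, s3, s4, s5, s6, s7, s8, s9⟩ := g2_structure hj
    exact ⟨s1, s2, s3, s4, s5, s6, s7, s8, s9, range_block_eq_expGroup hj⟩
  · intro i h1 h2
    obtain ⟨j, rfl⟩ : ∃ j, i = j + 1 := ⟨i - 1, by omega⟩
    have hj : j + 2 < n := by omega
    refine ⟨(g3Basis_isBivBasis hj).linearIndependent, ?_, fixedPoints_g3_right hj,
      fixedPoints_g3_left hj, fun G hG => cartan_right hj hG, fun G hG => cartan_left hj hG,
      blockProducts_left_right_left hj, blockProducts_right_left_right hj,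
      blockProducts_tfim_triangle hj⟩
    rw [g3_toSubmodule hj, (g3Basis_isBivBasis hj).span_eq]
  · rw [length_triangleIdx, show n - 1 + 1 = n by omega]
  · rw [length_squareIdx, show n - 1 + 1 = n by omega]
  · have h := hasDepthLE_triangleIdx (n - 1)
    rwa [show 2 * (n - 1) - 1 = 2 * n - 3 by omega] at h
  · have h := hasDepthLE_squareIdx (n - 1)
    rwa [show n - 1 + 1 = n by omega] at h
  · intro idx h
    rw [← blockProducts_triangle_eq_square]
    exact ⟨blockProducts_subset_triangle h, blockProducts_subset_triangle h⟩
  · intro r h dt l hl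
    exact mem_triangle_inter_square (list_ofFn_reverse_prod_mem fun k =>
      trotterStep_mem_circuitGroup hn (h k) (dt k) (hl k))
  · intro r α β γ dt l hl
    obtain ⟨φ, U, hU, h⟩ := list_ofFn_reverse_prod_mem (S := phaseCircuitGroup n)
      fun k => fermionTrotterStep_mem (hl k) (dt k)
    exact ⟨φ, U, mem_triangle_inter_square hU, h⟩
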